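/- Write $\log$ for the natural logarithm and, for $0\le p\le 1$, let $G(N,p)$ be the random graph on the vertex set $[N]=\{1,\dots,N\}$ in which each possible edge is present independently with probability $p$. For $n\in\mathbb{N}$ put $\lambda_0(n)=n\log\log n/\log^2 n$. A matching between two disjoint vertex sets $A$ and $B$ is a set of disjoint edges, each with one end in $A$ and the other in $B$, covering $A\cup B$. The length of a path is its number of edges. Let $G$ be a graph, let $\lambda,n\in\mathbb{N}$ and let $R\subset V(G)$ with $|R|=6\lambda$. We use two kinds of $\lambda$-device for $R$ in $G$. (i) A $\lambda$-device of matching type is a pair of disjoint sets $W_0,W_1\subset V(G)\setminus R$ with $9\lambda\le |W_0|\le 10^3\lambda$ and $|W_1|=|W_0|-3\lambda$ such that, for every $U\subset R$ with $|U|=|R|/2=3\lambda$, there is a matching between $W_0$ and $W_1\cup U$ in $G$. (ii) For $l\in\mathbb{N}$, a $\lambda$-device of path type with parameter $l$ is a set $X\subset V(G)\setminus R$ with $|X|=9\lambda l-3\lambda$ together with pairs $(x_i,y_i)$, $i\in[9\lambda]$, consisting of $18\lambda$ distinct vertices of $X$, such that, for every $U\subset R$ with $|U|=|R|/2=3\lambda$,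 there are vertex-disjoint paths $P_i$, $i\in[9\lambda]$, in $G[X\cup U]$, where $P_i$ is an $x_i,y_i$-path of length $l-1$; together these paths then cover $X\cup U$ exactly. Lemma. There is a function $f:\mathbb{N}\to\mathbb{R}$ with $f(n)=o(n^{-1})$ as $n\to\infty$ such that the following holds. Let $\lambda,n,n'\in\mathbb{N}$ satisfy $\lambda_0(n)\le\lambda\le n/(100\log n)$ and $n'\ge 3n/4$, let $R\subset[n']$ satisfy $|R|=6\lambda$, and suppose that $p=10^5\log n/n$ lies in $[0,1]$ (as it does for all large $n$). Then, with probability at least $1-f(n)$, the random graph $G=G(n',p)$ has the following property. - If $\lambda>\lambda_0(n)$, then $G$ contains a $\lambda$-device of matching type for $R$. - If $\lambda=\lambda_0(n)$ up to rounding, that is, $\lambda=\lceil\lambda_0(n)\rceil$, then $G$ contains a $\lambda$-device of path type for $R$ with parameter $l$, for each of the two roundings $l=\lfloor 10^4\log^2 n/(\log\log n)^2\rfloor$ and $l=\lceil 10^4\log^2 n/(\log\log n)^2\rceil$. -/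

import Mathlib

namespace LambdaDevice

/-- The lower end `n log log n / log² n` of the range of `lam`. -/
noncomputable def lowerEnd (n : ℕ) : ℝ :=
  n * Real.log (Real.log n) / Real.log n ^ 2

/-- The real number `10⁴ log² n / (log log n)²`; its rounding is the number of vertices of the
paths in a path device. -/
noncomputable def pathOrder (n : ℕ) : ℝ :=
  10 ^ 4 * Real.log n ^ 2 / Real.log (Real.log n) ^ 2

/-- There is a matching between `A` and `B` in `G`: the sets are disjoint, and some bijection from
`A` to `B` sends each vertex of `A` to one of its neighbours (so `A` and `B` are both covered). -/
def HasMatchingBetween {V : Type*} (G : SimpleGraph V) (A B : Finset V) : Prop :=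
  Disjoint A B ∧
    ∃ f : V → V, Set.BijOn f (A : Set V) (B : Set V) ∧ ∀ a ∈ A, G.Adj a (f a)

/-- `(W₀, W₁)` is a `lam`-device of matching type for `R` in `G`. -/
structure IsMatchingDevice {V : Type*} [DecidableEq V] (G : SimpleGraph V) (lam : ℕ)
    (R W₀ W₁ : Finset V) : Prop where
  disjoint_left : Disjoint W₀ R
  disjoint_right : Disjoint W₁ R
  le_card : 9 * lam ≤ W₀.card
  card_le : W₀.card ≤ 10 ^ 3 * lam
  card_eq : W₁.card + 3 * lam = W₀.card
  matching : ∀ U ⊆ R, U.card = 3 * lam → HasMatchingBetween G W₀ (W₁ ∪ U)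

/-- `(X, {(x i, y i)})` is a `lam`-device of path type for `R` in `G`, where the paths have `l`
vertices each, that is, length `l - 1`. The last clause says that the paths cover `X ∪ U`, so
together they cover it exactly. -/
structure IsPathDevice {V : Type*} [DecidableEq V] (G : SimpleGraph V) (lam l : ℕ)
    (R X : Finset V) (x y : Fin (9 * lam) → V) : Prop where
  disjoint : Disjoint X R
  x_mem : ∀ i, x i ∈ X
  y_mem : ∀ i, y i ∈ X
  /-- the `18 * lam` vertices `x i`, `y i` are distinct -/
  injective : Function.Injective (Sum.elim x y)
  card_eq : X.card + 3 * lam = 9 * lam * l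
  paths : ∀ U ⊆ R, U.card = 3 * lam →
    ∃ P : ∀ i, G.Walk (x i) (y i),
      (∀ i, (P i).IsPath ∧ (P i).length + 1 = l ∧ ∀ v ∈ (P i).support, v ∈ X ∪ U) ∧
      (∀ i j, i ≠ j → List.Disjoint (P i).support (P j).support) ∧
      ∀ v ∈ X ∪ U, ∃ i, v ∈ (P i).support

/-- `G` contains a `lam`-device for `R` (with respect to the parameter `n`): one of matching type
if `lam` exceeds the lower end, and one of path type if `lam` is the lower end, rounded up to an
integer. At an integer `lam` that is the lower end rounded up but is not equal to it, both types
are required; the number of vertices of the paths may be rounded either way. -/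
def HasDevice {V : Type*} [DecidableEq V] (G : SimpleGraph V) (n lam : ℕ) (R : Finset V) : Prop :=
  (lowerEnd n < lam → ∃ W₀ W₁ : Finset V, IsMatchingDevice G lam R W₀ W₁) ∧
  (lam = ⌈lowerEnd n⌉₊ →
    ∀ l : ℕ, (l = ⌊pathOrder n⌋₊ ∨ l = ⌈pathOrder n⌉₊) →
      ∃ (X : Finset V) (x y : Fin (9 * lam) → V), IsPathDevice G lam l R X x y)

end LambdaDevice

/-! Both devices realise one template inside `G`. The template is a bipartite graph between `9λ`
elements and `Y ∪ R`, where `Y` consists of `6λ` further vertices, such that for every half `U` of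
`R` the `9λ` elements can be matched to `Y ∪ U`. It is given by twenty maps from `Y ∪ R` to the `9λ`
elements and twenty maps from these to `Y`. If no small set has fewer images than members, Hall's
condition holds for all `U` at once: small sets use the maps into `Y`, large ones the maps out of `Y
∪ U` (`exists_matching_of_expands`). Random maps have this property by a union bound over obstacles,
that is, `b` sources with all images among `b - 1` targets (`obstacle_term_le`).

Matching type. The template is found in `G` itself. Every vertex of `Y ∪ R ∪ C`, with `C` playing
the `9λ` elements, grows twenty disjoint trees of depth two into reserved sets (`exists_sprouts`),
so that a leaf set has many expected neighbours in `C` and in `Y`. The edges leaving the leaves have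
not been inspected. The first vertex met by a leaf set, in a cyclic order with a well-chosen start,
behaves like a uniform random image up to a factor `11/10`, so the same union bound applies
(`gnp_not_expands_le`). A template edge `c r` is thereby a path `c q p r`. Matching `c q` and `p r`
on the selected edges and `p q` on all others gives the required matchings
(`isMatchingDevice_of_subdivision`).

Path type. The template is obtained by counting, with maximum degree 60 on both sides. Its element
`i` becomes a path from `x i` to `y i` that can take in any one of the template neighbours of `i`,
and a template matching for `U` says which one. Such a path is a chain of absorbers
(`State.exists_chain`), where an absorber for `r` is a vertex set spanned by a path with the same
two ends whether or not `r` is added (`State.exists_absorber`). All of this is assembled from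
vertex-disjoint links between prescribed vertices (`State.exists_link`). To find a link, two large
trees are grown in the manner of Friedman and Pippenger (`Extendable.exists_leaf`), an edge between
their last levels is used, and everything except the connecting path is given back
(`Extendable.rollback`). A link thus costs only logarithmically many vertices.

The two properties of `G` that are needed, expansion of small sets by about `log n` and an edge
between any two disjoint sets of about `n / √(log n)` vertices, fail with probability at most `n⁻³`.
The dominant error is `2 / λ²`, of order at most `log⁴ n / n²`, from the matching device; this is
`o(n⁻¹)`. -/

namespace LambdaDevice

set_option linter.unusedSectionVars false

section

open Finset

variable {V : Type*} [DecidableEq V]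

/-! ### Paths given by their end-vertices and vertex sets -/

/-- `HamPath G a b S`: there is a path in `G` from `a` to `b` with vertex set `S`. -/
inductive HamPath (G : SimpleGraph V) : V → V → Finset V → Prop
  | single (a : V) : HamPath G a a {a}
  | cons {a b c : V} {S : Finset V} (hab : G.Adj a b) (ha : a ∉ S) (h : HamPath G b c S) :
      HamPath G a c (insert a S)

namespace HamPath

variable {G : SimpleGraph V} {a b c d : V} {S T : Finset V}

theorem left_mem (h : HamPath G a b S) : a ∈ S := by
  cases h <;> simp

theorem right_mem (h : HamPath G a b S) : b ∈ S := by
  induction h with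
  | single a => simp
  | cons _ _ _ ih => exact mem_insert_of_mem ih

theorem append (h : HamPath G a b S) (hbc : G.Adj b c) (h' : HamPath G c d T)
    (hST : Disjoint S T) : HamPath G a d (S ∪ T) := by
  induction h with
  | single a =>
    rw [← insert_eq]
    exact .cons hbc (by simpa using hST) h'
  | @cons x y z S hxy hx _ ih =>
    rw [insert_union]
    rw [disjoint_insert_left] at hST
    exact .cons hxy (by simp [hx, hST.1]) (ih hbc hST.2)

theorem snoc (h : HamPath G a b S) (hbc : G.Adj b c) (hc : c ∉ S) :
    HamPath G a c (insert c S) := by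
  rw [insert_eq, union_comm]
  exact h.append hbc (.single c) (by simpa using hc)

theorem symm (h : HamPath G a b S) : HamPath G b a S := by
  induction h with
  | single a => exact .single a
  | cons hab ha _ ih => exact ih.snoc hab.symm ha

theorem exists_walk (h : HamPath G a b S) :
    ∃ w : G.Walk a b, w.IsPath ∧ w.length + 1 = #S ∧ ∀ v, v ∈ w.support ↔ v ∈ S := by
  induction h with
  | single a => exact ⟨.nil, by simp⟩
  | cons hab ha _ ih =>
    obtain ⟨w, h1, h2, h3⟩ := ih
    refine ⟨.cons hab w, ?_, ?_, ?_⟩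
    · rw [SimpleGraph.Walk.cons_isPath_iff]
      exact ⟨h1, by rwa [h3]⟩
    · rw [card_insert_of_notMem ha, SimpleGraph.Walk.length_cons, h2]
    · intro v
      simp [h3]

end HamPath

/-! ### Extendable states -/

open Classical in
/-- The vertices of `F` with a neighbour in `U`. -/
noncomputable def nbrIn (G : SimpleGraph V) (F U : Finset V) : Finset V :=
  {y ∈ F | ∃ u ∈ U, G.Adj u y}

variable {G : SimpleGraph V} {A F F' T U U' L X : Finset V} {m d K t h : ℕ} {g g' : V → ℕ}

@[simp]
theorem mem_nbrIn {y : V} : y ∈ nbrIn G F U ↔ y ∈ F ∧ ∃ u ∈ U, G.Adj u y := by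
  simp [nbrIn]

theorem nbrIn_mono_left (h : F ⊆ F') : nbrIn G F U ⊆ nbrIn G F' U := by
  intro y; simp only [mem_nbrIn]; exact fun ⟨a, b⟩ => ⟨h a, b⟩

theorem nbrIn_mono_right (h : U ⊆ U') : nbrIn G F U ⊆ nbrIn G F U' := by
  intro y; simp only [mem_nbrIn]; exact fun ⟨a, u, b, c⟩ => ⟨a, u, h b, c⟩

theorem nbrIn_union : nbrIn G F (U ∪ U') = nbrIn G F U ∪ nbrIn G F U' := by
  ext y; simp only [mem_nbrIn, mem_union]; grind

theorem nbrIn_inter_subset : nbrIn G F (U ∩ U') ⊆ nbrIn G F U ∩ nbrIn G F U' := by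
  intro y; simp only [mem_nbrIn, mem_inter]; grind

/-- Every set of at most `2m` vertices of `A` has as many neighbours in the free set `F` as its
vertices demand. -/
def Extendable (G : SimpleGraph V) (A : Finset V) (m : ℕ) (F : Finset V) (g : V → ℕ) : Prop :=
  ∀ U ⊆ A, #U ≤ 2 * m → ∑ x ∈ U, g x ≤ #(nbrIn G F U)

theorem Extendable.anti (hE : Extendable G A m F g) (hg : ∀ x, g' x ≤ g x) :
    Extendable G A m F g' :=
  fun U hU hc => (sum_le_sum fun x _ => hg x).trans (hE U hU hc)

/-- Submodularity of the number of neighbours: the intersection is not deficient, so the union of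
two sets whose neighbours are used up by their demands is again such a set. -/
theorem Extendable.union_tight (hE : Extendable G A m F g) (hU : U ⊆ A)
    (hc : #(U ∪ U') ≤ 2 * m) (h : #(nbrIn G F U) ≤ ∑ x ∈ U, g x)
    (h' : #(nbrIn G F U') ≤ ∑ x ∈ U', g x) :
    #(nbrIn G F (U ∪ U')) ≤ ∑ x ∈ U ∪ U', g x := by
  have h1 := hE (U ∩ U') (inter_subset_left.trans hU)
    ((card_le_card (inter_subset_left.trans subset_union_left)).trans hc)
  have h2 := card_le_card (nbrIn_inter_subset (G := G) (F := F) (U := U) (U' := U'))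
  have h3 := card_union_add_card_inter (nbrIn G F U) (nbrIn G F U')
  have h4 := sum_union_inter (s₁ := U) (s₂ := U') (f := g)
  rw [nbrIn_union]
  omega

/-- One free neighbour of `s` can be spent on `s`. -/
theorem Extendable.exists_leaf (hE : Extendable G A m F g) (hm : 1 ≤ m)
    (hbig : ∀ U ⊆ A, m ≤ #U → #U ≤ 2 * m → ∑ x ∈ U, g x < #(nbrIn G F U))
    {s : V} (hs : s ∈ A) (hgs : 1 ≤ g s) :
    ∃ y ∈ F, G.Adj s y ∧ Extendable G A m (F.erase y) (Function.update g s (g s - 1)) := by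
  -- If no neighbour `y` of `s` can be spent, each `y` is seen by a tight set `U` that avoids `s`.
  -- Since sets of `m` to `2m` vertices have slack, `U` has fewer than `m` vertices.
  by_contra! hcon
  have key : ∀ y ∈ nbrIn G F {s}, ∃ U ⊆ A, #U < m ∧ s ∉ U ∧ y ∈ nbrIn G F U ∧
      #(nbrIn G F U) ≤ ∑ x ∈ U, g x := by
    intro y hy
    simp only [mem_nbrIn, mem_singleton, exists_eq_left] at hy
    have := hcon y hy.1 hy.2
    simp only [Extendable] at this
    push Not at this
    obtain ⟨U, hU, hc, hlt⟩ := this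
    have h0 := hE U hU hc
    have he : nbrIn G (F.erase y) U = (nbrIn G F U).erase y := by
      ext z; simp only [mem_nbrIn, mem_erase]; tauto
    rw [he] at hlt
    have h1 : #(nbrIn G F U) - 1 ≤ #((nbrIn G F U).erase y) := pred_card_le_card_erase
    have hsU : s ∉ U := by
      intro hsU
      have e1 := sum_update_of_mem hsU g (g s - 1)
      have e2 := sum_eq_add_sum_sdiff_singleton_of_mem hsU g
      omega
    rw [sum_update_of_notMem hsU] at hlt
    have hyU : y ∈ nbrIn G F U := by
      by_contra hn
      rw [erase_eq_of_notMem hn] at hlt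
      omega
    have ht : #(nbrIn G F U) ≤ ∑ x ∈ U, g x := by omega
    refine ⟨U, hU, ?_, hsU, hyU, ht⟩
    by_contra! hmU
    exact absurd (hbig U hU hmU hc) (by omega)
  -- Tight sets with fewer than `m` vertices are closed under union: a union has at most `2m`
  -- vertices and is tight, so by the slack it has fewer than `m`.
  have main : ∀ Y ⊆ nbrIn G F {s}, ∃ U ⊆ A, #U < m ∧ s ∉ U ∧ Y ⊆ nbrIn G F U ∧
      #(nbrIn G F U) ≤ ∑ x ∈ U, g x := by
    intro Y
    induction Y using Finset.induction_on with
    | empty => exact fun _ => ⟨∅, by simp, by rw [card_empty]; omega, by simp,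
        by simp, by simp [nbrIn]⟩
    | insert y Y hy ih =>
      intro hY
      obtain ⟨U, h1, h2, h3, h4, h5⟩ := ih ((subset_insert _ _).trans hY)
      obtain ⟨U', h1', h2', h3', h4', h5'⟩ := key y (hY (mem_insert_self _ _))
      have hc : #(U ∪ U') ≤ 2 * m := (card_union_le _ _).trans (by omega)
      have ht := hE.union_tight h1 hc h5 h5'
      refine ⟨U ∪ U', union_subset h1 h1', ?_, by simp [h3, h3'], ?_, ht⟩
      · by_contra! hmU
        exact absurd (hbig _ (union_subset h1 h1') hmU hc) (by omega)
      · rw [nbrIn_union]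
        exact insert_subset (mem_union_right _ h4') (h4.trans subset_union_left)
  -- This tight set sees every free neighbour of `s`. Adding `s` increases the demand but not the
  -- neighbourhood, a contradiction.
  obtain ⟨U, h1, h2, h3, h4, h5⟩ := main _ subset_rfl
  have h6 := hE (insert s U) (insert_subset hs h1) ((card_insert_le _ _).trans (by omega))
  rw [sum_insert h3, insert_eq, nbrIn_union, union_eq_right.2 h4] at h6
  omega

/-- The number of vertices of `X` whose parent is `x`. -/
def childCount (X : Finset V) (par : V → V) (x : V) : ℕ := #{y ∈ X | par y = x}

theorem childCount_union {par : V → V} {x : V} (h : Disjoint X U) :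
    childCount (X ∪ U) par x = childCount X par x + childCount U par x := by
  rw [childCount, filter_union, card_union_of_disjoint (disjoint_filter_filter h)]
  rfl

theorem childCount_congr {par par' : V → V} {x : V} (h : ∀ y ∈ X, par y = par' y) :
    childCount X par x = childCount X par' x := by
  unfold childCount
  congr 1
  exact filter_congr fun y hy => by rw [h y hy]

/-- Spent neighbours can be returned to the free set. -/
theorem Extendable.rollback (hE : Extendable G A m F g) {par : V → V} (hX : Disjoint F X)
    (hpar : ∀ y ∈ X, G.Adj (par y) y) :
    Extendable G A m (F ∪ X) (fun x => g x + childCount X par x) := by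
  intro U hU hc
  have h1 := hE U hU hc
  rw [sum_add_distrib]
  have h2 : ∑ x ∈ U, childCount X par x = #{y ∈ X | par y ∈ U} := by
    rw [card_eq_sum_card_fiberwise (f := par) (t := U)]
    · refine sum_congr rfl fun x hx => ?_
      unfold childCount
      congr 1
      ext y; simp only [mem_filter]; grind
    · intro y hy
      simpa using (mem_filter.1 hy).2
  have h3 : {y ∈ X | par y ∈ U} ⊆ nbrIn G X U := by
    intro y hy
    rw [mem_filter] at hy
    exact mem_nbrIn.2 ⟨hy.1, _, hy.2, hpar y hy.1⟩
  have h4 : nbrIn G (F ∪ X) U = nbrIn G F U ∪ nbrIn G X U := by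
    ext y; simp only [mem_nbrIn, mem_union, or_and_right]
  have h5 : Disjoint (nbrIn G F U) (nbrIn G X U) :=
    hX.mono (fun y hy => (mem_nbrIn.1 hy).1) (fun y hy => (mem_nbrIn.1 hy).1)
  rw [h4, card_union_of_disjoint h5, h2]
  exact Nat.add_le_add h1 (card_le_card h3)

/-- The properties of the ambient graph that are used for growing trees and paths: inside the
vertex set `A`, sets of `m` to `2m` vertices have at least `K` neighbours in the reservoir `T`, and
disjoint sets of `m` vertices are joined by an edge. -/
structure Host (G : SimpleGraph V) (A T : Finset V) (m K : ℕ) : Prop where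
  subset : T ⊆ A
  one_le : 1 ≤ m
  expand : ∀ U ⊆ A, m ≤ #U → #U ≤ 2 * m → K ≤ #(nbrIn G T U)
  joined : ∀ P ⊆ A, ∀ Q ⊆ A, Disjoint P Q → m ≤ #P → m ≤ #Q → ∃ p ∈ P, ∃ q ∈ Q, G.Adj p q

/-- A free set `F` of vertices of the reservoir and a demand function `g` such that the free
vertices can still meet all demands. -/
structure State (G : SimpleGraph V) (A T : Finset V) (m d : ℕ) (F : Finset V) (g : V → ℕ) :
    Prop where
  subset : F ⊆ T
  ext : Extendable G A m F g
  le : ∀ x, g x ≤ d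
  free : ∀ x ∈ F, g x = d

/-- At most `#T - #F` of the `K` reservoir neighbours of a large set have been used, and by `hK`
more than `2md` remain. This is the slack needed to spend a leaf. -/
theorem State.exists_leaf (hH : Host G A T m K) (hS : State G A T m d F g)
    (hK : 2 * m * d + #T < K + #F) {s : V} (hs : s ∈ A) (hsF : s ∉ F) (hgs : 1 ≤ g s) :
    ∃ y ∈ F, G.Adj s y ∧ State G A T m d (F.erase y) (Function.update g s (g s - 1)) := by
  obtain ⟨y, hy, hsy, hE⟩ := hS.ext.exists_leaf hH.one_le (fun U hU h1 h2 => by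
    have h3 := hH.expand U hU h1 h2
    have h4 : ∑ x ∈ U, g x ≤ #U * d := sum_le_card_nsmul _ _ _ fun x _ => hS.le x
    have h5 : #U * d ≤ 2 * m * d := Nat.mul_le_mul_right _ h2
    have h6 : nbrIn G T U ⊆ nbrIn G F U ∪ (T \ F) := by
      intro y hy
      rw [mem_nbrIn] at hy
      by_cases hyF : y ∈ F
      · exact mem_union_left _ (mem_nbrIn.2 ⟨hyF, hy.2⟩)
      · exact mem_union_right _ (mem_sdiff.2 ⟨hy.1, hyF⟩)
    have h7 := (card_le_card h6).trans (card_union_le _ _)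
    have h8 := card_sdiff_of_subset hS.subset
    have h9 := card_le_card hS.subset
    omega) hs hgs
  refine ⟨y, hy, hsy, (erase_subset _ _).trans hS.subset, hE, fun x => ?_, fun x hx => ?_⟩
  · by_cases hxs : x = s
    · subst hxs
      simpa using (Nat.sub_le _ _).trans (hS.le x)
    · simpa [Function.update_of_ne hxs] using hS.le x
  · have hxs : x ≠ s := fun h => hsF (h ▸ mem_of_mem_erase hx)
    rw [Function.update_of_ne hxs]
    exact hS.free x (mem_of_mem_erase hx)

/-- A new level of `t` vertices can be grown from the vertices of `L`. -/
theorem State.exists_level (hH : Host G A T m K) (hL : L ⊆ A) (t : ℕ) :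
    ∀ {F : Finset V} {g : V → ℕ}, State G A T m d F g → 2 * m * d + #T + t ≤ K + #F →
      Disjoint L F → t ≤ ∑ x ∈ L, g x →
      ∃ N ⊆ F, #N = t ∧ ∃ par : V → V, (∀ y ∈ N, par y ∈ L ∧ G.Adj (par y) y) ∧
        ∃ g' : V → ℕ, State G A T m d (F \ N) g' ∧ ∀ x, g x = g' x + childCount N par x := by
  induction t with
  | zero =>
    intro F g hS _ _ _
    exact ⟨∅, by simp, by simp, id, by simp, g, by simpa using hS, by simp [childCount]⟩
  | succ t ih =>
    intro F g hS hK hd ht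
    obtain ⟨N, hN, hNc, par, hpar, g', hS', hg⟩ := ih hS (by omega) hd (by omega)
    have hsum : ∑ x ∈ L, g x = ∑ x ∈ L, g' x + #N := by
      rw [sum_congr rfl (fun x _ => hg x), sum_add_distrib]
      congr 1
      exact (card_eq_sum_card_fiberwise fun y hy => (hpar y hy).1).symm
    obtain ⟨s, hs, hgs⟩ : ∃ s ∈ L, 1 ≤ g' s := by
      by_contra! hcon
      have : ∑ x ∈ L, g' x = 0 := sum_eq_zero fun x hx => by have := hcon x hx; omega
      omega
    have hsF : s ∉ F := disjoint_left.1 hd hs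
    have hFN := card_sdiff_of_subset hN
    have hFN' := card_le_card hN
    obtain ⟨y, hy, hsy, hS''⟩ := hS'.exists_leaf hH (by omega) (hL hs)
      (fun h => hsF (mem_sdiff.1 h).1) hgs
    rw [mem_sdiff] at hy
    refine ⟨insert y N, insert_subset hy.1 hN, by rw [card_insert_of_notMem hy.2, hNc],
      Function.update par y s, ?_, Function.update g' s (g' s - 1), ?_, ?_⟩
    · intro z hz
      by_cases hzy : z = y
      · subst hzy; simpa using ⟨hs, hsy⟩
      · rw [Function.update_of_ne hzy]
        exact hpar z (mem_of_mem_insert_of_ne hz hzy)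
    · convert hS'' using 1
      ext z; simp only [mem_sdiff, mem_insert, mem_erase]; tauto
    · intro x
      have e : insert y N = N ∪ {y} := by rw [insert_eq, union_comm]
      rw [e, childCount_union (by simpa using hy.2), hg x,
        childCount_congr (X := N) (par := Function.update par y s) (par' := par)
          (fun z hz => Function.update_of_ne (ne_of_mem_of_not_mem hz hy.2) _ _)]
      by_cases hxs : x = s
      · subst hxs
        simp [childCount, filter_singleton]
        omega
      · simp [childCount, filter_singleton, Function.update_of_ne hxs, Ne.symm hxs]

end

/-! ### Growing trees and linking two vertices -/

section

open Finset

variable {V : Type*} [DecidableEq V]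

variable {G : SimpleGraph V} {A F F' T U U' L X : Finset V} {m d K t h : ℕ} {g g' : V → ℕ}

/-- A tree with `h + 1` levels below its root `a`, the last of which has `min (d ^ h) m` vertices,
can be grown inside the free set. -/
theorem State.exists_tree (hH : Host G A T m K) (hd : 1 ≤ d) {a : V} (ha : a ∈ A)
    (hS : State G A T m d F g) (haF : a ∉ F) (hga : 1 ≤ g a) (h : ℕ)
    (hK : 2 * m * d + #T + ∑ i ∈ range (h + 1), min (d ^ i) m ≤ K + #F) :
    ∃ N ⊆ F, #N = ∑ i ∈ range (h + 1), min (d ^ i) m ∧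
      ∃ par : V → V, (∀ y ∈ N, par y ∈ insert a N ∧ G.Adj (par y) y) ∧
      ∃ g' : V → ℕ, State G A T m d (F \ N) g' ∧ (∀ x, g x = g' x + childCount N par x) ∧
      ∃ L ⊆ N, #L = min (d ^ h) m ∧ (∀ x ∈ L, g' x = d) ∧
      ∀ z ∈ L, ∃ S ⊆ N, ∃ a', HamPath G a' z S ∧ G.Adj a a' ∧ #S = h + 1 ∧
        Set.InjOn par S ∧ ∀ y ∈ S, par y ∈ insert a (S.erase z) := by
  induction h with
  | zero =>
    have hm := hH.one_le
    obtain ⟨N, hN, hNc, par, hpar, g', hS', hg⟩ := hS.exists_level hH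
      (L := {a}) (by simpa using ha) 1 (by simpa [hm] using hK) (by simpa using haF)
      (by simpa using hga)
    have hone : min (d ^ 0) m = 1 := by simp [hm]
    simp only [mem_singleton] at hpar
    refine ⟨N, hN, by simp [hNc, hm], par,
      fun y hy => ⟨by simp [(hpar y hy).1], (hpar y hy).2⟩, g', hS', hg, N, subset_rfl,
      by rw [hNc, hone], fun x hx => ?_, fun z hz => ?_⟩
    · have h1 := hg x
      rw [hS.free x (hN hx)] at h1
      have h2 : childCount N par x = 0 := by
        rw [childCount, card_eq_zero, filter_eq_empty_iff]
        intro y hy hyx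
        rw [(hpar y hy).1] at hyx
        exact haF (hyx ▸ hN hx)
      omega
    · refine ⟨{z}, by simpa using hz, z, .single z, ?_, by simp, by simp, ?_⟩
      · have := hpar z hz
        rw [this.1] at this
        exact this.2
      · simp [(hpar z hz).1]
  | succ h ih =>
    rw [sum_range_succ] at hK
    obtain ⟨N, hN, hNc, par, hpar, g', hS', hg, L, hL, hLc, hLd, hLp⟩ := ih (by omega)
    have hFN := card_sdiff_of_subset hN
    have hFN' := card_le_card hN
    have hNA : N ⊆ A := hN.trans (hS.subset.trans hH.subset)
    obtain ⟨N₂, hN₂, hN₂c, par₂, hpar₂, g₂, hS₂, hg₂⟩ := hS'.exists_level hH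
      (L := L) (hL.trans hNA) (min (d ^ (h + 1)) m) (by omega)
      (disjoint_sdiff.mono_left hL) (by
        -- The vertices of the last level have no children yet, so each still offers its full demand
        -- `d`; together they can carry the next level.
        rw [sum_congr rfl hLd, sum_const, hLc, smul_eq_mul]
        rcases le_total (d ^ h) m with h1 | h1
        · rw [min_eq_left h1, ← pow_succ]; exact min_le_left _ _
        · rw [min_eq_right h1]
          exact (min_le_right _ _).trans (Nat.le_mul_of_pos_right _ hd))
    have hdis : Disjoint N N₂ := disjoint_sdiff.mono_right hN₂
    have hN₂F : N₂ ⊆ F := hN₂.trans sdiff_subset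
    let q : V → V := fun y => if y ∈ N₂ then par₂ y else par y
    have hq₂ : ∀ y ∈ N₂, q y = par₂ y := fun y hy => if_pos hy
    have hq₁ : ∀ y ∈ N, q y = par y := fun y hy => if_neg (disjoint_left.1 hdis hy)
    refine ⟨N ∪ N₂, union_subset hN hN₂F, ?_, q, ?_, g₂, ?_, ?_, N₂, subset_union_right, hN₂c, ?_,
      ?_⟩
    · rw [card_union_of_disjoint hdis, hNc, hN₂c, ← sum_range_succ]
    · intro y hy
      rcases mem_union.1 hy with hy | hy
      · rw [hq₁ y hy]
        exact ⟨insert_subset_insert _ subset_union_left (hpar y hy).1, (hpar y hy).2⟩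
      · rw [hq₂ y hy]
        exact ⟨mem_insert_of_mem (mem_union_left _ (hL (hpar₂ y hy).1)), (hpar₂ y hy).2⟩
    · convert hS₂ using 1
      exact sdiff_union_distrib _ _ _ |>.trans (by ext z; simp only [mem_inter, mem_sdiff]; tauto)
    · intro x
      rw [childCount_union hdis, childCount_congr hq₁, childCount_congr hq₂, hg x, hg₂ x]
      ring
    · intro x hx
      have h1 := hg₂ x
      rw [hS'.free x (hN₂ hx)] at h1
      have h2 : childCount N₂ par₂ x = 0 := by
        rw [childCount, card_eq_zero, filter_eq_empty_iff]
        intro y hy hyx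
        have := (hpar₂ y hy).1
        rw [hyx] at this
        exact disjoint_left.1 hdis (hL this) hx
      omega
    · intro z hz
      obtain ⟨hzL, hza⟩ := hpar₂ z hz
      obtain ⟨S, hSN, a', hP, haa, hSc, hinj, hcl⟩ := hLp _ hzL
      have hzS : z ∉ S := fun hh => disjoint_left.1 hdis (hSN hh) hz
      have hqS : ∀ y ∈ S, q y = par y := fun y hy => hq₁ y (hSN hy)
      refine ⟨insert z S, insert_subset (mem_union_right _ hz) (hSN.trans subset_union_left), a',
        hP.snoc hza hzS, haa, by rw [card_insert_of_notMem hzS, hSc], ?_, ?_⟩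
      · rw [coe_insert, Set.injOn_insert (by simpa using hzS)]
        refine ⟨fun x hx y hy hxy => hinj hx hy ?_, ?_⟩
        · rwa [hqS x hx, hqS y hy] at hxy
        · rintro ⟨y, hy, hyz⟩
          rw [hqS y hy, hq₂ z hz] at hyz
          have := hcl y hy
          rw [hyz, mem_insert, mem_erase] at this
          rcases this with h1 | h1
          · exact haF (h1 ▸ hN (hL hzL))
          · exact h1.1 rfl
      · intro y hy
        rw [erase_insert hzS]
        rcases mem_insert.1 hy with rfl | hy
        · rw [hq₂ y hz]
          exact mem_insert_of_mem hP.right_mem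
        · rw [hqS y hy]
          exact insert_subset_insert _ (erase_subset _ _) (hcl y hy)

/-- Along a retained path every vertex is the parent of at most one path vertex. This bounds what
the path costs each vertex. -/
theorem childCount_le_ite {S : Finset V} {par : V → V} (hinj : Set.InjOn par S)
    (hcl : ∀ y ∈ S, par y ∈ U) (x : V) : childCount S par x ≤ if x ∈ U then 1 else 0 := by
  split_ifs with hx
  · rw [childCount, card_le_one]
    intro y hy z hz
    rw [mem_filter] at hy hz
    exact hinj hy.1 hz.1 (hy.2.trans hz.2.symm)
  · rw [childCount, Nat.le_zero, card_eq_zero, filter_eq_empty_iff]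
    rintro y hy rfl
    exact hx (hcl y hy)

/-- The demand function after one unit has been spent at every vertex of `I`. -/
def spend (g : V → ℕ) (I : Finset V) : V → ℕ := fun x => g x - if x ∈ I then 1 else 0

theorem spend_of_notMem {I : Finset V} {x : V} (hx : x ∉ I) : spend g I x = g x := by
  simp [spend, hx]

theorem sdiff_sdiff_union_sdiff {N M S S' : Finset V} (hN : N ⊆ F) (hM : M ⊆ F)
    (hNM : Disjoint N M) (hS : S ⊆ N) (hS' : S' ⊆ M) :
    (F \ N) \ M ∪ M \ S' ∪ N \ S = F \ (S ∪ S') := by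
  ext x
  have h1 : x ∈ N → x ∉ M := fun h => disjoint_left.1 hNM h
  have h2 := @hN x
  have h3 := @hM x
  have h4 := @hS x
  have h5 := @hS' x
  simp only [mem_union, mem_sdiff]
  tauto

/-- Two vertices with positive demand are joined by a path with `2 (h + 1)` inner vertices, all of
them free, such that the remaining free vertices can still meet the remaining demands. -/
theorem State.exists_link (hH : Host G A T m K) (hd : 1 ≤ d) {a b : V} (ha : a ∈ A) (hb : b ∈ A)
    (hab : a ≠ b) (hS : State G A T m d F g) (haF : a ∉ F) (hbF : b ∉ F) (hga : 1 ≤ g a)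
    (hgb : 1 ≤ g b) (hh : m ≤ d ^ h)
    (hK : 2 * m * d + #T + 2 * ∑ i ∈ range (h + 1), min (d ^ i) m ≤ K + #F) :
    ∃ I ⊆ F, #I = 2 * (h + 1) ∧ ∃ a' b', HamPath G a' b' I ∧ G.Adj a a' ∧ G.Adj b' b ∧
      State G A T m d (F \ I) (spend g (insert a (insert b I))) := by
  obtain ⟨N, hN, hNc, par, hpar, g₁, hS₁, hg₁, L, hL, hLc, -, hLp⟩ :=
    hS.exists_tree hH hd ha haF hga h (by omega)
  have hFN := card_sdiff_of_subset hN
  have hFN' := card_le_card hN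
  have hb1 : 1 ≤ g₁ b := by
    have h1 := hg₁ b
    have h2 : childCount N par b = 0 := by
      rw [childCount, card_eq_zero, filter_eq_empty_iff]
      rintro y hy rfl
      rcases mem_insert.1 (hpar y hy).1 with h3 | h3
      · exact hab h3.symm
      · exact hbF (hN h3)
    omega
  obtain ⟨M, hM, hMc, par', hpar', g₂, hS₂, hg₂, L', hL', hLc', -, hLp'⟩ :=
    hS₁.exists_tree hH hd hb (fun h => hbF (mem_sdiff.1 h).1) hb1 h (by omega)
  have hMF : M ⊆ F := hM.trans sdiff_subset
  have hFA : F ⊆ A := hS.subset.trans hH.subset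
  have hNM : Disjoint N M := disjoint_sdiff.mono_right hM
  rw [min_eq_right hh] at hLc hLc'
  -- Both trees have reached `m` leaves, so some edge joins their last levels.
  obtain ⟨α, hα, β, hβ, hαβ⟩ := hH.joined L (hL.trans (hN.trans hFA)) L' (hL'.trans (hMF.trans hFA))
    (hNM.mono hL hL') hLc.ge hLc'.ge
  obtain ⟨S, hSN, a', hP, haa, hSc, hinj, hcl⟩ := hLp α hα
  obtain ⟨S', hSM, b', hP', hbb, hSc', hinj', hcl'⟩ := hLp' β hβ
  have hSS : Disjoint S S' := hNM.mono hSN hSM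
  have hSF : S ⊆ F := hSN.trans hN
  have hSF' : S' ⊆ F := hSM.trans hMF
  refine ⟨S ∪ S', union_subset hSF hSF', ?_, a', b', ?_, haa, hbb.symm, ?_⟩
  · rw [card_union_of_disjoint hSS]; omega
  · exact hP.append hαβ hP'.symm hSS
  -- Both trees are returned except for the paths `S` and `S'` to the ends of that edge.
  have hE₁ := hS₂.ext.rollback (X := M \ S') (par := par')
    (disjoint_sdiff.symm.mono_right sdiff_subset) (fun y hy => (hpar' y (mem_sdiff.1 hy).1).2)
  have hE₂ := hE₁.rollback (X := N \ S) (par := par)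
    (by
      rw [disjoint_union_left]
      exact ⟨(disjoint_sdiff.symm.mono_right sdiff_subset).mono_left sdiff_subset,
        hNM.symm.mono sdiff_subset sdiff_subset⟩)
    (fun y hy => (hpar y (mem_sdiff.1 hy).1).2)
  rw [sdiff_sdiff_union_sdiff hN hMF hNM hSN hSM] at hE₂
  -- After the rollback only the children on `S` and `S'` are charged, at most one per vertex. The
  -- ends `α` and `β` have no child there; lowering their demand as well is harmless and keeps
  -- `spend` uniform.
  refine ⟨sdiff_subset.trans hS.subset, hE₂.anti fun x => ?_, fun x => ?_, fun x hx => ?_⟩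
  · have h1 := hg₁ x
    have h2 := hg₂ x
    have h3 : childCount N par x = childCount (N \ S) par x + childCount S par x := by
      rw [← childCount_union sdiff_disjoint, sdiff_union_of_subset hSN]
    have h4 : childCount M par' x = childCount (M \ S') par' x + childCount S' par' x := by
      rw [← childCount_union sdiff_disjoint, sdiff_union_of_subset hSM]
    have h5 := childCount_le_ite hinj
      (fun y hy => insert_subset_insert a (erase_subset _ _) (hcl y hy)) x
    have h6 := childCount_le_ite hinj'
      (fun y hy => insert_subset_insert b (erase_subset _ _) (hcl' y hy)) x
    have hdis : Disjoint (insert a S) (insert b S') := by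
      rw [disjoint_insert_left, disjoint_insert_right]
      refine ⟨?_, fun h => hbF (hSF h), hSS⟩
      rw [mem_insert]
      rintro (h | h)
      · exact hab h
      · exact haF (hSF' h)
    have h7 : insert a (insert b (S ∪ S')) = insert a S ∪ insert b S' := by
      ext z; simp only [mem_union, mem_insert]; tauto
    unfold spend
    rw [h7]
    by_cases hx : x ∈ insert a S
    · have hx' : x ∉ insert b S' := disjoint_left.1 hdis hx
      rw [if_pos hx] at h5
      rw [if_neg hx'] at h6
      rw [if_pos (mem_union_left _ hx)]
      omega
    · rw [if_neg hx] at h5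
      by_cases hx' : x ∈ insert b S'
      · rw [if_pos hx'] at h6
        rw [if_pos (mem_union_right _ hx')]
        omega
      · rw [if_neg hx'] at h6
        rw [if_neg (by rw [mem_union]; tauto)]
        omega
  · exact (Nat.sub_le _ _).trans (hS.le x)
  · rw [mem_sdiff] at hx
    rw [spend_of_notMem, hS.free x hx.1]
    rw [mem_insert, mem_insert]
    rintro (rfl | rfl | h)
    · exact haF hx.1
    · exact hbF hx.1
    · exact hx.2 h

end

/-! ### Ladders: one vertex set, two path systems -/

section

open Finset

variable {V : Type*} [DecidableEq V]

variable {G : SimpleGraph V} {A F F' T U U' L X : Finset V} {m d K t h : ℕ} {g g' : V → ℕ}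

/-- A host in which the trees used for linking two vertices have `h + 1` levels. -/
structure Linker (G : SimpleGraph V) (A T : Finset V) (m d K h : ℕ) : Prop where
  host : Host G A T m K
  one_le : 1 ≤ d
  le_pow : m ≤ d ^ h

/-- The number of vertices that must be kept in reserve for the next link. -/
def reserve (T : Finset V) (m d h : ℕ) : ℕ :=
  2 * m * d + #T + 2 * ∑ i ∈ range (h + 1), min (d ^ i) m

theorem State.link (hL : Linker G A T m d K h) (hS : State G A T m d F g) {a b : V} (ha : a ∈ A)
    (hb : b ∈ A) (hab : a ≠ b) (haF : a ∉ F) (hbF : b ∉ F) (hga : 1 ≤ g a) (hgb : 1 ≤ g b)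
    (hK : reserve T m d h ≤ K + #F) :
    ∃ I ⊆ F, #I = 2 * (h + 1) ∧ ∃ a' b', HamPath G a' b' I ∧ G.Adj a a' ∧ G.Adj b' b ∧
      State G A T m d (F \ I) (spend g (insert a (insert b I))) :=
  hS.exists_link hL.host hL.one_le ha hb hab haF hbF hga hgb hL.le_pow hK

theorem State.leaf (hL : Linker G A T m d K h) (hS : State G A T m d F g) {s : V} (hs : s ∈ A)
    (hsF : s ∉ F) (hgs : 1 ≤ g s) (hK : reserve T m d h ≤ K + #F) :
    ∃ y ∈ F, G.Adj s y ∧ State G A T m d (F.erase y) (spend g {s}) := by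
  have h0 : 1 ≤ ∑ i ∈ range (h + 1), min (d ^ i) m := by
    have hm := hL.host.one_le
    calc 1 = min (d ^ 0) m := by simp [hm]
      _ ≤ _ := single_le_sum (f := fun i => min (d ^ i) m) (fun i _ => Nat.zero_le _)
        (mem_range.2 (Nat.succ_pos h))
  obtain ⟨y, hy, hsy, hS'⟩ := hS.exists_leaf hL.host (by unfold reserve at hK; omega) hs hsF hgs
  refine ⟨y, hy, hsy, ?_⟩
  convert hS' using 1
  funext x
  by_cases hx : x = s
  · subst hx; simp [spend]
  · simp [spend, hx]

theorem HamPath.uncons {a b : V} {S : Finset V} (hP : HamPath G a b S) (hS : 2 ≤ #S) :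
    ∃ w, G.Adj a w ∧ HamPath G w b (S.erase a) := by
  cases hP with
  | single => simp at hS
  | cons hab ha hP => exact ⟨_, hab, by rwa [erase_insert ha]⟩

theorem HamPath.uncons_four {e c : V} {I : Finset V} (hP : HamPath G e c (insert e I))
    (he : e ∉ I) (hI : 4 ≤ #I) :
    ∃ w₁ w₂ w₃ w₄ I', I = insert w₁ (insert w₂ (insert w₃ (insert w₄ I'))) ∧
      w₁ ∉ insert w₂ (insert w₃ (insert w₄ I')) ∧ w₂ ∉ insert w₃ (insert w₄ I') ∧
      w₃ ∉ insert w₄ I' ∧ w₄ ∉ I' ∧ G.Adj e w₁ ∧ G.Adj w₁ w₂ ∧ G.Adj w₂ w₃ ∧ G.Adj w₃ w₄ ∧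
      HamPath G w₄ c (insert w₄ I') := by
  obtain ⟨w₁, h₁, hP⟩ := hP.uncons (by rw [card_insert_of_notMem he]; omega)
  rw [erase_insert he] at hP
  have m₁ := hP.left_mem
  have c₁ := card_erase_of_mem m₁
  obtain ⟨w₂, h₂, hP⟩ := hP.uncons (by omega)
  have m₂ := hP.left_mem
  have c₂ := card_erase_of_mem m₂
  obtain ⟨w₃, h₃, hP⟩ := hP.uncons (by omega)
  have m₃ := hP.left_mem
  have c₃ := card_erase_of_mem m₃
  obtain ⟨w₄, h₄, hP⟩ := hP.uncons (by omega)
  have m₄ := hP.left_mem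
  refine ⟨w₁, w₂, w₃, w₄, (((I.erase w₁).erase w₂).erase w₃).erase w₄, ?_, ?_, ?_, ?_, ?_, h₁, h₂,
    h₃, h₄, ?_⟩
  · rw [insert_erase m₄, insert_erase m₃, insert_erase m₂, insert_erase m₁]
  · rw [insert_erase m₄, insert_erase m₃, insert_erase m₂]; simp
  · rw [insert_erase m₄, insert_erase m₃]; simp
  · rw [insert_erase m₄]; simp
  · simp
  · rwa [insert_erase m₄]

/-- The two path systems on the vertex set `S` from which an absorber is built: one path from `u₂`
to `f`, or two disjoint paths, from `u₂` to `e` and from `u₁` to `f`. -/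
structure Ladder (G : SimpleGraph V) (u₁ u₂ e f : V) (S : Finset V) : Prop where
  path : HamPath G u₂ f S
  paths : ∃ P Q, Disjoint P Q ∧ S = P ∪ Q ∧ HamPath G u₂ e P ∧ HamPath G u₁ f Q

/-- Four vertices `w₁ w₂ w₃ w₄` following `e` are added, with a link `J₁` from `f` to `w₂` and a
link `J₂` from `w₁` to `w₄`. The single path continues `f J₁ w₂ w₁ J₂ w₄ w₃`; the two paths continue
`e w₁ J₂ w₄` and `f J₁ w₂ w₃`. Both cover the same vertices, and `w₄`, `w₃` take over the roles of
`e`, `f`. -/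
theorem Ladder.step {u₁ u₂ e f w₁ w₂ w₃ w₄ a a' b b' : V} {S J₁ J₂ : Finset V}
    (hl : Ladder G u₁ u₂ e f S) (he₁ : G.Adj e w₁) (h₁₂ : G.Adj w₁ w₂) (h₂₃ : G.Adj w₂ w₃)
    (h₃₄ : G.Adj w₃ w₄) (hJ₁ : HamPath G a a' J₁) (ha : G.Adj f a) (ha' : G.Adj a' w₂)
    (hJ₂ : HamPath G b b' J₂) (hb : G.Adj w₁ b) (hb' : G.Adj b' w₄)
    (hw₁ : w₁ ∉ S ∪ J₁ ∪ J₂) (hw₂ : w₂ ∉ S ∪ J₁ ∪ J₂) (hw₃ : w₃ ∉ S ∪ J₁ ∪ J₂)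
    (hw₄ : w₄ ∉ S ∪ J₁ ∪ J₂) (n₁₂ : w₁ ≠ w₂) (n₁₃ : w₁ ≠ w₃) (n₁₄ : w₁ ≠ w₄) (n₂₃ : w₂ ≠ w₃)
    (n₂₄ : w₂ ≠ w₄) (n₃₄ : w₃ ≠ w₄) (hSJ₁ : Disjoint S J₁) (hSJ₂ : Disjoint S J₂)
    (hJ : Disjoint J₁ J₂) :
    Ladder G u₁ u₂ w₄ w₃ (S ∪ J₁ ∪ J₂ ∪ {w₁, w₂, w₃, w₄}) := by
  simp only [mem_union, not_or] at hw₁ hw₂ hw₃ hw₄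
  rw [disjoint_left] at hSJ₁ hSJ₂ hJ
  constructor
  · have h1 := hl.path.append ha hJ₁ (disjoint_left.2 hSJ₁)
    have h2 := h1.snoc ha' (c := w₂) (by simp; tauto)
    have h3 := h2.snoc h₁₂.symm (by simp; tauto)
    have h4 := h3.append hb hJ₂ (by
      rw [disjoint_left]; intro x; simp only [mem_insert, mem_union]
      rintro (rfl | rfl | h | h)
      · tauto
      · tauto
      · exact hSJ₂ h
      · exact hJ h)
    have h5 := h4.snoc hb' (by simp; tauto)
    have h6 := h5.snoc h₃₄.symm (by simp; tauto)
    convert h6 using 1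
    clear * -
    ext x; simp only [mem_insert, mem_union, mem_singleton]; tauto
  · obtain ⟨P, Q, hPQ, rfl, hP, hQ⟩ := hl.paths
    simp only [mem_union, not_or] at hw₁ hw₂ hw₃ hw₄ hSJ₁ hSJ₂
    have h1 := hP.snoc he₁ (by tauto)
    have h2 := h1.append hb hJ₂ (by
      rw [disjoint_left]; intro x; simp only [mem_insert]
      rintro (rfl | h)
      · tauto
      · exact hSJ₂ (Or.inl h))
    have h3 := h2.snoc hb' (by simp; tauto)
    have k1 := hQ.append ha hJ₁ (by rw [disjoint_left]; exact fun x h => hSJ₁ (Or.inr h))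
    have k2 := k1.snoc ha' (c := w₂) (by simp; tauto)
    have k3 := k2.snoc h₂₃ (by simp; tauto)
    refine ⟨_, _, ?_, ?_, h3, k3⟩
    · rw [disjoint_left] at hPQ ⊢
      intro x
      simp only [mem_insert, mem_union, not_or]
      rintro (rfl | (rfl | h) | h)
      · tauto
      · tauto
      · refine ⟨?_, ?_, hPQ h, hSJ₁ (Or.inl h)⟩
        · rintro rfl; tauto
        · rintro rfl; tauto
      · refine ⟨?_, ?_, fun hx => hSJ₂ (Or.inr hx) h, fun hx => hJ hx h⟩
        · rintro rfl; tauto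
        · rintro rfl; tauto
    · clear * -
      ext x; simp only [mem_insert, mem_union, mem_singleton]; tauto

/-- Iterating `Ladder.step` along a path from `e` to `c` with `4q` further vertices moves the end
`e` to `c`, at the price of two links for every four vertices. -/
theorem State.exists_ladder (hL : Linker G A T m d K h) {u₁ u₂ c : V} (q : ℕ) :
    ∀ {F : Finset V} {g : V → ℕ} {e f : V} {S I : Finset V}, State G A T m d F g →
      Ladder G u₁ u₂ e f S → HamPath G e c (insert e I) → e ∉ I → #I = 4 * q → Disjoint I S →
      S ⊆ A → I ⊆ A → Disjoint S F → Disjoint I F → 1 ≤ g f → (∀ x ∈ I, 1 ≤ g x) →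
      reserve T m d h + 4 * (h + 1) * q ≤ K + #F →
      ∃ J ⊆ F, #J = 4 * (h + 1) * q ∧ ∃ f' g', State G A T m d (F \ J) g' ∧
        Ladder G u₁ u₂ c f' (S ∪ I ∪ J) ∧ 1 ≤ g' f' ∧ ∀ x, x ∉ insert f (I ∪ J) → g' x = g x := by
  induction q with
  | zero =>
    intro F g e f S I hS hl hP he hI _ _ _ _ _ hgf _ _
    rw [Nat.mul_zero, card_eq_zero] at hI
    subst hI
    have hec : c = e := by
      have := hP.right_mem
      simpa using this
    subst hec
    exact ⟨∅, by simp, by simp, f, g, by simpa using hS, by simpa using hl, hgf, by simp⟩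
  | succ q ih =>
    intro F g e f S I hS hl hP he hI hIS hSA hIA hSF hIF hgf hgI hK
    obtain ⟨w₁, w₂, w₃, w₄, I', rfl, i₁, i₂, i₃, i₄, he₁, h₁₂, h₂₃, h₃₄, hP'⟩ :=
      hP.uncons_four he (by omega)
    have hc4 : #I' = 4 * q := by
      rw [card_insert_of_notMem i₁, card_insert_of_notMem i₂, card_insert_of_notMem i₃,
        card_insert_of_notMem i₄] at hI
      omega
    have hfS : f ∈ S := hl.path.right_mem
    simp only [disjoint_insert_left] at hIS hIF
    simp only [insert_subset_iff] at hIA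
    simp only [mem_insert, not_or] at i₁ i₂ i₃
    simp only [mem_insert, forall_eq_or_imp] at hgI
    -- The two links spend demand at `f`, `w₂`, `w₁` and `w₄`, but not at `w₃`, which therefore can
    -- start a link when it becomes the next `f`.
    obtain ⟨J₁, hJ₁F, hJ₁c, a, a', hJ₁, ha, ha', hS₁⟩ := hS.link hL (hSA hfS) hIA.2.1
      (fun h => hIS.2.1 (h ▸ hfS)) (disjoint_left.1 hSF hfS) hIF.2.1 hgf hgI.2.1 (by omega)
    have hF₁ := card_sdiff_of_subset hJ₁F
    have hF₁' := card_le_card hJ₁F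
    have hF1 : ∀ x, x ∉ F → x ∉ F \ J₁ := fun x hx h => hx (mem_sdiff.1 h).1
    have nf : ∀ {x}, x ∉ S → x ≠ f := fun hx h => hx (h ▸ hfS)
    have nJ₁ : ∀ {x}, x ∉ F → x ∉ J₁ := fun hx h => hx (hJ₁F h)
    have hs₁ : spend g (insert f (insert w₂ J₁)) w₁ = g w₁ := spend_of_notMem (by
      simp only [mem_insert, not_or]; exact ⟨nf hIS.1, i₁.1, nJ₁ hIF.1⟩)
    have hs₄ : spend g (insert f (insert w₂ J₁)) w₄ = g w₄ := spend_of_notMem (by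
      simp only [mem_insert, not_or]
      exact ⟨nf hIS.2.2.2.1, Ne.symm i₂.2.1, nJ₁ hIF.2.2.2.1⟩)
    have hexp : 4 * (h + 1) * (q + 1) = 2 * (h + 1) + 2 * (h + 1) + 4 * (h + 1) * q := by ring
    obtain ⟨J₂, hJ₂F, hJ₂c, b, b', hJ₂, hb, hb', hS₂⟩ := hS₁.link hL hIA.1 hIA.2.2.2.1
      i₁.2.2.1 (hF1 _ hIF.1) (hF1 _ hIF.2.2.2.1) (by rw [hs₁]; exact hgI.1)
      (by rw [hs₄]; exact hgI.2.2.2.1) (by omega)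
    have hF₂ := card_sdiff_of_subset hJ₂F
    have hF₂' := card_le_card hJ₂F
    have hJ₂F' : J₂ ⊆ F := hJ₂F.trans sdiff_subset
    have nJ₂ : ∀ {x}, x ∉ F → x ∉ J₂ := fun hx h => hx (hJ₂F' h)
    have hJJ : Disjoint J₁ J₂ := disjoint_sdiff.mono_right hJ₂F
    have hFA : F ⊆ A := hS.subset.trans hL.host.subset
    have nw : ∀ {x}, x ∉ S → x ∉ F → x ∉ S ∪ J₁ ∪ J₂ := fun h1 h2 => by
      simp only [mem_union, not_or]; exact ⟨⟨h1, nJ₁ h2⟩, nJ₂ h2⟩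
    have hl' := hl.step he₁ h₁₂ h₂₃ h₃₄ hJ₁ ha ha' hJ₂ hb hb' (nw hIS.1 hIF.1)
      (nw hIS.2.1 hIF.2.1) (nw hIS.2.2.1 hIF.2.2.1) (nw hIS.2.2.2.1 hIF.2.2.2.1)
      i₁.1 i₁.2.1 i₁.2.2.1 i₂.1 i₂.2.1 i₃.1 (hSF.mono_right hJ₁F) (hSF.mono_right hJ₂F') hJJ
    have hsp : ∀ x, x ∉ F → x ≠ f → x ≠ w₁ → x ≠ w₂ → x ≠ w₄ →
        spend (spend g (insert f (insert w₂ J₁))) (insert w₁ (insert w₄ J₂)) x = g x := by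
      intro x h1 h2 h3 h4 h5
      rw [spend_of_notMem, spend_of_notMem]
      · simp only [mem_insert, not_or]; exact ⟨h2, h4, nJ₁ h1⟩
      · simp only [mem_insert, not_or]; exact ⟨h3, h5, nJ₂ h1⟩
    have hI'S : Disjoint I' (S ∪ J₁ ∪ J₂ ∪ {w₁, w₂, w₃, w₄}) := by
      rw [disjoint_left]
      intro x hx
      have h1 := disjoint_left.1 hIS.2.2.2.2 hx
      have h2 := disjoint_left.1 hIF.2.2.2.2 hx
      rw [mem_union, not_or]
      refine ⟨nw h1 h2, ?_⟩
      simp only [mem_insert, mem_singleton]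
      rintro (rfl | rfl | rfl | rfl)
      · exact i₁.2.2.2 hx
      · exact i₂.2.2 hx
      · exact i₃.2 hx
      · exact i₄ hx
    obtain ⟨J₃, hJ₃F, hJ₃c, f', g', hS₃, hl₃, hf₃, hg₃⟩ := ih hS₂ hl' hP' i₄ hc4 hI'S
      (by
        refine union_subset (union_subset (union_subset hSA (hJ₁F.trans hFA)) (hJ₂F'.trans hFA)) ?_
        simp only [insert_subset_iff, singleton_subset_iff]
        exact ⟨hIA.1, hIA.2.1, hIA.2.2.1, hIA.2.2.2.1⟩)
      hIA.2.2.2.2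
      (by
        rw [disjoint_left]
        intro x hx hx'
        simp only [mem_sdiff] at hx'
        simp only [mem_union, mem_insert, mem_singleton] at hx
        rcases hx with ((hx | hx) | hx) | rfl | rfl | rfl | rfl
        · exact disjoint_left.1 hSF hx hx'.1.1
        · exact hx'.1.2 hx
        · exact hx'.2 hx
        · exact hIF.1 hx'.1.1
        · exact hIF.2.1 hx'.1.1
        · exact hIF.2.2.1 hx'.1.1
        · exact hIF.2.2.2.1 hx'.1.1)
      (hIF.2.2.2.2.mono_right (sdiff_subset.trans sdiff_subset))
      (by
        rw [hsp _ hIF.2.2.1 (nf hIS.2.2.1) (Ne.symm i₁.2.1) (Ne.symm i₂.1) i₃.1]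
        exact hgI.2.2.1)
      (by
        intro x hx
        rw [hsp _ (disjoint_left.1 hIF.2.2.2.2 hx) (nf (disjoint_left.1 hIS.2.2.2.2 hx))]
        · exact hgI.2.2.2.2 x hx
        · rintro rfl; exact i₁.2.2.2 hx
        · rintro rfl; exact i₂.2.2 hx
        · rintro rfl; exact i₄ hx)
      (by omega)
    have hJ₃F' : J₃ ⊆ F := hJ₃F.trans (sdiff_subset.trans sdiff_subset)
    have hd3 : Disjoint (J₁ ∪ J₂) J₃ := by
      rw [disjoint_union_left]
      exact ⟨(disjoint_sdiff.mono_right sdiff_subset).mono_right hJ₃F,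
        disjoint_sdiff.mono_right hJ₃F⟩
    refine ⟨J₁ ∪ J₂ ∪ J₃, union_subset (union_subset hJ₁F hJ₂F') hJ₃F', ?_, f', g', ?_, ?_, hf₃, ?_⟩
    · rw [card_union_of_disjoint hd3, card_union_of_disjoint hJJ]
      omega
    · convert hS₃ using 1
      clear * -
      ext x; simp only [mem_sdiff, mem_union]; tauto
    · convert hl₃ using 1
      clear * -
      ext x; simp only [mem_union, mem_insert, mem_singleton]; tauto
    · intro x hx
      simp only [mem_insert, mem_union, not_or] at hx
      obtain ⟨x0, ⟨x1, x2, x3, x4, x5⟩, ⟨x6, x7⟩, x8⟩ := hx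
      rw [hg₃ x (by simp only [mem_insert, mem_union, not_or]; exact ⟨x3, x5, x8⟩),
        spend_of_notMem, spend_of_notMem]
      · simp only [mem_insert, not_or]; exact ⟨x0, x2, x6⟩
      · simp only [mem_insert, not_or]; exact ⟨x1, x4, x7⟩

end

/-! ### Absorbers, and paths that pass through several of them -/

section

open Finset

variable {V : Type*} [DecidableEq V]

variable {G : SimpleGraph V} {A F F' T U U' L X : Finset V} {m d K t h : ℕ} {g g' : V → ℕ}

/-- The number of vertices of an absorber. -/
def absorberSize (h : ℕ) : ℕ := 2 + 2 * (h + 1) + 2 * (h + 1) ^ 2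

theorem spend_of_mem {I : Finset V} {x : V} (hx : x ∈ I) : spend g I x = g x - 1 := by
  simp [spend, hx]

/-- For a vertex `r` there are a set `S` of free vertices and vertices `s`, `t` of it such that both
`S` and `S ∪ {r}` are the vertex set of a path from `s` to `t`. -/
theorem State.exists_absorber (hL : Linker G A T m d K h) (hS : State G A T m d F g) (hd : 2 ≤ d)
    {q : ℕ} (hq : h + 1 = 2 * q) {r : V} (hr : r ∈ A) (hrF : r ∉ F) (hgr : 2 ≤ g r)
    (hK : reserve T m d h + absorberSize h ≤ K + #F) :
    ∃ S ⊆ F, #S = absorberSize h ∧ ∃ s t g', State G A T m d (F \ S) g' ∧ HamPath G s t S ∧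
      HamPath G s t (insert r S) ∧ s ≠ t ∧ 1 ≤ g' s ∧ 1 ≤ g' t ∧
      (∀ x, x ∉ insert r S → g' x = g x) ∧ g r ≤ g' r + 2 := by
  unfold absorberSize at hK ⊢
  have hFA : F ⊆ A := hS.subset.trans hL.host.subset
  -- The absorber starts from a cycle `r u₁ u₂ I r`. Its two edges at `r` account for the two units
  -- of demand taken from `r`.
  obtain ⟨u₁, hu₁, hru₁, hS₁⟩ := hS.leaf hL hr hrF (by omega) (by omega)
  have hc₁ := card_erase_of_mem hu₁
  have hF0 : 0 < #F := card_pos.2 ⟨_, hu₁⟩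
  have hur₁ : u₁ ≠ r := fun h => hrF (h ▸ hu₁)
  have hg₁ : spend g {r} u₁ = d := by
    rw [spend_of_notMem (by simpa using hur₁), hS.free _ hu₁]
  obtain ⟨u₂, hu₂, hu₁₂, hS₂⟩ := hS₁.leaf hL (hFA hu₁) (by simp) (by omega) (by omega)
  have hc₂ := card_erase_of_mem hu₂
  have hF1 : 0 < #(F.erase u₁) := card_pos.2 ⟨_, hu₂⟩
  have hu₂F : u₂ ∈ F := mem_of_mem_erase hu₂
  have hne : u₂ ≠ u₁ := ne_of_mem_erase hu₂
  have hur₂ : u₂ ≠ r := fun h => hrF (h ▸ hu₂F)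
  have e₁ : spend (spend g {r}) {u₁} u₂ = d := by
    rw [spend_of_notMem (by simpa using hne), spend_of_notMem (by simpa using hur₂),
      hS.free _ hu₂F]
  have e₂ : spend (spend g {r}) {u₁} r = g r - 1 := by
    rw [spend_of_notMem (by simpa using hur₁.symm), spend_of_mem (by simp)]
  have e₃ : spend (spend g {r}) {u₁} u₁ = d - 1 := by
    rw [spend_of_mem (by simp), hg₁]
  have hrF₂ : r ∉ (F.erase u₁).erase u₂ := fun h => hrF (mem_of_mem_erase (mem_of_mem_erase h))
  obtain ⟨I, hI, hIc, a, c, hP, hua, hcr, hS₃⟩ := hS₂.link hL (hFA hu₂F) hr hur₂ (by simp) hrF₂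
    (by omega) (by omega) (by omega)
  have hc₃ := card_sdiff_of_subset hI
  have hc₃' := card_le_card hI
  have hIF : I ⊆ F := hI.trans ((erase_subset _ _).trans (erase_subset _ _))
  have hu₂I : u₂ ∉ I := fun h => by simpa using hI h
  have hu₁I : u₁ ∉ I := fun h => by simpa using hI h
  have hrI : r ∉ I := fun h => hrF (hIF h)
  set g₃ := spend (spend (spend g {r}) {u₁}) (insert u₂ (insert r I)) with hgc
  have f₁ : g₃ u₁ = d - 1 := by
    rw [hgc, spend_of_notMem (by simp [hne.symm, hur₁, hu₁I]), e₃]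
  have f₂ : g₃ u₂ = d - 1 := by
    rw [hgc, spend_of_mem (by simp), e₁]
  have f₃ : g₃ r = g r - 1 - 1 := by
    rw [hgc, spend_of_mem (by simp), e₂]
  have f₄ : ∀ x ∈ I, g₃ x = d - 1 := by
    intro x hx
    have h1 := hI hx
    simp only [mem_erase] at h1
    rw [hgc, spend_of_mem (by simp [hx]), spend_of_notMem (by simpa using h1.2.1),
      spend_of_notMem (by simpa using fun h : x = r => hrI (h ▸ hx)), hS.free _ h1.2.2]
  have hl : Ladder G u₁ u₂ u₂ u₁ {u₁, u₂} := by
    refine ⟨(HamPath.single u₂).snoc hu₁₂.symm (by simpa using hne.symm), {u₂}, {u₁}, ?_, ?_,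
      .single _, .single _⟩
    · simpa using hne
    · rw [union_comm]; rfl
  have hP' : HamPath G u₂ c (insert u₂ I) := .cons hua hu₂I hP
  have hsub : ({u₁, u₂} : Finset V) ⊆ F := by simp [insert_subset_iff, hu₁, hu₂F]
  have hsI : Disjoint I {u₁, u₂} := by
    rw [disjoint_insert_right, disjoint_singleton_right]; exact ⟨hu₁I, hu₂I⟩
  -- `I` has `2(h + 1) = 4q` vertices, so the ladder uses it up in `q` steps; this is why `h + 1`
  -- has to be even.
  have hsq : 4 * (h + 1) * q = 2 * (h + 1) ^ 2 := by
    calc 4 * (h + 1) * q = 2 * (h + 1) * (2 * q) := by ring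
      _ = 2 * (h + 1) ^ 2 := by rw [← hq]; ring
  obtain ⟨J, hJ, hJc, f, g', hS₄, hl', hgf, hg'⟩ := hS₃.exists_ladder hL q hl hP' hu₂I (by omega)
    hsI (hsub.trans hFA) (hIF.trans hFA)
    (by
      rw [disjoint_insert_left, disjoint_singleton_left]
      simp)
    disjoint_sdiff (by omega) (fun x hx => by rw [f₄ x hx]; omega) (by omega)
  have hJF : J ⊆ F := hJ.trans (sdiff_subset.trans ((erase_subset _ _).trans (erase_subset _ _)))
  have hu₁J : u₁ ∉ J := fun h => by simpa using hJ h
  have hu₂J : u₂ ∉ J := fun h => by simpa using hJ h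
  have hIJ : Disjoint I J := disjoint_sdiff.mono_right hJ
  have hrS : r ∉ ({u₁, u₂} : Finset V) ∪ I ∪ J := by
    simp only [mem_union, mem_insert, mem_singleton, not_or]
    exact ⟨⟨⟨hur₁.symm, hur₂.symm⟩, hrI⟩, fun h => hrF (hJF h)⟩
  refine ⟨{u₁, u₂} ∪ I ∪ J, union_subset (union_subset hsub hIF) hJF, ?_, u₂, f, g', ?_, hl'.path,
    ?_, ?_, ?_, hgf, ?_, ?_⟩
  · rw [card_union_of_disjoint, card_union_of_disjoint hsI.symm, card_pair hne.symm]
    · omega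
    · rw [disjoint_union_left, disjoint_insert_left, disjoint_singleton_left]
      exact ⟨⟨hu₁J, hu₂J⟩, hIJ⟩
  · convert hS₄ using 1
    clear * -
    ext x; simp only [mem_sdiff, mem_union, mem_insert, mem_singleton, mem_erase]; tauto
  -- The two paths of the ladder end at the neighbour `c` of `r` and start at the neighbour `u₁` of
  -- `r`, so `r` joins them into one path from `u₂` to `f`. Without `r`, the single path of the
  -- ladder has the same ends.
  · obtain ⟨P, Q, hPQ, hPQ', hp, hp'⟩ := hl'.paths
    rw [hPQ'] at hrS ⊢
    rw [mem_union, not_or] at hrS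
    have h1 := (hp.snoc hcr hrS.1).append hru₁ hp' (by
      rw [disjoint_insert_left]; exact ⟨hrS.2, hPQ⟩)
    rwa [insert_union] at h1
  · rintro rfl
    obtain ⟨P, Q, hPQ, -, hp, hp'⟩ := hl'.paths
    exact disjoint_left.1 hPQ hp.left_mem hp'.right_mem
  · rw [hg' u₂ (by simp [hne, hu₂I, hu₂J]), f₂]
    omega
  · intro x hx
    simp only [mem_union, mem_insert, mem_singleton, not_or] at hx
    obtain ⟨x0, ⟨⟨x1, x2⟩, x3⟩, x4⟩ := hx
    rw [hg' x (by simp [x1, x3, x4]), hgc, spend_of_notMem (by simp [x0, x2, x3]),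
      spend_of_notMem (by simpa using x1), spend_of_notMem (by simpa using x0)]
  · rw [hg' r, f₃]
    · omega
    · simp only [mem_union, mem_insert, mem_singleton, not_or] at hrS ⊢
      exact ⟨hrS.1.1.1, hrS.1.2, hrS.2⟩

/-- The second path shares only its start `b` with the first. Allowing `B = ∅` covers a degenerate
continuation, such as an empty chain. -/
theorem HamPath.concat {a b c : V} {S B : Finset V} (h : HamPath G a b S)
    (h' : HamPath G b c (insert b B)) (hB : Disjoint S B) : HamPath G a c (S ∪ B) := by
  have hb : b ∉ B := disjoint_left.1 hB h.right_mem
  rcases B.eq_empty_or_nonempty with rfl | hne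
  · have : c = b := by simpa using h'.right_mem
    subst this
    simpa using h
  · obtain ⟨w, hw, hP⟩ := h'.uncons (by
      rw [card_insert_of_notMem hb]
      have := card_pos.2 hne
      omega)
    rw [erase_insert hb] at hP
    exact h.append hw hP hB

/-- From `x` a path through absorbers of all vertices of the list `rs` can be grown. -/
theorem State.exists_chain (hL : Linker G A T m d K h) (hd : 2 ≤ d) {q : ℕ} (hq : h + 1 = 2 * q)
    (rs : List V) : ∀ {F : Finset V} {g : V → ℕ} {x : V}, State G A T m d F g → rs.Nodup →
      (∀ r ∈ rs, r ∈ A ∧ r ∉ F ∧ 2 ≤ g r) → x ∈ A → x ∉ F → x ∉ rs → 1 ≤ g x →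
      reserve T m d h + rs.length * (absorberSize h + 2 * (h + 1)) ≤ K + #F →
      ∃ B ⊆ F, #B = rs.length * (absorberSize h + 2 * (h + 1)) ∧ ∃ y g',
        State G A T m d (F \ B) g' ∧ HamPath G x y (insert x B) ∧
        (∀ r ∈ rs, HamPath G x y (insert r (insert x B))) ∧ 1 ≤ g' y ∧
        (∀ z, z ∉ B → z ≠ x → z ∉ rs → g' z = g z) ∧ ∀ z ∈ rs, g z ≤ g' z + 2 := by
  induction rs with
  | nil =>
    intro F g x hS _ _ _ _ _ hgx _
    exact ⟨∅, by simp, by simp, x, g, by simpa using hS, by simpa using HamPath.single x, by simp,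
      hgx, by simp, by simp⟩
  | cons r rs ih =>
    intro F g x hS hnd hrs hxA hxF hxr hgx hK
    simp only [List.nodup_cons, List.mem_cons, not_or, List.length_cons] at hnd hrs hxr hK ⊢
    rw [Nat.add_one_mul] at hK ⊢
    have hFA : F ⊆ A := hS.subset.trans hL.host.subset
    obtain ⟨hrA, hrF, hgr⟩ := hrs r (Or.inl rfl)
    obtain ⟨S, hSF, hSc, s, t, g₁, hS₁, hP, hP', hst, hgs, hgt, hg₁, hgr₁⟩ :=
      hS.exists_absorber hL hd hq hrA hrF hgr (by omega)
    have hc₁ := card_sdiff_of_subset hSF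
    have hc₁' := card_le_card hSF
    have hsS := hP.left_mem
    have htS := hP.right_mem
    have hxS : x ∉ S := fun h => hxF (hSF h)
    have hg₁x : g₁ x = g x := hg₁ x (by simp [hxS, hxr.1])
    obtain ⟨I, hI, hIc, a, b, hQ, hxa, hbs, hS₂⟩ := hS₁.link hL hxA (hFA (hSF hsS))
      (fun h => hxS (h ▸ hsS)) (fun h => hxF (mem_sdiff.1 h).1) (by simp [hsS]) (by omega) hgs
      (by omega)
    have hc₂ := card_sdiff_of_subset hI
    have hc₂' := card_le_card hI
    have hIF : I ⊆ F := hI.trans sdiff_subset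
    have hIS : Disjoint I S := disjoint_sdiff.symm.mono_left hI
    have hxI : x ∉ I := fun h => hxF (hIF h)
    have htI : t ∉ I := fun h => disjoint_left.1 hIS h htS
    have hF₂ : ∀ z, z ∉ F → z ∉ (F \ S) \ I := fun z hz h => hz (mem_sdiff.1 (mem_sdiff.1 h).1).1
    set g₂ := spend g₁ (insert x (insert s I)) with hg₂
    have hg₂' : ∀ z, z ∉ S → z ∉ I → z ≠ x → z ≠ r → g₂ z = g z := by
      intro z h1 h2 h3 h4
      rw [hg₂, spend_of_notMem, hg₁ z (by simp [h1, h4])]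
      simp only [mem_insert, not_or]
      exact ⟨h3, fun h => h1 (h ▸ hsS), h2⟩
    have hrx : ∀ r' ∈ rs, g₂ r' = g r' := fun r' hr' => by
      have h1 := (hrs r' (Or.inr hr')).2.1
      exact hg₂' r' (fun h => h1 (hSF h)) (fun h => h1 (hIF h)) (fun h => hxr.2 (h ▸ hr'))
        (fun h => hnd.1 (h ▸ hr'))
    have hg₂t : 1 ≤ g₂ t := by
      rw [hg₂, spend_of_notMem]
      · exact hgt
      · simp only [mem_insert, not_or]
        exact ⟨fun h => hxS (h ▸ htS), hst.symm, htI⟩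
    obtain ⟨B, hB, hBc, y, g₃, hS₃, hp, hp', hgy, hgc, hgc'⟩ := ih hS₂ hnd.2
      (fun r' hr' => ⟨(hrs r' (Or.inr hr')).1, hF₂ _ (hrs r' (Or.inr hr')).2.1, by
        rw [hrx r' hr']; exact (hrs r' (Or.inr hr')).2.2⟩)
      (hFA (hSF htS)) (by simp [htS])
      (fun h => (hrs t (Or.inr h)).2.1 (hSF htS)) hg₂t (by omega)
    have hBF : B ⊆ F := hB.trans (sdiff_subset.trans sdiff_subset)
    have hBI : Disjoint I B := disjoint_sdiff.mono_right hB
    have hBS : Disjoint S B := disjoint_sdiff.mono_right (hB.trans sdiff_subset)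
    have hxB : x ∉ B := fun h => hxF (hBF h)
    have hrS : r ∉ S := fun h => hrF (hSF h)
    have hrB : r ∉ B := fun h => hrF (hBF h)
    have hrI : r ∉ I := fun h => hrF (hIF h)
    have hxI' : HamPath G x b (insert x I) := .cons hxa hxI hQ
    have hd1 : Disjoint (insert x I) S := by
      rw [disjoint_insert_left]; exact ⟨hxS, hIS⟩
    have hpre : HamPath G x t (insert x I ∪ S) := hxI'.append hbs hP hd1
    have hpre' : HamPath G x t (insert x I ∪ insert r S) := hxI'.append hbs hP' (by
      rw [disjoint_insert_right]
      refine ⟨?_, hd1⟩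
      simp only [mem_insert, not_or]
      exact ⟨Ne.symm hxr.1, hrI⟩)
    have hd2 : Disjoint (insert x I ∪ S) B := by
      rw [disjoint_union_left, disjoint_insert_left]; exact ⟨⟨hxB, hBI⟩, hBS⟩
    refine ⟨I ∪ S ∪ B, union_subset (union_subset hIF hSF) hBF, ?_, y, g₃, ?_, ?_, ?_, hgy, ?_, ?_⟩
    · rw [card_union_of_disjoint, card_union_of_disjoint hIS]
      · omega
      · rw [disjoint_union_left]; exact ⟨hBI, hBS⟩
    · convert hS₃ using 1
      clear * -
      ext x; simp only [mem_sdiff, mem_union]; tauto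
    · convert hpre.concat hp hd2 using 1
      rw [← insert_union, ← insert_union]
    -- The vertex to be absorbed belongs either to the absorber just built or to a later one; all
    -- other absorbers are traversed without their vertex.
    · rintro r' (rfl | hr')
      · convert hpre'.concat hp (by
          rw [disjoint_union_left] at hd2 ⊢
          exact ⟨hd2.1, disjoint_insert_left.2 ⟨hrB, hd2.2⟩⟩) using 1
        clear * -
        ext x; simp only [mem_insert, mem_union]; tauto
      · have h1 := hp' r' hr'
        have h2 := (hrs r' (Or.inr hr')).2.1
        rw [insert_comm] at h1
        convert hpre.concat h1 (by
          rw [disjoint_insert_right]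
          refine ⟨?_, hd2⟩
          simp only [mem_union, mem_insert, not_or]
          exact ⟨⟨fun h => hxr.2 (h ▸ hr'), fun h => h2 (hIF h)⟩, fun h => h2 (hSF h)⟩) using 1
        clear * -
        ext x; simp only [mem_insert, mem_union]; tauto
    · intro z hz hzx hzr
      simp only [mem_union, not_or] at hz hzr
      rw [hgc z hz.2 (fun h => hz.1.2 (h ▸ htS)) hzr.2, hg₂' z hz.1.2 hz.1.1 hzx hzr.1]
    · rintro z (rfl | hz)
      · rw [hgc z hrB (fun h => hrS (h ▸ htS)) hnd.1, hg₂, spend_of_notMem]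
        · exact hgr₁
        · simp only [mem_insert, not_or]
          exact ⟨Ne.symm hxr.1, fun h => hrS (h ▸ hsS), hrI⟩
      · rw [← hrx z hz]
        exact hgc' z hz

/-- A path with `n` free vertices can be grown from `y`. -/
theorem State.exists_tail (hL : Linker G A T m d K h) (n : ℕ) :
    ∀ {F : Finset V} {g : V → ℕ} {y : V}, State G A T m d F g → y ∈ A → y ∉ F → 1 ≤ g y →
      reserve T m d h + n ≤ K + #F →
      ∃ B ⊆ F, #B = n ∧ ∃ z g', State G A T m d (F \ B) g' ∧ HamPath G y z (insert y B) ∧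
        ∀ v, v ∉ insert y B → g' v = g v := by
  induction n with
  | zero =>
    intro F g y hS _ _ _ _
    exact ⟨∅, by simp, by simp, y, g, by simpa using hS, by simpa using HamPath.single y, by simp⟩
  | succ n ih =>
    intro F g y hS hyA hyF hgy hK
    obtain ⟨w, hw, hyw, hS₁⟩ := hS.leaf hL hyA hyF hgy (by omega)
    have hc := card_erase_of_mem hw
    have hF0 : 0 < #F := card_pos.2 ⟨_, hw⟩
    have hwy : w ≠ y := fun h => hyF (h ▸ hw)
    obtain ⟨B, hB, hBc, z, g', hS₂, hP, hg'⟩ := ih hS₁ (hL.host.subset (hS.subset hw)) (by simp)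
      (by rw [spend_of_notMem (by simpa using hwy), hS.free _ hw]; exact hL.one_le) (by omega)
    have hwB : w ∉ B := fun h => by simpa using hB h
    have hBF : B ⊆ F := hB.trans (erase_subset _ _)
    refine ⟨insert w B, insert_subset hw hBF, by rw [card_insert_of_notMem hwB, hBc], z, g', ?_,
      .cons hyw ?_ hP, ?_⟩
    · convert hS₂ using 1
      clear * -
      ext x; simp only [mem_sdiff, mem_insert, mem_erase]; tauto
    · rw [mem_insert, not_or]; exact ⟨hwy.symm, fun h => hyF (hBF h)⟩
    · intro v hv
      simp only [mem_insert, not_or] at hv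
      rw [hg' v (by simp [hv.2.1, hv.2.2]), spend_of_notMem (by simpa using hv.1)]

/-- From `x` a path with `n` further free vertices can be grown that can absorb any one of the
vertices of `rs`. -/
theorem State.exists_block (hL : Linker G A T m d K h) (hS : State G A T m d F g) (hd : 2 ≤ d)
    {q : ℕ} (hq : h + 1 = 2 * q) {rs : List V} {x : V} {n : ℕ} (hnd : rs.Nodup)
    (hrs : ∀ r ∈ rs, r ∈ A ∧ r ∉ F ∧ 2 ≤ g r) (hxA : x ∈ A) (hxF : x ∉ F) (hxr : x ∉ rs)
    (hgx : 1 ≤ g x) (hn : rs.length * (absorberSize h + 2 * (h + 1)) < n)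
    (hK : reserve T m d h + n ≤ K + #F) :
    ∃ B ⊆ F, #B = n ∧ ∃ y ∈ B, ∃ g', State G A T m d (F \ B) g' ∧
      (∀ r ∈ rs, HamPath G x y (insert r (insert x B))) ∧
      (∀ z, z ∉ B → z ≠ x → z ∉ rs → g' z = g z) ∧ ∀ z ∈ rs, g z ≤ g' z + 2 := by
  have hFA : F ⊆ A := hS.subset.trans hL.host.subset
  obtain ⟨B, hB, hBc, y, g₁, hS₁, hP, hP', hgy, hg₁, hg₁'⟩ :=
    hS.exists_chain hL hd hq rs hnd hrs hxA hxF hxr hgx (by omega)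
  have hc := card_sdiff_of_subset hB
  have hc' := card_le_card hB
  have hyB : y ∈ insert x B := hP.right_mem
  have hyA : y ∈ A := insert_subset hxA (hB.trans hFA) hyB
  have hyF : y ∉ F \ B := fun h => by
    rw [mem_sdiff] at h
    rcases mem_insert.1 hyB with rfl | h'
    · exact hxF h.1
    · exact h.2 h'
  obtain ⟨D, hD, hDc, z, g₂, hS₂, hQ, hg₂⟩ := hS₁.exists_tail hL (n - #B) hyA hyF hgy (by omega)
  have hDF : D ⊆ F := hD.trans sdiff_subset
  have hBD : Disjoint B D := disjoint_sdiff.mono_right hD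
  have hxD : x ∉ D := fun h => hxF (hDF h)
  -- Because `hn` is strict, the padding is nonempty, and the path ends in a new vertex rather than
  -- possibly in `x` itself.
  have hzD : z ∈ D := by
    rcases mem_insert.1 hQ.right_mem with rfl | h'
    · have hne : D.Nonempty := card_pos.1 (by omega)
      have hzD' : z ∉ D := fun h => hyF (hD h)
      obtain ⟨w, hw, hw'⟩ := hQ.symm.uncons (by
        rw [card_insert_of_notMem hzD', hDc]; omega)
      have := hw'.right_mem
      simp at this
    · exact h'
  have hrg : ∀ r, r ∉ F → r ≠ x → g₂ r = g₁ r := fun r hr hrx => hg₂ r (by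
    rw [mem_insert, not_or]
    refine ⟨?_, fun h => hr (hDF h)⟩
    rintro rfl
    rcases mem_insert.1 hyB with h | h
    · exact hrx h
    · exact hr (hB h))
  refine ⟨B ∪ D, union_subset hB hDF, by rw [card_union_of_disjoint hBD]; omega, z,
    mem_union_right _ hzD, g₂, ?_, ?_, ?_, ?_⟩
  · convert hS₂ using 1
    clear * -
    ext x; simp only [mem_sdiff, mem_union]; tauto
  · intro r hr
    convert (hP' r hr).concat hQ (by
      rw [disjoint_insert_left, disjoint_insert_left]
      exact ⟨fun h => (hrs r hr).2.1 (hDF h), hxD, hBD⟩) using 1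
    rw [insert_union, insert_union]
  · intro v hv hvx hvr
    rw [mem_union, not_or] at hv
    rw [hg₂ v, hg₁ v hv.1 hvx hvr]
    rw [mem_insert, not_or]
    refine ⟨?_, hv.2⟩
    rintro rfl
    rcases mem_insert.1 hyB with h | h
    · exact hvx h
    · exact hv.1 h
  · intro r hr
    rw [hrg r (hrs r hr).2.1 (fun h => hxr (h ▸ hr))]
    exact hg₁' r hr

end

/-! ### From absorbing paths to a path device -/

section

open Finset

variable {V : Type*} [DecidableEq V]

variable {G : SimpleGraph V} {A F F' T U U' L X : Finset V} {m d K t h : ℕ} {g g' : V → ℕ}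

/-- The blocks are built one at a time in the shrinking free set. Each block whose list contains `r`
costs `r` two units of demand, which `hdeg` bounds by `d` in total, and each `x i` is untouched
until its own turn. -/
theorem exists_blocks (hL : Linker G A T m d K h) (hE : Extendable G A m T (fun _ => d))
    (hd : 2 ≤ d) {q : ℕ} (hq : h + 1 = 2 * q) {ι : Type*} [Fintype ι] [DecidableEq ι]
    {x : ι → V} {nb : ι → List V} {n : ℕ} (hx : Function.Injective x)
    (hxA : ∀ i, x i ∈ A ∧ x i ∉ T) (hnd : ∀ i, (nb i).Nodup)
    (hnb : ∀ i, ∀ r ∈ nb i, r ∈ A ∧ r ∉ T ∧ ∀ j, r ≠ x j)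
    (hdeg : ∀ r, 2 * #{i | r ∈ nb i} ≤ d)
    (hlen : ∀ i, (nb i).length * (absorberSize h + 2 * (h + 1)) < n)
    (hK : reserve T m d h + Fintype.card ι * n ≤ K + #T) :
    ∃ (B : ι → Finset V) (y : ι → V), (∀ i, B i ⊆ T ∧ #(B i) = n ∧ y i ∈ B i ∧
      ∀ r ∈ nb i, HamPath G (x i) (y i) (insert r (insert (x i) (B i)))) ∧
      ∀ i j, i ≠ j → Disjoint (B i) (B j) := by
  have main : ∀ J : Finset ι, ∃ (B : ι → Finset V) (y : ι → V) (g : V → ℕ),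
      (∀ i ∈ J, B i ⊆ T ∧ #(B i) = n ∧ y i ∈ B i ∧
        ∀ r ∈ nb i, HamPath G (x i) (y i) (insert r (insert (x i) (B i)))) ∧
      (∀ i ∈ J, ∀ j ∈ J, i ≠ j → Disjoint (B i) (B j)) ∧
      State G A T m d (T \ J.biUnion B) g ∧ (∀ i ∉ J, g (x i) = d) ∧
      ∀ r ∉ T, (∀ j, r ≠ x j) → d ≤ g r + 2 * #{i ∈ J | r ∈ nb i} := by
    intro J
    induction J using Finset.induction_on with
    | empty =>
      refine ⟨fun _ => ∅, x, fun _ => d, by simp, by simp, ?_, by simp, by simp⟩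
      rw [biUnion_empty, sdiff_empty]
      exact ⟨subset_rfl, hE, fun _ => le_rfl, fun _ _ => rfl⟩
    | insert i J hi ih =>
      obtain ⟨B, y, g, hB, hBB, hS, hgx, hgr⟩ := ih
      have hsub : J.biUnion B ⊆ T := biUnion_subset.2 fun j hj => (hB j hj).1
      have hc := card_sdiff_of_subset hsub
      have hc' := card_le_card hsub
      have hc2 : #(J.biUnion B) ≤ #J * n :=
        card_biUnion_le_card_mul _ _ _ fun j hj => (hB j hj).2.1.le
      have hJ : #J + 1 ≤ Fintype.card ι := by
        rw [← card_insert_of_notMem hi]; exact card_le_univ _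
      have hJn := Nat.mul_le_mul_right n hJ
      rw [Nat.add_one_mul] at hJn
      have hrs : ∀ r ∈ nb i, r ∈ A ∧ r ∉ T \ J.biUnion B ∧ 2 ≤ g r := by
        intro r hr
        obtain ⟨h1, h2, h3⟩ := hnb i r hr
        refine ⟨h1, fun h => h2 (mem_sdiff.1 h).1, ?_⟩
        have h4 := hgr r h2 h3
        have h5 := hdeg r
        -- The block `i` is not among those already charged to `r`, so two units are still available
        -- for it.
        have h6 : #{j ∈ J | r ∈ nb j} + 1 ≤ #{j | r ∈ nb j} := by
          rw [← card_insert_of_notMem (a := i) (by simp [hi])]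
          refine card_le_card fun j hj => ?_
          simp only [mem_insert, mem_filter, mem_univ, true_and] at hj ⊢
          rcases hj with rfl | hj
          · exact hr
          · exact hj.2
        omega
      obtain ⟨D, hD, hDc, z, hz, g', hS', hP, hg', hg''⟩ := hS.exists_block hL hd hq (hnd i) hrs
        (hxA i).1 (fun h => (hxA i).2 (mem_sdiff.1 h).1) (fun h => (hnb i _ h).2.2 i rfl)
        (by rw [hgx i hi]; omega) (hlen i) (by omega)
      have hne : ∀ j ∈ J, j ≠ i := fun j hj h => hi (h ▸ hj)
      have hDT : D ⊆ T := hD.trans sdiff_subset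
      have hBD : ∀ j ∈ J, Disjoint (B j) D := fun j hj =>
        (disjoint_sdiff.mono_right hD).mono_left (subset_biUnion_of_mem B hj)
      refine ⟨Function.update B i D, Function.update y i z, g', ?_, ?_, ?_, ?_, ?_⟩
      · intro j hj
        rcases mem_insert.1 hj with rfl | hj
        · simpa using ⟨hDT, hDc, hz, hP⟩
        · simpa [Function.update_of_ne (hne j hj)] using hB j hj
      · intro j hj k hk hjk
        rcases mem_insert.1 hj with hj' | hj' <;> rcases mem_insert.1 hk with hk' | hk'
        · exact absurd (hj'.trans hk'.symm) hjk
        · subst hj'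
          simpa [Function.update_of_ne (hne k hk')] using (hBD k hk').symm
        · subst hk'
          simpa [Function.update_of_ne (hne j hj')] using hBD j hj'
        · simpa [Function.update_of_ne (hne j hj'), Function.update_of_ne (hne k hk')]
            using hBB j hj' k hk' hjk
      · convert hS' using 1
        rw [biUnion_insert, Function.update_self,
          biUnion_congr rfl fun j hj => Function.update_of_ne (hne j hj) D B]
        clear * -
        ext v; simp only [mem_sdiff, mem_union]; tauto
      · intro j hj
        rw [mem_insert, not_or] at hj
        rw [hg' _ (fun h => (hxA j).2 (hDT h)) (fun h => hj.1 (hx h))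
          (fun h => (hnb i _ h).2.2 j rfl), hgx j hj.2]
      · intro r hrT hrx
        have h1 := hgr r hrT hrx
        rw [filter_insert]
        split_ifs with hri
        · rw [card_insert_of_notMem (by simp [hi])]
          have := hg'' r hri
          omega
        · rw [hg' r (fun h => hrT (hDT h)) (hrx i) hri]
          exact h1
  obtain ⟨B, y, g, hB, hBB, -⟩ := main univ
  exact ⟨B, y, fun i => hB i (mem_univ i), fun i j => hBB i (mem_univ i) j (mem_univ j)⟩

/-- A linked system of paths over a robustly matchable template is a path device. -/
theorem exists_pathDevice (hL : Linker G A T m d K h) (hE : Extendable G A m T (fun _ => d))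
    (hd : 2 ≤ d) {q : ℕ} (hq : h + 1 = 2 * q) {lam n : ℕ} {R Y : Finset V}
    {x : Fin (9 * lam) → V} {nb : Fin (9 * lam) → List V} (hYc : #Y = 6 * lam) (hYR : Disjoint Y R)
    (hx : Function.Injective x) (hxA : ∀ i, x i ∈ A ∧ x i ∉ T) (hxRY : ∀ i, x i ∉ Y ∪ R)
    (hRA : R ⊆ A) (hRT : Disjoint R T) (hYA : Y ⊆ A) (hYT : Disjoint Y T)
    (hnd : ∀ i, (nb i).Nodup) (hnb : ∀ i, ∀ r ∈ nb i, r ∈ Y ∪ R)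
    (hdeg : ∀ r, 2 * #{i | r ∈ nb i} ≤ d)
    (hlen : ∀ i, (nb i).length * (absorberSize h + 2 * (h + 1)) < n)
    (hK : reserve T m d h + 9 * lam * n ≤ K + #T)
    (htemp : ∀ U ⊆ R, #U = 3 * lam → ∃ φ : Fin (9 * lam) → V, Function.Injective φ ∧
      ∀ i, φ i ∈ nb i ∧ φ i ∈ Y ∪ U) :
    ∃ (X : Finset V) (x y : Fin (9 * lam) → V), IsPathDevice G lam (n + 2) R X x y := by
  have hRYT : Disjoint (Y ∪ R) T := disjoint_union_left.2 ⟨hYT, hRT⟩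
  obtain ⟨B, y, hB, hBB⟩ := exists_blocks hL hE hd hq hx hxA hnd (fun i r hr =>
    ⟨union_subset hYA hRA (hnb i r hr), disjoint_left.1 hRYT (hnb i r hr),
      fun j hj => hxRY j (hj ▸ hnb i r hr)⟩) hdeg hlen (by simpa using hK)
  have hyT : ∀ i, y i ∈ T := fun i => (hB i).1 (hB i).2.2.1
  have hblock : ∀ i j, i ≠ j → Disjoint (insert (x i) (B i)) (insert (x j) (B j)) := by
    intro i j hij
    rw [disjoint_insert_left, disjoint_insert_right, mem_insert, not_or]
    exact ⟨⟨fun h => hij (hx h), fun h => (hxA i).2 ((hB j).1 h)⟩,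
      fun h => (hxA j).2 ((hB i).1 h), hBB i j hij⟩
  have hRYb : ∀ i, ∀ r ∈ Y ∪ R, r ∉ insert (x i) (B i) := by
    intro i r hr
    rw [mem_insert, not_or]
    exact ⟨fun h => hxRY i (h ▸ hr), fun h => disjoint_left.1 hRYT hr ((hB i).1 h)⟩
  have hmem : ∀ i, ∀ v ∈ insert (x i) (B i),
      v ∈ Y ∪ univ.biUnion fun i => insert (x i) (B i) := fun i v hv =>
    mem_union_right _ (mem_biUnion.2 ⟨i, mem_univ i, hv⟩)
  refine ⟨Y ∪ univ.biUnion fun i => insert (x i) (B i), x, y, ?_, ?_, ?_, ?_, ?_, ?_⟩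
  · rw [disjoint_union_left, disjoint_biUnion_left]
    refine ⟨hYR, fun i _ => ?_⟩
    rw [disjoint_left]
    exact fun v hv hvR => hRYb i v (mem_union_right _ hvR) hv
  · exact fun i => hmem i _ (mem_insert_self _ _)
  · exact fun i => hmem i _ (mem_insert_of_mem (hB i).2.2.1)
  · refine hx.sumElim (fun i j hij => ?_) fun i j hij => (hxA i).2 (hij ▸ hyT j)
    by_contra hne
    exact disjoint_left.1 (hBB i j hne) (hB i).2.2.1 (hij ▸ (hB j).2.2.1)
  · rw [card_union_of_disjoint, card_biUnion fun i _ j _ hij => hblock i j hij, hYc]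
    · have : ∀ i ∈ (univ : Finset (Fin (9 * lam))), #(insert (x i) (B i)) = n + 1 := by
        intro i _
        rw [card_insert_of_notMem (fun h => (hxA i).2 ((hB i).1 h)), (hB i).2.1]
      rw [sum_congr rfl this, sum_const, card_univ, Fintype.card_fin, smul_eq_mul]
      ring
    · rw [disjoint_biUnion_right]
      intro i _
      rw [disjoint_left]
      exact fun v hv => hRYb i v (mem_union_left _ hv)
  · intro U hU hUc
    obtain ⟨φ, hφ, hφn⟩ := htemp U hU hUc
    have hφRY : ∀ i, φ i ∈ Y ∪ R := fun i => hnb i _ (hφn i).1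
    have hwalk := fun i => ((hB i).2.2.2 _ (hφn i).1).exists_walk
    choose P hP1 hP2 hP3 using hwalk
    refine ⟨P, fun i => ⟨hP1 i, ?_, ?_⟩, ?_, ?_⟩
    · rw [hP2, card_insert_of_notMem (hRYb i _ (hφRY i)),
        card_insert_of_notMem (fun h => (hxA i).2 ((hB i).1 h)), (hB i).2.1]
    · intro v hv
      rw [hP3, mem_insert] at hv
      rcases hv with rfl | hv
      · rcases mem_union.1 (hφn i).2 with h | h
        · exact mem_union_left _ (mem_union_left _ h)
        · exact mem_union_right _ h
      · exact mem_union_left _ (hmem i v hv)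
    · intro i j hij v hv hv'
      rw [hP3, mem_insert] at hv hv'
      rcases hv with rfl | hv
      · rcases hv' with hv' | hv'
        · exact hij (hφ hv')
        · exact hRYb j _ (hφRY i) hv'
      · rcases hv' with rfl | hv'
        · exact hRYb i _ (hφRY j) hv
        · exact disjoint_left.1 (hblock i j hij) hv hv'
    -- `φ` is injective on `9λ` indices and `Y ∪ U` has `6λ + 3λ` elements, so every vertex of `Y ∪
    -- U` is taken in by some path.
    · have himg : univ.image φ = Y ∪ U := by
        refine eq_of_subset_of_card_le (image_subset_iff.2 fun i _ => (hφn i).2) ?_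
        rw [card_image_of_injective _ hφ, card_univ, Fintype.card_fin,
          card_union_of_disjoint (hYR.mono_right hU), hYc, hUc]
        omega
      intro v hv
      have hv' : v ∈ Y ∪ U ∨ v ∈ univ.biUnion fun i => insert (x i) (B i) := by
        simp only [mem_union] at hv ⊢
        tauto
      rcases hv' with h | h
      · rw [← himg] at h
        obtain ⟨i, -, rfl⟩ := mem_image.1 h
        exact ⟨i, (hP3 i _).2 (mem_insert_self _ _)⟩
      · obtain ⟨i, -, hi⟩ := mem_biUnion.1 h
        exact ⟨i, (hP3 i _).2 (mem_insert_of_mem hi)⟩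

end

section

open Finset

/-! ### Expanding families of maps -/

section Expand

variable {σ τ : Type*} [Fintype σ] [Fintype τ] [DecidableEq σ] [DecidableEq τ] {k s : ℕ}

/-- Every set of at most `s` elements has at least as many images under the `k` maps `F · j`. -/
def Expands (F : σ → Fin k → τ) (s : ℕ) : Prop :=
  ∀ B : Finset σ, #B ≤ s → #B ≤ #(B.biUnion fun b => univ.image (F b))

/-- A small set `B` of sources and a set `A` of fewer targets. -/
def obstacles (σ τ : Type*) [Fintype σ] [Fintype τ] [DecidableEq σ] [DecidableEq τ] (s : ℕ) :
    Finset (Finset σ × Finset τ) :=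
  (Icc 2 s).biUnion fun b => powersetCard b univ ×ˢ powersetCard (b - 1) univ

theorem mem_obstacles {x : Finset σ × Finset τ} :
    x ∈ obstacles σ τ s ↔ 2 ≤ #x.1 ∧ #x.1 ≤ s ∧ #x.2 + 1 = #x.1 := by
  simp only [obstacles, mem_biUnion, mem_Icc, mem_product, mem_powersetCard, subset_univ, true_and]
  constructor
  · rintro ⟨b, ⟨h1, h2⟩, rfl, h4⟩; omega
  · rintro ⟨h1, h2, h3⟩; exact ⟨#x.1, ⟨h1, h2⟩, rfl, by omega⟩

/-- The image of a deficient set is enlarged to exactly one element fewer than the set. One source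
is never deficient because it has an image, hence the lower bound 2 in `obstacles`. -/
theorem exists_obstacle {F : σ → Fin k → τ} (hk : 0 < k) (hs : s ≤ Fintype.card τ)
    (h : ¬ Expands F s) :
    ∃ x ∈ obstacles σ τ s, ∀ b ∈ x.1, ∀ j, F b j ∈ x.2 := by
  unfold Expands at h
  push Not at h
  obtain ⟨B, hB, hlt⟩ := h
  obtain ⟨A, hA, -, hAc⟩ := exists_subsuperset_card_eq
    (subset_univ (B.biUnion fun b => univ.image (F b))) (n := #B - 1) (by omega)
    (by rw [card_univ]; omega)
  have hmem : ∀ b ∈ B, ∀ j, F b j ∈ A := fun b hb j =>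
    hA (mem_biUnion.2 ⟨b, hb, mem_image_of_mem _ (mem_univ j)⟩)
  refine ⟨(B, A), mem_obstacles.2 ⟨?_, hB, by simp only; omega⟩, hmem⟩
  have hBne : B.Nonempty := card_pos.1 (by omega)
  obtain ⟨b, hb⟩ := hBne
  have : 0 < #A := card_pos.2 ⟨_, hmem b hb ⟨0, hk⟩⟩
  simp only
  omega

theorem sum_obstacles (w : ℕ → ℝ) :
    ∑ x ∈ obstacles σ τ s, w #x.1 = ∑ b ∈ Icc 2 s,
      ((Fintype.card σ).choose b : ℝ) * ((Fintype.card τ).choose (b - 1) : ℝ) * w b := by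
  unfold obstacles
  rw [sum_biUnion]
  · refine sum_congr rfl fun b _ => ?_
    rw [sum_congr rfl (g := fun _ => w b) (fun x hx => by
      rw [mem_product, mem_powersetCard] at hx; rw [hx.1.2])]
    rw [sum_const, card_product, card_powersetCard, card_powersetCard, card_univ, card_univ,
      nsmul_eq_mul]
    push_cast
    rfl
  · intro b _ c _ hbc
    rw [Function.onFun, disjoint_left]
    intro x hx hx'
    rw [mem_product, mem_powersetCard] at hx hx'
    exact hbc (hx.1.2.symm.trans hx'.1.2)

/-- Two expanding families of maps, from `β` to `α` and from `α` to the subset `Y` of `β`, give a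
perfect matching. -/
theorem exists_matching_of_expands {α β : Type*} [Fintype α] [DecidableEq α] [DecidableEq β]
    {Y Z U : Finset β} (hYU : Disjoint Y U) (hYZ : Y ⊆ Z) (hUZ : U ⊆ Z)
    (hc : Fintype.card α = #Y + #U) {p q : ℕ} (hp : Fintype.card α + 1 ≤ 2 * p)
    (hq : Fintype.card α ≤ 2 * q + 1) {F : Z → Fin k → α} {H : α → Fin k → Y}
    (hF : Expands F p) (hH : Expands H q) :
    ∃ φ : α → β, Function.Injective φ ∧ ∀ a, φ a ∈ Y ∪ U ∧
      ((∃ hz : φ a ∈ Z, ∃ j, F ⟨φ a, hz⟩ j = a) ∨ ∃ j, (H a j : β) = φ a) := by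
  classical
  let N : α → Finset β := fun a => {b ∈ Y ∪ U |
    (∃ hz : b ∈ Z, ∃ j, F ⟨b, hz⟩ j = a) ∨ ∃ j, (H a j : β) = b}
  have hall : ∀ A : Finset α, #A ≤ #(A.biUnion N) := by
    intro A
    -- Up to `q` elements, the maps into `Y` alone give enough neighbours.
    by_cases hA : #A ≤ q
    · refine (hH A hA).trans ?_
      rw [← card_map (Function.Embedding.subtype (· ∈ Y))]
      refine card_le_card fun b hb => ?_
      simp only [mem_map, mem_biUnion, mem_image, mem_univ, true_and,
        Function.Embedding.subtype_apply] at hb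
      obtain ⟨y, ⟨a, ha, j, rfl⟩, rfl⟩ := hb
      exact mem_biUnion.2 ⟨a, ha, mem_filter.2 ⟨mem_union_left _ (H a j).2, Or.inr ⟨j, rfl⟩⟩⟩
    -- If a larger `A` violated Hall's condition, more than `Fintype.card α - #A` elements of `Y ∪
    -- U` would be missed by it. Their images under `F` avoid `A`, contradicting the expansion of
    -- `F`; `hp` and `hq` make the two size ranges meet.
    · by_contra! hlt
      have hNsub : A.biUnion N ⊆ Y ∪ U := biUnion_subset.2 fun a _ => filter_subset _ _
      have h1 := card_sdiff_of_subset hNsub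
      have h2 := card_le_card hNsub
      rw [card_union_of_disjoint hYU, ← hc] at h1 h2
      have h3 : #A ≤ Fintype.card α := card_le_univ A
      obtain ⟨B, hB, hBc⟩ := exists_subset_card_eq
        (show Fintype.card α - #A + 1 ≤ #((Y ∪ U) \ A.biUnion N) by omega)
      have hBZ : ∀ b ∈ B, b ∈ Z := fun b hb =>
        union_subset hYZ hUZ (mem_sdiff.1 (hB hb)).1
      let B' : Finset Z := B.subtype (· ∈ Z)
      have hB'c : #B' = #B := by
        rw [card_subtype, filter_true_of_mem hBZ]
      have h4 := hF B' (by omega)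
      have h5 : (B'.biUnion fun b => univ.image (F b)) ⊆ univ \ A := by
        intro a ha
        simp only [mem_biUnion, mem_image, mem_univ, true_and] at ha
        obtain ⟨b, hb, j, rfl⟩ := ha
        rw [mem_sdiff]
        refine ⟨mem_univ _, fun haA => ?_⟩
        have hbB : (b : β) ∈ B := mem_subtype.1 hb
        refine (mem_sdiff.1 (hB hbB)).2 (mem_biUnion.2 ⟨_, haA, mem_filter.2
          ⟨(mem_sdiff.1 (hB hbB)).1, Or.inl ⟨b.2, j, rfl⟩⟩⟩)
      have h6 := card_le_card h5
      rw [card_sdiff_of_subset (subset_univ _), card_univ] at h6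
      omega
  obtain ⟨φ, hφ, hφN⟩ := (all_card_le_biUnion_card_iff_exists_injective N).1 hall
  exact ⟨φ, hφ, fun a => mem_filter.1 (hφN a)⟩

/-- The permutations mapping `B` into `A`. -/
theorem card_perm_mapsTo_le {X : Type*} [Fintype X] [DecidableEq X] (A B : Finset X) :
    (#{π : Equiv.Perm X | ∀ x ∈ B, π x ∈ A} : ℝ) ≤
      (Fintype.card X).factorial * ((#A : ℝ) / Fintype.card X) ^ #B := by
  induction B using Finset.induction_on with
  | empty => simp [Fintype.card_perm]
  | insert x B hx ih =>
    set P : Finset (Equiv.Perm X) := {π | ∀ x ∈ B, π x ∈ A} with hP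
    -- Composing with a transposition shows that, among permutations sending `B` into `A`, all
    -- points outside `B` are equally likely to be sent into `A`.
    have hsym : ∀ y ∈ univ \ B, #{π ∈ P | π y ∈ A} = #{π ∈ P | π x ∈ A} := by
      intro y hy
      have hyB : y ∉ B := (mem_sdiff.1 hy).2
      refine card_bij' (fun π _ => π * Equiv.swap x y) (fun π _ => π * Equiv.swap x y) ?_ ?_ ?_ ?_
      · intro π hπ
        simp only [hP, mem_filter, mem_univ, true_and, Equiv.Perm.coe_mul,
          Function.comp_apply] at hπ ⊢
        refine ⟨fun z hz => ?_, by rw [Equiv.swap_apply_left]; exact hπ.2⟩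
        rw [Equiv.swap_apply_of_ne_of_ne (ne_of_mem_of_not_mem hz hx) (ne_of_mem_of_not_mem hz hyB)]
        exact hπ.1 z hz
      · intro π hπ
        simp only [hP, mem_filter, mem_univ, true_and, Equiv.Perm.coe_mul,
          Function.comp_apply] at hπ ⊢
        refine ⟨fun z hz => ?_, by rw [Equiv.swap_apply_right]; exact hπ.2⟩
        rw [Equiv.swap_apply_of_ne_of_ne (ne_of_mem_of_not_mem hz hx) (ne_of_mem_of_not_mem hz hyB)]
        exact hπ.1 z hz
      · intro π _; simp [mul_assoc]
      · intro π _; simp [mul_assoc]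
    have hcount : ∀ π ∈ P, #{y ∈ univ \ B | π y ∈ A} = #A - #B := by
      intro π hπ
      have h1 : {y ∈ univ \ B | π y ∈ A} = (A \ B.image π).image π.symm := by
        ext y
        simp only [mem_filter, mem_sdiff, mem_univ, true_and, mem_image]
        constructor
        · rintro ⟨h1, h2⟩
          refine ⟨π y, ⟨h2, ?_⟩, by simp⟩
          rintro ⟨z, hz, hzy⟩
          exact h1 (π.injective hzy ▸ hz)
        · rintro ⟨a, ⟨ha, hna⟩, rfl⟩
          refine ⟨fun h => hna ⟨_, h, by simp⟩, by simpa using ha⟩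
      rw [h1, card_image_of_injective _ π.symm.injective, card_sdiff_of_subset,
        card_image_of_injective _ π.injective]
      rw [image_subset_iff]
      simpa [hP] using hπ
    have hdc : ∑ y ∈ univ \ B, #{π ∈ P | π y ∈ A} = ∑ π ∈ P, #{y ∈ univ \ B | π y ∈ A} :=
      sum_card_bipartiteAbove_eq_sum_card_bipartiteBelow (fun (y : X) (π : Equiv.Perm X) => π y ∈ A)
    rw [sum_congr rfl hsym, sum_congr rfl hcount, sum_const, sum_const, smul_eq_mul, smul_eq_mul,
      card_sdiff_of_subset (subset_univ _), card_univ] at hdc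
    have hset : ({π : Equiv.Perm X | ∀ z ∈ insert x B, π z ∈ A} : Finset _) =
        {π ∈ P | π x ∈ A} := by
      ext π
      simp only [hP, mem_filter, mem_univ, true_and, mem_insert, forall_eq_or_imp]
      tauto
    rw [hset, card_insert_of_notMem hx, pow_succ]
    have hBX : #B + 1 ≤ Fintype.card X := by
      rw [← card_insert_of_notMem hx]; exact card_le_univ _
    have hAX : #A ≤ Fintype.card X := card_le_univ _
    have hX0 : (0 : ℝ) < Fintype.card X := by
      have : 0 < Fintype.card X := by omega
      exact_mod_cast this
    rcases le_total (#A) (#B) with hAB | hAB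
    · rw [Nat.sub_eq_zero_of_le hAB, mul_zero] at hdc
      have : #{π ∈ P | π x ∈ A} = 0 := by
        rcases Nat.mul_eq_zero.1 hdc with h | h
        · omega
        · exact h
      rw [this]
      simp only [Nat.cast_zero]
      positivity
    · have hdc' : ((Fintype.card X : ℝ) - #B) * #{π ∈ P | π x ∈ A} = #P * ((#A : ℝ) - #B) := by
        rw [← Nat.cast_sub hAB, ← Nat.cast_sub (show #B ≤ Fintype.card X by omega)]
        exact_mod_cast hdc
      have hpos : (0 : ℝ) < (Fintype.card X : ℝ) - #B := by
        have : (#B : ℝ) + 1 ≤ Fintype.card X := by exact_mod_cast hBX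
        linarith
      have hAX' : (#A : ℝ) ≤ Fintype.card X := by exact_mod_cast hAX
      -- Hence the conditional proportion is `(#A - #B) / (N - #B)` with `N = Fintype.card X`, which
      -- is at most `#A / N`: drawing without replacement only helps.
      have hstep : (#{π ∈ P | π x ∈ A} : ℝ) ≤ #P * ((#A : ℝ) / Fintype.card X) := by
        rw [← mul_le_mul_iff_right₀ hpos, hdc', ← sub_nonneg]
        have : ((Fintype.card X : ℝ) - #B) * (#P * ((#A : ℝ) / Fintype.card X)) -
            #P * ((#A : ℝ) - #B) = #P * #B * ((Fintype.card X - #A) / Fintype.card X) := by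
          field_simp
          ring
        rw [this]
        have : (0 : ℝ) ≤ Fintype.card X - #A := by linarith
        positivity
      calc (#{π ∈ P | π x ∈ A} : ℝ) ≤ #P * ((#A : ℝ) / Fintype.card X) := hstep
        _ ≤ _ := by
          rw [← mul_assoc]
          exact mul_le_mul_of_nonneg_right ih (by positivity)

end Expand

end

/-! ### The union bound over obstacles -/

section

open Finset

theorem pow_six_le_two_pow {b : ℕ} (hb : 30 ≤ b) : b ^ 6 ≤ 2 ^ b := by
  induction b, hb using Nat.le_induction with
  | base => norm_num
  | succ b hb ih =>
    have h1 : (b + 1) ^ 6 ≤ 2 * b ^ 6 := by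
      have h2 : (30 * (b + 1)) ^ 6 ≤ (31 * b) ^ 6 := Nat.pow_le_pow_left (by omega) 6
      rw [mul_pow, mul_pow] at h2
      have h3 : 31 ^ 6 * b ^ 6 ≤ (2 * 30 ^ 6) * b ^ 6 := Nat.mul_le_mul_right _ (by norm_num)
      have h4 : 30 ^ 6 * (b + 1) ^ 6 ≤ 30 ^ 6 * (2 * b ^ 6) := by
        calc _ ≤ _ := h2
          _ ≤ _ := h3
          _ = _ := by ring
      exact Nat.le_of_mul_le_mul_left h4 (by norm_num)
    rw [pow_succ 2 b]
    omega

theorem choose_le_exp_div_pow (N b : ℕ) (hb : 0 < b) :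
    (N.choose b : ℝ) ≤ (Real.exp 1 * N / b) ^ b := by
  have hb' : (0 : ℝ) < b := by exact_mod_cast hb
  have h1 : (N.choose b : ℝ) ≤ (N : ℝ) ^ b / b.factorial := Nat.choose_le_pow_div b N
  have h2 := Real.pow_div_factorial_le_exp (x := (b : ℝ)) hb'.le b
  have hf : (0 : ℝ) < b.factorial := by exact_mod_cast b.factorial_pos
  have he : Real.exp (b : ℝ) = Real.exp 1 ^ b := by rw [← Real.exp_nat_mul]; simp
  rw [he, div_le_iff₀ hf] at h2
  refine h1.trans ?_
  rw [div_pow, mul_pow, div_le_div_iff₀ hf (by positivity)]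
  nlinarith [pow_nonneg (Nat.cast_nonneg (α := ℝ) N) b]

/-- The weight of an obstacle with `b` sources. -/
noncomputable def obstacleWeight (t b : ℕ) : ℝ := (11 / 10 * b / t) ^ (20 * b)

/-- With `y = b / t`, the number of pairs is at most `(3e² / (2y²)) ^ b`, while the weight is `((11y
/ 10) ^ 20) ^ b`. The twenty maps leave a factor `y ^ 18` inside the power, and `75` bounds the
constants. -/
theorem obstacle_term_le {S t b : ℕ} (ht : 900 ≤ t) (hS : 2 * S ≤ 3 * t) (hb : 2 ≤ b)
    (hbt : 4 * b ≤ 3 * t) :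
    (S.choose b : ℝ) * (t.choose (b - 1) : ℝ) * obstacleWeight t b ≤ 1 / (t : ℝ) ^ 3 := by
  have ht0 : (0 : ℝ) < t := by exact_mod_cast (by omega : 0 < t)
  have hb0 : (0 : ℝ) < b := by exact_mod_cast (by omega : 0 < b)
  have hS' : (S : ℝ) ≤ 3 / 2 * t := by
    have : (2 : ℝ) * S ≤ 3 * t := by exact_mod_cast hS
    linarith
  have hbt' : (b : ℝ) / t ≤ 3 / 4 := by
    rw [div_le_iff₀ ht0]
    have : (4 : ℝ) * b ≤ 3 * t := by exact_mod_cast hbt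
    linarith
  set y : ℝ := b / t with hy
  have hy0 : 0 < y := by positivity
  have h1 : (S.choose b : ℝ) ≤ (Real.exp 1 * (3 / 2) / y) ^ b := by
    refine (choose_le_exp_div_pow S b (by omega)).trans (pow_le_pow_left₀ (by positivity) ?_ b)
    rw [hy, div_div_eq_mul_div]
    apply div_le_div_of_nonneg_right _ hb0.le
    have := mul_le_mul_of_nonneg_left hS' (Real.exp_pos 1).le
    linarith
  have h2 : (t.choose (b - 1) : ℝ) ≤ (Real.exp 1 / y) ^ b := by
    have hc : ((b - 1).factorial : ℝ) = b.factorial / b := by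
      rw [eq_div_iff hb0.ne']
      have := Nat.mul_factorial_pred (show b ≠ 0 by omega)
      rw [mul_comm]
      exact_mod_cast this
    have h3 : (t.choose (b - 1) : ℝ) ≤ (t : ℝ) ^ (b - 1) / (b - 1).factorial :=
      Nat.choose_le_pow_div (b - 1) t
    have h4 := Real.pow_div_factorial_le_exp (x := (b : ℝ)) hb0.le b
    have hf : (0 : ℝ) < b.factorial := by exact_mod_cast b.factorial_pos
    have he : Real.exp (b : ℝ) = Real.exp 1 ^ b := by rw [← Real.exp_nat_mul]; simp
    rw [he] at h4
    have h5 : (t : ℝ) ^ (b - 1) / (b - 1).factorial = (t : ℝ) ^ b / b.factorial * y := by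
      rw [hc, hy]
      obtain ⟨c, rfl⟩ : ∃ c, b = c + 1 := ⟨b - 1, by omega⟩
      rw [Nat.add_sub_cancel, pow_succ]
      field_simp
    have h6 : (t : ℝ) ^ b / b.factorial = ((b : ℝ) ^ b / b.factorial) / y ^ b := by
      rw [hy, div_pow]
      field_simp
    rw [h5, h6] at h3
    refine h3.trans ?_
    rw [div_pow (Real.exp 1)]
    have h7 : (b : ℝ) ^ b / b.factorial / y ^ b ≤ Real.exp 1 ^ b / y ^ b :=
      div_le_div_of_nonneg_right h4 (by positivity)
    have h8 : 0 ≤ (b : ℝ) ^ b / b.factorial / y ^ b := by positivity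
    nlinarith
  have h3 : obstacleWeight t b = ((11 / 10 * y) ^ 20) ^ b := by
    rw [obstacleWeight, ← pow_mul, hy, mul_div_assoc]
  have he2 : Real.exp 1 ^ 2 ≤ 7.3891 := by
    have := Real.exp_one_lt_d9
    have h0 := Real.exp_pos 1
    nlinarith
  have hbase : Real.exp 1 * (3 / 2) / y * (Real.exp 1 / y) * (11 / 10 * y) ^ 20 ≤ 75 * y ^ 18 := by
    have : Real.exp 1 * (3 / 2) / y * (Real.exp 1 / y) * (11 / 10 * y) ^ 20 =
        (3 / 2 * (11 / 10) ^ 20 * Real.exp 1 ^ 2) * y ^ 18 := by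
      field_simp
    rw [this]
    refine mul_le_mul_of_nonneg_right ?_ (by positivity)
    calc 3 / 2 * (11 / 10) ^ 20 * Real.exp 1 ^ 2 ≤ 3 / 2 * (11 / 10) ^ 20 * 7.3891 :=
          mul_le_mul_of_nonneg_left he2 (by positivity)
      _ ≤ 75 := by norm_num
  have hterm : (S.choose b : ℝ) * (t.choose (b - 1) : ℝ) * obstacleWeight t b ≤
      (75 * y ^ 18) ^ b := by
    rw [h3]
    calc _ ≤ (Real.exp 1 * (3 / 2) / y) ^ b * (Real.exp 1 / y) ^ b * ((11 / 10 * y) ^ 20) ^ b := by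
          gcongr
      _ = (Real.exp 1 * (3 / 2) / y * (Real.exp 1 / y) * (11 / 10 * y) ^ 20) ^ b := by
          rw [← mul_pow, ← mul_pow]
      _ ≤ _ := pow_le_pow_left₀ (by positivity) hbase b
  refine hterm.trans ?_
  -- For `b² ≤ t` the base is at most `t⁻²`, and `b ≥ 2` suffices. For larger `b` the base is at
  -- most `1 / 2`, and `2 ^ b ≥ b ^ 6 ≥ t ^ 3`; here `t ≥ 900` forces `b ≥ 30`.
  rcases le_or_gt (b ^ 2) t with hc | hc
  · have hy2 : y ^ 2 ≤ 1 / t := by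
      rw [hy, div_pow, div_le_div_iff₀ (by positivity) ht0]
      have : (b : ℝ) ^ 2 ≤ t := by exact_mod_cast hc
      nlinarith
    have hy18 : 75 * y ^ 18 ≤ 1 / (t : ℝ) ^ 2 := by
      have e : y ^ 18 = (y ^ 2) ^ 9 := by ring
      have h5 : (y ^ 2) ^ 9 ≤ (1 / (t : ℝ)) ^ 9 := pow_le_pow_left₀ (by positivity) hy2 9
      have ht9 : (900 : ℝ) ≤ t := by exact_mod_cast ht
      have h6 : (75 : ℝ) ≤ t ^ 7 := by
        calc (75 : ℝ) ≤ 900 ^ 7 := by norm_num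
          _ ≤ _ := pow_le_pow_left₀ (by norm_num) ht9 7
      have h7 : 75 * (1 / (t : ℝ)) ^ 9 ≤ 1 / (t : ℝ) ^ 2 := by
        rw [div_pow, one_pow, mul_one_div, div_le_div_iff₀ (by positivity) (by positivity)]
        nlinarith [pow_pos ht0 2]
      rw [e]
      linarith
    have ht1 : (1 : ℝ) ≤ t := by exact_mod_cast (by omega : 1 ≤ t)
    calc (75 * y ^ 18) ^ b ≤ (1 / (t : ℝ) ^ 2) ^ b := pow_le_pow_left₀ (by positivity) hy18 b
      _ ≤ (1 / (t : ℝ) ^ 2) ^ 2 := by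
          apply pow_le_pow_of_le_one (by positivity) _ hb
          rw [div_le_one (by positivity)]
          exact one_le_pow₀ ht1
      _ = 1 / (t : ℝ) ^ 4 := by rw [div_pow, one_pow, ← pow_mul]
      _ ≤ 1 / (t : ℝ) ^ 3 := by
          apply one_div_le_one_div_of_le (by positivity)
          exact pow_le_pow_right₀ ht1 (by norm_num)
  · have hb30 : 30 ≤ b := by
      by_contra! h
      have : b ^ 2 ≤ 29 ^ 2 := Nat.pow_le_pow_left (by omega) 2
      omega
    have h5 : 75 * y ^ 18 ≤ 1 / 2 := by
      have : y ^ 18 ≤ (3 / 4) ^ 18 := pow_le_pow_left₀ hy0.le hbt' 18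
      calc 75 * y ^ 18 ≤ 75 * (3 / 4) ^ 18 := by linarith
        _ ≤ 1 / 2 := by norm_num
    have h6 : (t : ℝ) ^ 3 ≤ 2 ^ b := by
      have h7 : t ^ 3 ≤ 2 ^ b := by
        calc t ^ 3 ≤ (b ^ 2) ^ 3 := Nat.pow_le_pow_left hc.le 3
          _ = b ^ 6 := by rw [← pow_mul]
          _ ≤ _ := pow_six_le_two_pow hb30
      exact_mod_cast h7
    calc (75 * y ^ 18) ^ b ≤ (1 / 2) ^ b := pow_le_pow_left₀ (by positivity) h5 b
      _ = 1 / 2 ^ b := by rw [div_pow, one_pow]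
      _ ≤ 1 / (t : ℝ) ^ 3 := one_div_le_one_div_of_le (by positivity) h6

section

variable {σ τ : Type*} [Fintype σ] [Fintype τ] [DecidableEq σ] [DecidableEq τ] {k s : ℕ}

theorem sum_obstacleWeight_le (ht : 900 ≤ Fintype.card τ)
    (hS : 2 * Fintype.card σ ≤ 3 * Fintype.card τ) (hs : 4 * s ≤ 3 * Fintype.card τ) :
    ∑ x ∈ obstacles σ τ s, obstacleWeight (Fintype.card τ) #x.1 ≤
      1 / (Fintype.card τ : ℝ) ^ 2 := by
  rw [sum_obstacles]
  set t := Fintype.card τ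
  have ht0 : (0 : ℝ) < t := by exact_mod_cast (by omega : 0 < t)
  calc _ ≤ ∑ b ∈ Icc 2 s, 1 / (t : ℝ) ^ 3 := sum_le_sum fun b hb => by
        rw [mem_Icc] at hb
        exact obstacle_term_le ht hS hb.1 (by omega)
    _ = (s + 1 - 2 : ℕ) * (1 / (t : ℝ) ^ 3) := by rw [sum_const, Nat.card_Icc, nsmul_eq_mul]
    _ ≤ t * (1 / (t : ℝ) ^ 3) := by
        refine mul_le_mul_of_nonneg_right ?_ (by positivity)
        exact_mod_cast (by omega : s + 1 - 2 ≤ t)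
    _ = _ := by field_simp

/-- There is an expanding family of 20 maps in which every element has at most 40 preimages. -/
theorem exists_expands (ht : 900 ≤ Fintype.card τ)
    (hS : 2 * Fintype.card σ ≤ 3 * Fintype.card τ) (hs : 4 * s ≤ 3 * Fintype.card τ) :
    ∃ F : σ → Fin 20 → τ, Expands F s ∧ ∀ y, #{p : σ × Fin 20 | F p.1 p.2 = y} ≤ 40 := by
  -- The maps are induced by twenty permutations of two copies of `τ`, into which `σ` embeds. Each
  -- permutation then has at most two preimages over each element, which gives the bound 40.
  obtain ⟨ι⟩ : Nonempty (σ ↪ τ × Bool) := by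
    rw [Function.Embedding.nonempty_iff_card_le, Fintype.card_prod, Fintype.card_bool]
    omega
  set N := Fintype.card (τ × Bool) with hN
  have hNt : (N : ℝ) = 2 * Fintype.card τ := by
    rw [hN, Fintype.card_prod, Fintype.card_bool]; push_cast; ring
  have ht0 : (0 : ℝ) < Fintype.card τ := by exact_mod_cast (by omega : 0 < Fintype.card τ)
  let bad : Finset σ × Finset τ → Finset (Fin 20 → Equiv.Perm (τ × Bool)) := fun x =>
    Fintype.piFinset fun _ => {π | ∀ z ∈ x.1.map ι, π z ∈ x.2 ×ˢ univ}
  have hbad : ∀ x ∈ obstacles σ τ s, (#(bad x) : ℝ) ≤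
      (N.factorial : ℝ) ^ 20 * obstacleWeight (Fintype.card τ) #x.1 := by
    intro x hx
    have hx' := mem_obstacles.1 hx
    rw [Fintype.card_piFinset_const, Nat.cast_pow]
    have h1 := card_perm_mapsTo_le (x.2 ×ˢ (univ : Finset Bool)) (x.1.map ι)
    rw [card_map, card_product, card_univ, Fintype.card_bool] at h1
    -- For permutations the ratio is `(b - 1) / t`; the factor `11 / 10` in the weight is slack that
    -- the random graph version uses up.
    have h2 : (((#x.2 * 2 : ℕ) : ℝ) / N) ≤ 11 / 10 * #x.1 / Fintype.card τ := by
      rw [hNt, div_le_div_iff₀ (by positivity) ht0]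
      have h3 : (#x.2 : ℝ) + 1 = #x.1 := by exact_mod_cast hx'.2.2
      push_cast
      nlinarith [(Nat.cast_nonneg (#x.1) : (0 : ℝ) ≤ _)]
    calc _ ≤ ((N.factorial : ℝ) * (((#x.2 * 2 : ℕ) : ℝ) / N) ^ #x.1) ^ 20 :=
          pow_le_pow_left₀ (Nat.cast_nonneg _) h1 20
      _ ≤ ((N.factorial : ℝ) * (11 / 10 * #x.1 / Fintype.card τ) ^ #x.1) ^ 20 := by gcongr
      _ = _ := by rw [mul_pow, ← pow_mul, obstacleWeight, mul_comm 20]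
  have hlt : #((obstacles σ τ s).biUnion bad) <
      #(univ : Finset (Fin 20 → Equiv.Perm (τ × Bool))) := by
    have h1 : (#((obstacles σ τ s).biUnion bad) : ℝ) ≤
        (N.factorial : ℝ) ^ 20 * (1 / (Fintype.card τ : ℝ) ^ 2) := by
      calc (#((obstacles σ τ s).biUnion bad) : ℝ) ≤ ∑ x ∈ obstacles σ τ s, (#(bad x) : ℝ) := by
            exact_mod_cast card_biUnion_le
        _ ≤ ∑ x ∈ obstacles σ τ s, (N.factorial : ℝ) ^ 20 * obstacleWeight (Fintype.card τ) #x.1 :=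
            sum_le_sum hbad
        _ ≤ _ := by
            rw [← mul_sum]
            exact mul_le_mul_of_nonneg_left (sum_obstacleWeight_le ht hS hs) (by positivity)
    have h2 : (#(univ : Finset (Fin 20 → Equiv.Perm (τ × Bool))) : ℝ) = (N.factorial : ℝ) ^ 20 := by
      rw [card_univ, Fintype.card_fun, Fintype.card_perm, Fintype.card_fin]
      push_cast
      rfl
    have h3 : (1 : ℝ) / (Fintype.card τ : ℝ) ^ 2 < 1 := by
      rw [div_lt_one (by positivity)]
      exact one_lt_pow₀ (by exact_mod_cast (by omega : 1 < Fintype.card τ)) (by norm_num)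
    have h4 : (0 : ℝ) < (N.factorial : ℝ) ^ 20 := by positivity
    have h5 : (#((obstacles σ τ s).biUnion bad) : ℝ) <
        #(univ : Finset (Fin 20 → Equiv.Perm (τ × Bool))) := by
      rw [h2]
      nlinarith
    exact_mod_cast h5
  obtain ⟨ω, -, hω⟩ := exists_mem_notMem_of_card_lt_card hlt
  refine ⟨fun b j => (ω j (ι b)).1, ?_, fun y => ?_⟩
  · by_contra hcon
    obtain ⟨x, hx, hxF⟩ := exists_obstacle (by norm_num) (by omega) hcon
    refine hω (mem_biUnion.2 ⟨x, hx, ?_⟩)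
    simp only [bad, Fintype.mem_piFinset, mem_filter, mem_univ, true_and, mem_map, mem_product,
      and_true]
    rintro j z ⟨b, hb, rfl⟩
    exact hxF b hb j
  · have h1 : #{p : σ × Fin 20 | (ω p.2 (ι p.1)).1 = y} ≤ #(univ : Finset (Fin 20 × Bool)) := by
      refine card_le_card_of_injOn (fun p => (p.2, (ω p.2 (ι p.1)).2)) (by simp) ?_
      rintro ⟨b, j⟩ hp ⟨b', j'⟩ hp' heq
      simp only [coe_filter, mem_univ, true_and, Set.mem_ofPred_eq] at hp hp'
      simp only [Prod.mk.injEq] at heq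
      obtain ⟨rfl, h2⟩ := heq
      have h3 : ω j (ι b) = ω j (ι b') := Prod.ext (hp.trans hp'.symm) h2
      rw [ι.injective ((ω j).injective h3)]
    simpa using h1

end

end

section

open Finset MeasureTheory

/-! ### Cylinder events of the binomial random graph -/

section Cylinder

variable {V : Type*} [Fintype V] [DecidableEq V] (p : unitInterval)

/-- The graphs that contain all edges of the first set and none of the second. -/
def cyl (S S' : Finset (Sym2 V)) : Set (SimpleGraph V) :=
  {G | (∀ e ∈ S, e ∈ G.edgeSet) ∧ ∀ e ∈ S', e ∉ G.edgeSet}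

/-- The law of the binomial random graph. -/
noncomputable abbrev gnp (V : Type*) [Fintype V] (p : unitInterval) :
    Measure (SimpleGraph V) := SimpleGraph.binomialRandom V p

theorem measurableSet_cyl (S S' : Finset (Sym2 V)) : MeasurableSet (cyl S S') := by
  have : cyl S S' = SimpleGraph.edgeSet ⁻¹'
      ((⋂ e ∈ S, {s | e ∈ s}) ∩ ⋂ e ∈ S', {s : Set (Sym2 V) | e ∈ s}ᶜ) := by
    ext G; simp [cyl]
  rw [this]
  refine SimpleGraph.measurable_edgeSet (MeasurableSet.inter ?_ ?_)
  · exact .biInter S.countable_toSet fun e _ => measurableSet_mem e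
  · exact .biInter S'.countable_toSet fun e _ => (measurableSet_mem e).compl

/-- The edge set is a product of independent trials over all non-diagonal pairs, so a cylinder event
is a box. -/
theorem gnp_cyl {S S' : Finset (Sym2 V)} (hd : Disjoint S S') (hS : ∀ e ∈ S, ¬ e.IsDiag)
    (hS' : ∀ e ∈ S', ¬ e.IsDiag) :
    (gnp V p).real (cyl S S') = (p : ℝ) ^ #S * (1 - (p : ℝ)) ^ #S' := by
  classical
  have h1 : gnp V p (cyl S S') = Measure.infinitePi
      (fun i : Sym2 V => unitInterval.toNNReal p • Measure.dirac (i ∈ Sym2.diagSetᶜ) +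
        unitInterval.toNNReal (unitInterval.symm p) • Measure.dirac False)
      (Set.pi ↑(S ∪ S') fun e => if e ∈ S then {True} else {False}) := by
    rw [gnp, SimpleGraph.binomialRandom_eq_map, Measure.map_apply
      SimpleGraph.measurable_fromEdgeSet (measurableSet_cyl S S'),
      ProbabilityTheory.setBernoulli_apply']
    congr 1
    ext f
    simp only [Set.mem_preimage, cyl, Set.mem_ofPred_eq, SimpleGraph.edgeSet_fromEdgeSet,
      Set.mem_sdiff, Set.mem_pi, coe_union, Set.mem_union, mem_coe]
    constructor
    · rintro ⟨h1, h2⟩ e he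
      by_cases heS : e ∈ S
      · have := h1 e heS
        rw [if_pos heS]
        simpa using this.1
      · rw [if_neg heS]
        have heS' := he.resolve_left heS
        have := h2 e heS'
        have h3 := hS' e heS'
        simp only [Set.mem_singleton_iff, eq_iff_iff, iff_false]
        intro hf
        exact this ⟨hf, h3⟩
    · intro h
      refine ⟨fun e he => ?_, fun e he hf => ?_⟩
      · have := h e (Or.inl he)
        rw [if_pos he] at this
        exact ⟨by simpa using this, hS e he⟩
      · have := h e (Or.inr he)
        rw [if_neg (disjoint_right.1 hd he)] at this
        simp only [Set.mem_singleton_iff, eq_iff_iff, iff_false] at this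
        exact this hf.1
  rw [measureReal_def, h1, Measure.infinitePi_pi _ (fun _ _ => MeasurableSet.of_discrete),
    prod_union hd, ENNReal.toReal_mul, ENNReal.toReal_prod, ENNReal.toReal_prod]
  congr 1
  · rw [← prod_const]
    refine prod_congr rfl fun e he => ?_
    have h2 : e ∈ (Sym2.diagSetᶜ : Set (Sym2 V)) := hS e he
    rw [if_pos he]
    simp [h2]
  · rw [← prod_const]
    refine prod_congr rfl fun e he => ?_
    have h2 : e ∈ (Sym2.diagSetᶜ : Set (Sym2 V)) := hS' e he
    rw [if_neg (disjoint_right.1 hd he)]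
    simp [h2]

end Cylinder

end

/-! ### Joinedness and expansion of the random graph -/

section

open Finset MeasureTheory

variable {V : Type*} [Fintype V] [DecidableEq V] {p : unitInterval}

/-- The pairs with one element in `P` and one in `Q`. -/
def pairEdges (P Q : Finset V) : Finset (Sym2 V) := (P ×ˢ Q).image fun x => s(x.1, x.2)

theorem mem_pairEdges {P Q : Finset V} {e : Sym2 V} :
    e ∈ pairEdges P Q ↔ ∃ a ∈ P, ∃ b ∈ Q, s(a, b) = e := by
  simp only [pairEdges, mem_image, mem_product, Prod.exists]
  constructor
  · rintro ⟨a, b, ⟨ha, hb⟩, h⟩; exact ⟨a, ha, b, hb, h⟩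
  · rintro ⟨a, ha, b, hb, h⟩; exact ⟨a, b, ⟨ha, hb⟩, h⟩

theorem card_pairEdges {P Q : Finset V} (h : Disjoint P Q) : #(pairEdges P Q) = #P * #Q := by
  rw [pairEdges, card_image_of_injOn, card_product]
  rintro ⟨a, b⟩ hab ⟨c, d⟩ hcd heq
  simp only [coe_product, Set.mem_prod, mem_coe] at hab hcd
  simp only [Sym2.eq_iff] at heq
  rcases heq with ⟨h1, h2⟩ | ⟨h1, h2⟩
  · rw [h1, h2]
  · exact absurd hcd.2 (disjoint_left.1 h (h1 ▸ hab.1))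

theorem not_isDiag_of_mem_pairEdges {P Q : Finset V} (h : Disjoint P Q) {e : Sym2 V}
    (he : e ∈ pairEdges P Q) : ¬ e.IsDiag := by
  obtain ⟨a, ha, b, hb, rfl⟩ := mem_pairEdges.1 he
  rw [Sym2.mk_isDiag_iff]
  rintro rfl
  exact disjoint_left.1 h ha hb

theorem one_sub_nonneg : (0 : ℝ) ≤ 1 - (p : ℝ) := sub_nonneg.2 p.2.2

theorem one_sub_le_one : 1 - (p : ℝ) ≤ 1 := sub_le_self _ p.2.1

/-- The probability that two disjoint sets of `m` vertices of `A` are not joined by an edge. -/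
theorem gnp_not_joined_le (A : Finset V) (m : ℕ) :
    (gnp V p).real {G | ¬ ∀ P ⊆ A, ∀ Q ⊆ A, Disjoint P Q → m ≤ #P → m ≤ #Q →
      ∃ a ∈ P, ∃ b ∈ Q, G.Adj a b} ≤ 4 ^ #A * (1 - (p : ℝ)) ^ (m * m) := by
  let I : Finset (Finset V × Finset V) :=
    {x ∈ A.powerset ×ˢ A.powerset | Disjoint x.1 x.2 ∧ #x.1 = m ∧ #x.2 = m}
  have hsub : {G : SimpleGraph V | ¬ ∀ P ⊆ A, ∀ Q ⊆ A, Disjoint P Q → m ≤ #P → m ≤ #Q →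
      ∃ a ∈ P, ∃ b ∈ Q, G.Adj a b} ⊆ ⋃ x ∈ I, cyl ∅ (pairEdges x.1 x.2) := by
    intro G hG
    rw [Set.mem_ofPred_eq] at hG
    push Not at hG
    obtain ⟨P, hP, Q, hQ, hd, hPm, hQm, hno⟩ := hG
    obtain ⟨P', hP', hPc⟩ := exists_subset_card_eq hPm
    obtain ⟨Q', hQ', hQc⟩ := exists_subset_card_eq hQm
    simp only [Set.mem_iUnion]
    refine ⟨(P', Q'), ?_, by simp, ?_⟩
    · simp only [I, mem_filter, mem_product, mem_powerset]
      exact ⟨⟨hP'.trans hP, hQ'.trans hQ⟩, hd.mono hP' hQ', hPc, hQc⟩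
    · intro e he
      obtain ⟨a, ha, b, hb, rfl⟩ := mem_pairEdges.1 he
      exact hno a (hP' ha) b (hQ' hb)
  have hI : (#I : ℝ) ≤ 4 ^ #A := by
    have h1 : #I ≤ 2 ^ #A * 2 ^ #A := by
      refine (card_filter_le _ _).trans ?_
      rw [card_product, card_powerset]
    have h2 : 2 ^ #A * 2 ^ #A = 4 ^ #A := by rw [← mul_pow]; norm_num
    exact_mod_cast h2 ▸ h1
  calc _ ≤ (gnp V p).real (⋃ x ∈ I, cyl ∅ (pairEdges x.1 x.2)) :=
        measureReal_mono hsub (measure_ne_top _ _)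
    _ ≤ ∑ x ∈ I, (gnp V p).real (cyl ∅ (pairEdges x.1 x.2)) := measureReal_biUnion_finset_le _ _
    _ = ∑ x ∈ I, (1 - (p : ℝ)) ^ (m * m) := by
        refine sum_congr rfl fun x hx => ?_
        simp only [I, mem_filter] at hx
        rw [gnp_cyl _ (disjoint_empty_left _) (by simp)
          (fun e he => not_isDiag_of_mem_pairEdges hx.2.1 he), card_pairEdges hx.2.1, hx.2.2.1,
          hx.2.2.2]
        simp
    _ ≤ _ := by
        rw [sum_const, nsmul_eq_mul]
        exact mul_le_mul_of_nonneg_right hI (pow_nonneg one_sub_nonneg _)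

/-- The probability that `U` has exactly the neighbours `X` in `T`. -/
theorem gnp_nbrIn_eq_le {U T X : Finset V} (hUT : Disjoint U T) (hX : X ⊆ T) :
    (gnp V p).real {G | nbrIn G T U = X} ≤
      (#U * (p : ℝ)) ^ #X * (1 - (p : ℝ)) ^ (#U * (#T - #X)) := by
  let E : (∀ x ∈ X, V) → Finset (Sym2 V) := fun f => X.attach.image fun x => s(f x.1 x.2, x.1)
  have hUX : ∀ x ∈ X, x ∉ U := fun x hx => disjoint_right.1 hUT (hX hx)
  have hUTX : Disjoint U (T \ X) := hUT.mono_right sdiff_subset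
  have hsub : {G : SimpleGraph V | nbrIn G T U = X} ⊆
      ⋃ f ∈ X.pi fun _ => U, cyl (E f) (pairEdges U (T \ X)) := by
    intro G hG
    rw [Set.mem_ofPred_eq] at hG
    have h1 : ∀ x : V, ∀ hx : x ∈ X, ∃ u ∈ U, G.Adj u x := fun x hx => by
      rw [← hG] at hx; exact (mem_nbrIn.1 hx).2
    choose f hf hfa using h1
    simp only [Set.mem_iUnion]
    refine ⟨f, mem_pi.2 hf, ?_, ?_⟩
    · intro e he
      simp only [E, mem_image, mem_attach, true_and, Subtype.exists] at he
      obtain ⟨x, hx, rfl⟩ := he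
      exact hfa x hx
    · intro e he
      obtain ⟨a, ha, b, hb, rfl⟩ := mem_pairEdges.1 he
      rw [mem_sdiff, ← hG] at hb
      exact fun hab => hb.2 (mem_nbrIn.2 ⟨hb.1, a, ha, hab⟩)
  have hE : ∀ f ∈ X.pi fun _ => U, #(E f) = #X ∧ (∀ e ∈ E f, ¬ e.IsDiag) ∧
      Disjoint (E f) (pairEdges U (T \ X)) := by
    intro f hf
    rw [mem_pi] at hf
    refine ⟨?_, ?_, ?_⟩
    · rw [card_image_of_injective, card_attach]
      rintro ⟨x, hx⟩ ⟨y, hy⟩ hxy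
      simp only [Sym2.eq_iff] at hxy
      rcases hxy with ⟨-, h⟩ | ⟨h, -⟩
      · exact Subtype.ext h
      · exact absurd (h ▸ hf x hx) (hUX y hy)
    · intro e he
      simp only [E, mem_image, mem_attach, true_and, Subtype.exists] at he
      obtain ⟨x, hx, rfl⟩ := he
      rw [Sym2.mk_isDiag_iff]
      exact fun h => hUX x hx (h ▸ hf x hx)
    · rw [disjoint_left]
      intro e he he'
      simp only [E, mem_image, mem_attach, true_and, Subtype.exists] at he
      obtain ⟨x, hx, rfl⟩ := he
      obtain ⟨a, ha, b, hb, hab⟩ := mem_pairEdges.1 he'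
      rw [mem_sdiff] at hb
      rcases Sym2.eq_iff.1 hab with ⟨-, h⟩ | ⟨h, -⟩
      · exact hb.2 (h ▸ hx)
      · exact hUX x hx (h ▸ ha)
  calc _ ≤ (gnp V p).real (⋃ f ∈ X.pi fun _ => U, cyl (E f) (pairEdges U (T \ X))) :=
        measureReal_mono hsub (measure_ne_top _ _)
    _ ≤ ∑ f ∈ X.pi fun _ => U, (gnp V p).real (cyl (E f) (pairEdges U (T \ X))) :=
        measureReal_biUnion_finset_le _ _
    _ = ∑ f ∈ X.pi fun _ => U, (p : ℝ) ^ #X * (1 - (p : ℝ)) ^ (#U * (#T - #X)) := by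
        refine sum_congr rfl fun f hf => ?_
        obtain ⟨h1, h2, h3⟩ := hE f hf
        rw [gnp_cyl _ h3 h2 (fun e he => not_isDiag_of_mem_pairEdges hUTX he),
          card_pairEdges hUTX, h1, card_sdiff_of_subset hX]
    _ = _ := by
        rw [sum_const, nsmul_eq_mul, card_pi, prod_const, mul_pow, ← mul_assoc]
        push_cast
        rfl

/-- For `K ≥ y` the exponent in `(K / y) ^ x` can be raised to `y`, so one bound serves all smaller
neighbourhood sizes. -/
theorem pow_div_factorial_le_of_le {K : ℝ} {x y : ℕ} (hxy : x ≤ y) (hy : 0 < y) (hK : (y : ℝ) ≤ K) :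
    K ^ x / x.factorial ≤ (Real.exp 1 * K / y) ^ y := by
  have hy0 : (0 : ℝ) < y := by exact_mod_cast hy
  have h1 := Real.pow_div_factorial_le_exp (x := (y : ℝ)) hy0.le x
  have he : Real.exp (y : ℝ) = Real.exp 1 ^ y := by rw [← Real.exp_nat_mul]; simp
  rw [he] at h1
  have hK1 : 1 ≤ K / y := by rwa [one_le_div hy0]
  calc K ^ x / x.factorial = (K / y) ^ x * ((y : ℝ) ^ x / x.factorial) := by
        rw [div_pow]; field_simp
    _ ≤ (K / y) ^ y * Real.exp 1 ^ y :=
        mul_le_mul (pow_le_pow_right₀ hK1 hxy) h1 (by positivity) (by positivity)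
    _ = _ := by rw [← mul_pow]; congr 1; ring

/-- The probability that the set `U` of `u` vertices has fewer than `κ u` neighbours in `T`. -/
theorem gnp_card_nbrIn_lt_le {U T : Finset V} {κ M W : ℕ} (hκ : 0 < κ) (hU : 0 < #U)
    (hUM : κ * #U ≤ M) (hT : W + 2 * M ≤ #T) (hp : (κ : ℝ) ≤ #T * p) :
    (gnp V p).real {G | #(nbrIn G T U) < κ * #U} ≤
      M * ((Real.exp 1 * (#T * p) / κ) ^ κ * (1 - (p : ℝ)) ^ W) ^ #U := by
  set y := κ * #U with hy
  have hy0 : 0 < y := Nat.mul_pos hκ hU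
  -- `U` may meet `T`, so neighbours are counted in `T \ U` only; the slack `2M` in `hT` pays for
  -- the removed vertices and for the at most `M` neighbours.
  let I : Finset (Finset V) := (range y).biUnion fun x => powersetCard x (T \ U)
  have hsub : {G : SimpleGraph V | #(nbrIn G T U) < y} ⊆
      ⋃ X ∈ I, {G | nbrIn G (T \ U) U = X} := by
    intro G hG
    rw [Set.mem_ofPred_eq] at hG
    simp only [Set.mem_iUnion, Set.mem_ofPred_eq, exists_prop, exists_eq_right']
    simp only [I, mem_biUnion, mem_range, mem_powersetCard]
    refine ⟨_, (card_le_card (nbrIn_mono_left sdiff_subset)).trans_lt hG, ?_, rfl⟩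
    exact fun v hv => (mem_nbrIn.1 hv).1
  have hUT : Disjoint U (T \ U) := disjoint_sdiff
  have hUle : #U ≤ M := (Nat.le_mul_of_pos_left _ hκ).trans hUM
  have hTU : W + M ≤ #(T \ U) := by
    have := le_card_sdiff U T
    omega
  have hTU' : #(T \ U) ≤ #T := card_le_card sdiff_subset
  have hp0 : (0 : ℝ) ≤ p := p.2.1
  have hu0 : (0 : ℝ) < #U := by exact_mod_cast hU
  have hκ0 : (0 : ℝ) < κ := by exact_mod_cast hκ
  set K : ℝ := #T * (#U * (p : ℝ)) with hK
  have hyK : (y : ℝ) ≤ K := by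
    rw [hy, hK]; push_cast
    nlinarith
  have hbase : Real.exp 1 * K / y = Real.exp 1 * (#T * p) / κ := by
    rw [hy, hK]; push_cast
    field_simp
  calc _ ≤ (gnp V p).real (⋃ X ∈ I, {G | nbrIn G (T \ U) U = X}) :=
        measureReal_mono hsub (measure_ne_top _ _)
    _ ≤ ∑ X ∈ I, (gnp V p).real {G | nbrIn G (T \ U) U = X} := measureReal_biUnion_finset_le _ _
    _ ≤ ∑ X ∈ I, (#U * (p : ℝ)) ^ #X * (1 - (p : ℝ)) ^ (#U * W) := by
        refine sum_le_sum fun X hX => ?_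
        simp only [I, mem_biUnion, mem_range, mem_powersetCard] at hX
        obtain ⟨x, hx, hXT, hXc⟩ := hX
        refine (gnp_nbrIn_eq_le hUT hXT).trans (mul_le_mul_of_nonneg_left ?_ (by positivity))
        exact pow_le_pow_of_le_one one_sub_nonneg one_sub_le_one
          (Nat.mul_le_mul_left _ (by omega))
    _ = ∑ x ∈ range y, ((#(T \ U)).choose x : ℝ) *
          ((#U * (p : ℝ)) ^ x * (1 - (p : ℝ)) ^ (#U * W)) := by
        rw [sum_biUnion]
        · refine sum_congr rfl fun x _ => ?_
          rw [sum_congr rfl (g := fun _ => (#U * (p : ℝ)) ^ x * (1 - (p : ℝ)) ^ (#U * W))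
            (fun X hX => by rw [(mem_powersetCard.1 hX).2])]
          rw [sum_const, card_powersetCard, nsmul_eq_mul]
        · intro b _ c _ hbc
          rw [Function.onFun, disjoint_left]
          intro x hx hx'
          exact hbc ((mem_powersetCard.1 hx).2.symm.trans (mem_powersetCard.1 hx').2)
    _ ≤ ∑ x ∈ range y, (Real.exp 1 * K / y) ^ y * (1 - (p : ℝ)) ^ (#U * W) := by
        refine sum_le_sum fun x hx => ?_
        rw [← mul_assoc]
        refine mul_le_mul_of_nonneg_right ?_ (pow_nonneg one_sub_nonneg _)
        refine le_trans ?_ (pow_div_factorial_le_of_le (mem_range.1 hx).le hy0 hyK)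
        calc ((#(T \ U)).choose x : ℝ) * (#U * (p : ℝ)) ^ x
            ≤ ((#T : ℝ) ^ x / x.factorial) * (#U * (p : ℝ)) ^ x := by
              refine mul_le_mul_of_nonneg_right ?_ (by positivity)
              refine (Nat.choose_le_pow_div (α := ℝ) x _).trans ?_
              gcongr
          _ = _ := by rw [hK, mul_pow]; ring
    _ = y * ((Real.exp 1 * K / y) ^ y * (1 - (p : ℝ)) ^ (#U * W)) := by
        rw [sum_const, card_range, nsmul_eq_mul]
    _ = y * ((Real.exp 1 * (#T * p) / κ) ^ κ * (1 - (p : ℝ)) ^ W) ^ #U := by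
        rw [hbase, mul_pow, ← pow_mul, ← pow_mul, mul_comm (#U) W]
    _ ≤ _ := by
        refine mul_le_mul_of_nonneg_right (by exact_mod_cast hUM) ?_
        have := one_sub_nonneg (p := p)
        positivity

/-- Every subset of `A` expands into `T` by the factor `κ`, up to size `M`. -/
def ExpandsInto (G : SimpleGraph V) (A T : Finset V) (κ M : ℕ) : Prop :=
  ∀ U ⊆ A, κ * #U ≤ M → κ * #U ≤ #(nbrIn G T U)

/-- There are at most `#A ^ u` sets of size `u`, and the factor `#A` is absorbed into the `u`-th
power bounded by `ρ ^ u ≤ ρ`. The factors `M` count the sizes of `U` and of its neighbourhood. -/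
theorem gnp_not_expandsInto_le {A T : Finset V} {κ M W : ℕ} {ρ : ℝ} (hκ : 0 < κ)
    (hT : W + 2 * M ≤ #T) (hp : (κ : ℝ) ≤ #T * p)
    (hρ : #A * ((Real.exp 1 * (#T * p) / κ) ^ κ * (1 - (p : ℝ)) ^ W) ≤ ρ) (hρ1 : ρ ≤ 1) :
    (gnp V p).real {G | ¬ ExpandsInto G A T κ M} ≤ M * M * ρ := by
  let I : Finset (Finset V) := (Icc 1 M).biUnion fun u => powersetCard u A
  set c : ℝ := (Real.exp 1 * (#T * p) / κ) ^ κ * (1 - (p : ℝ)) ^ W with hc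
  have hp0 : (0 : ℝ) ≤ p := p.2.1
  have hc0 : 0 ≤ c := by
    have := one_sub_nonneg (p := p)
    positivity
  have hρ0 : 0 ≤ ρ := le_trans (by positivity) hρ
  have hsub : {G : SimpleGraph V | ¬ ExpandsInto G A T κ M} ⊆
      ⋃ U ∈ I, {G | κ * #U ≤ M ∧ #(nbrIn G T U) < κ * #U} := by
    intro G hG
    rw [Set.mem_ofPred_eq, ExpandsInto] at hG
    push Not at hG
    obtain ⟨U, hU, hUM, hlt⟩ := hG
    simp only [Set.mem_iUnion]
    refine ⟨U, ?_, hUM, hlt⟩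
    simp only [I, mem_biUnion, mem_Icc, mem_powersetCard]
    refine ⟨#U, ⟨?_, (Nat.le_mul_of_pos_left _ hκ).trans hUM⟩, hU, rfl⟩
    by_contra! h0
    have : #U = 0 := by omega
    rw [this] at hlt
    simp at hlt
  calc _ ≤ (gnp V p).real (⋃ U ∈ I, {G | κ * #U ≤ M ∧ #(nbrIn G T U) < κ * #U}) :=
        measureReal_mono hsub (measure_ne_top _ _)
    _ ≤ ∑ U ∈ I, (gnp V p).real {G | κ * #U ≤ M ∧ #(nbrIn G T U) < κ * #U} :=
        measureReal_biUnion_finset_le _ _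
    _ ≤ ∑ U ∈ I, M * c ^ #U := by
        refine sum_le_sum fun U hU => ?_
        simp only [I, mem_biUnion, mem_Icc, mem_powersetCard] at hU
        obtain ⟨u, hu, hUA, rfl⟩ := hU
        by_cases hUM : κ * #U ≤ M
        · refine (measureReal_mono (fun G hG => hG.2) (measure_ne_top _ _)).trans
            (gnp_card_nbrIn_lt_le hκ (by omega) hUM hT hp)
        · simp only [hUM, false_and]
          rw [show ({_G : SimpleGraph V | False} : Set _) = ∅ by ext; simp, measureReal_empty]
          positivity
    _ = ∑ u ∈ Icc 1 M, ((#A).choose u : ℝ) * (M * c ^ u) := by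
        rw [sum_biUnion]
        · refine sum_congr rfl fun u _ => ?_
          rw [sum_congr rfl (g := fun _ => (M : ℝ) * c ^ u)
            (fun X hX => by rw [(mem_powersetCard.1 hX).2])]
          rw [sum_const, card_powersetCard, nsmul_eq_mul]
        · intro b _ c _ hbc
          rw [Function.onFun, disjoint_left]
          intro x hx hx'
          exact hbc ((mem_powersetCard.1 hx).2.symm.trans (mem_powersetCard.1 hx').2)
    _ ≤ ∑ u ∈ Icc 1 M, M * ρ := by
        refine sum_le_sum fun u hu => ?_
        rw [mem_Icc] at hu
        calc ((#A).choose u : ℝ) * (M * c ^ u) ≤ (#A : ℝ) ^ u * (M * c ^ u) := by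
              refine mul_le_mul_of_nonneg_right ?_ (by positivity)
              exact_mod_cast Nat.choose_le_pow (#A) u
          _ = M * (#A * c) ^ u := by rw [mul_pow]; ring
          _ ≤ M * ρ ^ u := by gcongr
          _ ≤ M * ρ := by
              refine mul_le_mul_of_nonneg_left ?_ (by positivity)
              exact pow_le_of_le_one hρ0 hρ1 (by omega)
    _ = _ := by
        rw [sum_const, Nat.card_Icc, nsmul_eq_mul, Nat.add_sub_cancel, mul_assoc]

end

section

open Finset MeasureTheory

/-! ### Choosing the first hit in a cyclic order -/

section Rotation

/-- Translation in `ZMod`: for a fixed offset every element comes from one start, and from a fixed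
start no element repeats within one turn. -/
theorem exists_rotation (τ : Type*) [Fintype τ] [Nonempty τ] :
    ∃ rot : τ → ℕ → τ, (∀ k, Function.Injective fun θ => rot θ k) ∧
      ∀ θ, Set.InjOn (rot θ) (Set.Iio (Fintype.card τ)) := by
  have : NeZero (Fintype.card τ) := ⟨Fintype.card_ne_zero⟩
  let eq : τ ≃ ZMod (Fintype.card τ) := Fintype.equivOfCardEq (ZMod.card _).symm
  refine ⟨fun θ k => eq.symm (eq θ + k), fun k a b hab => ?_, fun θ k hk l hl hkl => ?_⟩
  · simpa using hab
  · simp only [EmbeddingLike.apply_eq_iff_eq, add_right_inj] at hkl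
    have := congrArg ZMod.val hkl
    rwa [ZMod.val_cast_of_lt hk, ZMod.val_cast_of_lt hl] at this

variable {τ : Type*} [Fintype τ] [DecidableEq τ]

/-- The total weight of the rotations of `θ` that lie in `A`. -/
noncomputable def rotWeight (rot : τ → ℕ → τ) (w : ℕ) (p : ℝ) (A : Finset τ) (θ : τ) : ℝ :=
  ∑ k ∈ range (Fintype.card τ) with rot θ k ∈ A, w * p * (1 - p) ^ (w * k)

theorem rotWeight_nonneg {rot : τ → ℕ → τ} {w : ℕ} {p : ℝ} (hp0 : 0 ≤ p) (hp1 : p ≤ 1)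
    (A : Finset τ) (θ : τ) : 0 ≤ rotWeight rot w p A θ := by
  have : 0 ≤ 1 - p := by linarith
  exact sum_nonneg fun k _ => by positivity

/-- By Bernoulli's inequality `r = (1 - p) ^ w` satisfies `r (1 + wp) ≤ (1 - p²) ^ w ≤ 1`, that is,
`wp ≤ (1 + wp)(1 - r)`, and the geometric sum is at most `1 / (1 - r)`. -/
theorem geom_le_one_add {w : ℕ} {p : ℝ} (hp0 : 0 ≤ p) (hp1 : p ≤ 1) (N : ℕ) :
    ∑ k ∈ range N, w * p * (1 - p) ^ (w * k) ≤ 1 + w * p := by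
  have h0 : 0 ≤ 1 - p := by linarith
  set r := (1 - p) ^ w with hr
  have hr0 : 0 ≤ r := pow_nonneg h0 w
  have h1 : r * (1 + w * p) ≤ 1 := by
    have hb : 1 + (w : ℝ) * p ≤ (1 + p) ^ w := one_add_mul_le_pow (by linarith) w
    calc r * (1 + w * p) ≤ (1 - p) ^ w * (1 + p) ^ w := mul_le_mul_of_nonneg_left hb hr0
      _ = (1 - p ^ 2) ^ w := by rw [← mul_pow]; ring_nf
      _ ≤ 1 := pow_le_one₀ (by nlinarith) (by nlinarith)
  have h2 : ∀ N : ℕ, (∑ k ∈ range N, r ^ k) * (1 - r) ≤ 1 := by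
    intro N
    rw [geom_sum_mul_neg]
    have := pow_nonneg hr0 N
    linarith
  have h3 : ∑ k ∈ range N, w * p * (1 - p) ^ (w * k) = w * p * ∑ k ∈ range N, r ^ k := by
    rw [mul_sum]
    exact sum_congr rfl fun k _ => by rw [hr, ← pow_mul]
  rw [h3]
  have h4 := h2 N
  set s := ∑ k ∈ range N, r ^ k with hs
  have hs0 : 0 ≤ s := sum_nonneg fun k _ => pow_nonneg hr0 k
  have hwp : 0 ≤ (w : ℝ) * p := by positivity
  have h5 : (w : ℝ) * p ≤ (1 + w * p) * (1 - r) := by nlinarith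
  calc (w : ℝ) * p * s ≤ (1 + w * p) * (1 - r) * s := mul_le_mul_of_nonneg_right h5 hs0
    _ = (1 + w * p) * (s * (1 - r)) := by ring
    _ ≤ (1 + w * p) * 1 := mul_le_mul_of_nonneg_left h4 (by linarith)
    _ = _ := mul_one _

/-- From a fixed start early positions are favoured. Summed over all starts, each position lands in
`A` at most `#A` times, which restores uniformity up to the factor `1 + wp`. -/
theorem sum_rotWeight_le {rot : τ → ℕ → τ} (hrot : ∀ k, Function.Injective fun θ => rot θ k)
    {w : ℕ} {p : ℝ} (hp0 : 0 ≤ p) (hp1 : p ≤ 1) (A : Finset τ) :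
    ∑ θ, rotWeight rot w p A θ ≤ #A * (1 + w * p) := by
  have h0 : 0 ≤ 1 - p := by linarith
  have h1 : ∑ θ, rotWeight rot w p A θ =
      ∑ k ∈ range (Fintype.card τ), #{θ | rot θ k ∈ A} * (w * p * (1 - p) ^ (w * k)) := by
    simp only [rotWeight, sum_filter]
    rw [sum_comm]
    refine sum_congr rfl fun k _ => ?_
    rw [← sum_filter, sum_const, nsmul_eq_mul]
  rw [h1]
  calc _ ≤ ∑ k ∈ range (Fintype.card τ), #A * (w * p * (1 - p) ^ (w * k)) := by
        refine sum_le_sum fun k _ => mul_le_mul_of_nonneg_right ?_ (by positivity)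
        have : #{θ | rot θ k ∈ A} ≤ #A :=
          card_le_card_of_injOn (fun θ => rot θ k) (fun θ hθ => by simpa using hθ)
            (hrot k).injOn
        exact_mod_cast this
    _ ≤ _ := by
        rw [← mul_sum]
        exact mul_le_mul_of_nonneg_left (geom_le_one_add hp0 hp1 _) (by positivity)

/-- Some choice of starting points is at least as good as the average. -/
theorem exists_rotation_start [Nonempty τ] {σ : Type*} [Fintype σ] [DecidableEq σ] {κ s : ℕ}
    {rot : τ → ℕ → τ} (hrot : ∀ k, Function.Injective fun θ => rot θ k) {w : ℕ} {p : ℝ}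
    (hp0 : 0 ≤ p) (hp1 : p ≤ 1) (hwp : w * p ≤ 1 / 10) :
    ∃ θ : σ × Fin κ → τ, ∑ x ∈ obstacles σ τ s, ∏ i ∈ x.1 ×ˢ univ, rotWeight rot w p x.2 (θ i) ≤
      ∑ x ∈ obstacles σ τ s, (11 / 10 * (#x.1 : ℝ) / Fintype.card τ) ^ (κ * #x.1) := by
  set t := Fintype.card τ with ht
  have ht0 : (0 : ℝ) < t := by exact_mod_cast Fintype.card_pos
  set N := Fintype.card (σ × Fin κ) with hN
  -- Averaging over independent starts turns the sum of products into a product of sums. Each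
  -- relevant factor is at most `#x.2 * (1 + wp)`, and `hwp` yields the constant `11 / 10`.
  suffices key : ∑ θ : σ × Fin κ → τ, ∑ x ∈ obstacles σ τ s,
      ∏ i ∈ x.1 ×ˢ univ, rotWeight rot w p x.2 (θ i) ≤ ∑ _θ : σ × Fin κ → τ,
        ∑ x ∈ obstacles σ τ s, (11 / 10 * (#x.1 : ℝ) / t) ^ (κ * #x.1) by
    obtain ⟨θ, -, hθ⟩ := exists_le_of_sum_le univ_nonempty key
    exact ⟨θ, hθ⟩
  rw [sum_comm, sum_const, card_univ, Fintype.card_fun, nsmul_eq_mul, mul_sum]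
  refine sum_le_sum fun x hx => ?_
  have hx' := mem_obstacles.1 hx
  set J : Finset (σ × Fin κ) := x.1 ×ˢ univ with hJ
  have hJc : #J = κ * #x.1 := by rw [hJ, card_product, card_univ, Fintype.card_fin, mul_comm]
  have h1 : ∑ θ : σ × Fin κ → τ, ∏ i ∈ J, rotWeight rot w p x.2 (θ i) =
      ∏ i, ∑ c, if i ∈ J then rotWeight rot w p x.2 c else 1 := by
    rw [prod_univ_sum, Fintype.piFinset_univ]
    refine sum_congr rfl fun θ _ => ?_
    rw [prod_ite, prod_const_one, mul_one, filter_mem_eq_inter, univ_inter]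
  rw [h1, ← hJc]
  have h2 : ∀ i, (∑ c, if i ∈ J then rotWeight rot w p x.2 c else (1 : ℝ)) ≤
      t * if i ∈ J then (11 / 10 * (#x.1 : ℝ) / t) else 1 := by
    intro i
    split_ifs with hi
    · refine (sum_rotWeight_le hrot hp0 hp1 x.2).trans ?_
      have h3 : (#x.2 : ℝ) + 1 = #x.1 := by exact_mod_cast hx'.2.2
      rw [mul_div_cancel₀ _ ht0.ne']
      have h4 : (0 : ℝ) ≤ #x.2 := Nat.cast_nonneg _
      nlinarith
    · rw [sum_const, card_univ, nsmul_eq_mul]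
  calc ∏ i, ∑ c, (if i ∈ J then rotWeight rot w p x.2 c else (1 : ℝ))
      ≤ ∏ i, ((t : ℝ) * if i ∈ J then (11 / 10 * (#x.1 : ℝ) / t) else 1) := by
        refine prod_le_prod (fun i _ => sum_nonneg fun c _ => ?_) fun i _ => h2 i
        split_ifs
        · exact rotWeight_nonneg hp0 hp1 _ _
        · exact zero_le_one
    _ = _ := by
        rw [prod_mul_distrib, prod_const, card_univ, prod_ite, prod_const_one, mul_one,
          filter_mem_eq_inter, univ_inter, prod_const]
        push_cast
        rfl

end Rotation

end

/-! ### First hits conditioned on a cylinder event -/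

section

open Finset MeasureTheory

variable {V : Type*} [Fintype V] [DecidableEq V] {p : unitInterval}

theorem gnp_cyl_union {S S' E E' : Finset (Sym2 V)} (hd : Disjoint S S')
    (hS : ∀ e ∈ S, ¬ e.IsDiag) (hS' : ∀ e ∈ S', ¬ e.IsDiag) (hdE : Disjoint E E')
    (hE : ∀ e ∈ E, ¬ e.IsDiag) (hE' : ∀ e ∈ E', ¬ e.IsDiag)
    (hav : ∀ e ∈ E ∪ E', e ∉ S ∪ S') :
    (gnp V p).real (cyl (S ∪ E) (S' ∪ E')) =
      (gnp V p).real (cyl S S') * ((p : ℝ) ^ #E * (1 - (p : ℝ)) ^ #E') := by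
  simp only [mem_union, not_or] at hav
  have h1 : Disjoint S E := disjoint_left.2 fun e he he' => (hav e (Or.inl he')).1 he
  have h2 : Disjoint S' E' := disjoint_left.2 fun e he he' => (hav e (Or.inr he')).2 he
  rw [gnp_cyl _ _ _ _, gnp_cyl _ hd hS hS', card_union_of_disjoint h1, card_union_of_disjoint h2,
    pow_add, pow_add]
  · ring
  · rw [disjoint_union_left, disjoint_union_right, disjoint_union_right]
    exact ⟨⟨hd, disjoint_left.2 fun e he he' => (hav e (Or.inr he')).1 he⟩,
      disjoint_left.2 fun e he he' => (hav e (Or.inl he)).2 he', hdE⟩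
  · intro e he
    rcases mem_union.1 he with h | h
    exacts [hS e h, hE e h]
  · intro e he
    rcases mem_union.1 he with h | h
    exacts [hS' e h, hE' e h]

/-- Some vertex of `Z` is adjacent to `c`. -/
def Hits (G : SimpleGraph V) (Z : Finset V) (c : V) : Prop := ∃ z ∈ Z, G.Adj z c

/-- The first vertex of `D`, in the order of the rotations of `θ`, that is hit by `Z` lies
in `A`. -/
def FirstHitIn (G : SimpleGraph V) {D : Finset V} (rot : D → ℕ → D) (Z : Finset V) (θ : D)
    (A : Finset D) : Prop :=
  ∃ k < #D, rot θ k ∈ A ∧ Hits G Z (rot θ k) ∧ ∀ l < k, ¬ Hits G Z (rot θ l)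

/-- For each `i`, fixing the position `k` of the first hit and a vertex of `Z i` realising it
prescribes one present edge and `wk` absent ones. Summing over the `w` vertices and the positions in
`A` gives `rotWeight`. -/
theorem gnp_firstHitIn_le {ι : Type*} [Fintype ι] [DecidableEq ι] {D : Finset V} {rot : D → ℕ → D}
    (hrot : ∀ θ, Set.InjOn (rot θ) (Set.Iio #D)) {Z : ι → Finset V} {w : ℕ}
    (hZ : ∀ i j, i ≠ j → Disjoint (Z i) (Z j)) (hZw : ∀ i, #(Z i) = w)
    (hZD : ∀ i, Disjoint (Z i) D) {S S' : Finset (Sym2 V)} (hd : Disjoint S S')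
    (hS : ∀ e ∈ S, ¬ e.IsDiag) (hS' : ∀ e ∈ S', ¬ e.IsDiag)
    (hav : ∀ i, ∀ e ∈ pairEdges (Z i) D, e ∉ S ∪ S') (θ : ι → D) (A : Finset D) :
    (gnp V p).real (cyl S S' ∩ {G | ∀ i, FirstHitIn G rot (Z i) (θ i) A}) ≤
      (gnp V p).real (cyl S S') * ∏ i, rotWeight rot w p A (θ i) := by
  let opt : ι → Finset (ℕ × V) := fun i => {k ∈ range #D | rot (θ i) k ∈ A} ×ˢ Z i
  let E : (ι → ℕ × V) → Finset (Sym2 V) := fun ξ =>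
    univ.image fun i => s((ξ i).2, (rot (θ i) (ξ i).1 : V))
  let Q : (ι → ℕ × V) → ι → Finset V := fun ξ i =>
    (range (ξ i).1).image fun l => (rot (θ i) l : V)
  let E' : (ι → ℕ × V) → Finset (Sym2 V) := fun ξ => univ.biUnion fun i => pairEdges (Z i) (Q ξ i)
  have hQD : ∀ ξ i, Q ξ i ⊆ D := by
    intro ξ i v hv
    simp only [Q, mem_image] at hv
    obtain ⟨l, -, rfl⟩ := hv
    exact (rot (θ i) l).2
  have hsub : cyl S S' ∩ {G : SimpleGraph V | ∀ i, FirstHitIn G rot (Z i) (θ i) A} ⊆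
      ⋃ ξ ∈ Fintype.piFinset opt, cyl (S ∪ E ξ) (S' ∪ E' ξ) := by
    rintro G ⟨hG, hG'⟩
    rw [Set.mem_ofPred_eq] at hG'
    choose k hk hkA hhit hmiss using hG'
    choose z hz hadj using hhit
    simp only [Set.mem_iUnion]
    refine ⟨fun i => (k i, z i), ?_, ?_, ?_⟩
    · simp only [Fintype.mem_piFinset, opt, mem_product, mem_filter, mem_range]
      exact fun i => ⟨⟨hk i, hkA i⟩, hz i⟩
    · intro e he
      rcases mem_union.1 he with he | he
      · exact hG.1 e he
      · simp only [E, mem_image, mem_univ, true_and] at he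
        obtain ⟨i, rfl⟩ := he
        exact hadj i
    · intro e he
      rcases mem_union.1 he with he | he
      · exact hG.2 e he
      · simp only [E', mem_biUnion, mem_univ, true_and] at he
        obtain ⟨i, he⟩ := he
        obtain ⟨a, ha, b, hb, rfl⟩ := mem_pairEdges.1 he
        simp only [Q, mem_image, mem_range] at hb
        obtain ⟨l, hl, rfl⟩ := hb
        exact fun hab => hmiss i l hl ⟨a, ha, hab⟩
  have hcyl : ∀ ξ ∈ Fintype.piFinset opt, (gnp V p).real (cyl (S ∪ E ξ) (S' ∪ E' ξ)) =
      (gnp V p).real (cyl S S') * ∏ i, ((p : ℝ) * (1 - (p : ℝ)) ^ (w * (ξ i).1)) := by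
    intro ξ hξ
    simp only [Fintype.mem_piFinset, opt, mem_product, mem_filter, mem_range] at hξ
    have hzD : ∀ i, ∀ z ∈ Z i, z ∉ D := fun i z hz => disjoint_left.1 (hZD i) hz
    have hEE : ∀ i, s((ξ i).2, (rot (θ i) (ξ i).1 : V)) ∈ pairEdges (Z i) D := fun i =>
      mem_pairEdges.2 ⟨_, (hξ i).2, _, (rot (θ i) (ξ i).1).2, rfl⟩
    have hEE' : ∀ i, pairEdges (Z i) (Q ξ i) ⊆ pairEdges (Z i) D := fun i e he => by
      obtain ⟨a, ha, b, hb, rfl⟩ := mem_pairEdges.1 he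
      exact mem_pairEdges.2 ⟨a, ha, b, hQD ξ i hb, rfl⟩
    -- The sets `Z i` are disjoint from each other and from `D`, so a pair determines its index. The
    -- prescribed pairs are thus distinct for distinct `i`, which makes the probability a product.
    have huniq : ∀ i j e, e ∈ pairEdges (Z i) D → e ∈ pairEdges (Z j) D → i = j := by
      intro i j e he he'
      obtain ⟨a, ha, b, hb, rfl⟩ := mem_pairEdges.1 he
      obtain ⟨a', ha', b', hb', heq⟩ := mem_pairEdges.1 he'
      by_contra hij
      rcases Sym2.eq_iff.1 heq with ⟨rfl, -⟩ | ⟨rfl, -⟩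
      · exact disjoint_left.1 (hZ i j hij) ha ha'
      · exact hzD j _ ha' hb
    have hEmem : ∀ e ∈ E ξ, ∃ i, e ∈ pairEdges (Z i) D ∧
        e = s((ξ i).2, (rot (θ i) (ξ i).1 : V)) := by
      intro e he
      simp only [E, mem_image, mem_univ, true_and] at he
      obtain ⟨i, rfl⟩ := he
      exact ⟨i, hEE i, rfl⟩
    have hEmem' : ∀ e ∈ E' ξ, ∃ i, e ∈ pairEdges (Z i) D ∧ e ∈ pairEdges (Z i) (Q ξ i) := by
      intro e he
      simp only [E', mem_biUnion, mem_univ, true_and] at he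
      obtain ⟨i, he⟩ := he
      exact ⟨i, hEE' i he, he⟩
    have hcE : #(E ξ) = Fintype.card ι := by
      rw [card_image_of_injective, card_univ]
      intro i j hij
      refine huniq i j _ (hEE i) ?_
      simp only at hij
      rw [hij]
      exact hEE j
    have hcQ : ∀ i, #(Q ξ i) = (ξ i).1 := by
      intro i
      rw [card_image_of_injOn, card_range]
      intro l hl l' hl' hll
      have h1 := (hξ i).1.1
      simp only [coe_range, Set.mem_Iio] at hl hl'
      exact hrot (θ i) (hl.trans h1) (hl'.trans h1) (Subtype.ext hll)
    have hcE' : #(E' ξ) = ∑ i, w * (ξ i).1 := by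
      rw [card_biUnion]
      · refine sum_congr rfl fun i _ => ?_
        rw [card_pairEdges ((hZD i).mono_right (hQD ξ i)), hZw, hcQ]
      · intro i _ j _ hij
        exact disjoint_left.2 fun e he he' => hij (huniq i j e (hEE' i he) (hEE' j he'))
    rw [gnp_cyl_union hd hS hS', hcE, hcE', prod_mul_distrib, prod_const, card_univ,
      prod_pow_eq_pow_sum]
    · rw [disjoint_left]
      intro e he he'
      obtain ⟨i, hi, rfl⟩ := hEmem e he
      obtain ⟨j, hj, hj'⟩ := hEmem' _ he'
      obtain rfl := huniq i j _ hi hj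
      obtain ⟨a, ha, b, hb, heq⟩ := mem_pairEdges.1 hj'
      rcases Sym2.eq_iff.1 heq with ⟨-, h⟩ | ⟨h, -⟩
      · rw [h] at hb
        simp only [Q, mem_image, mem_range] at hb
        obtain ⟨l, hl, hlk⟩ := hb
        have h1 := (hξ i).1.1
        exact hl.ne (hrot (θ i) (hl.trans h1) h1 (Subtype.ext hlk))
      · exact hzD i a ha (h ▸ (rot (θ i) (ξ i).1).2)
    · intro e he
      obtain ⟨i, hi, -⟩ := hEmem e he
      exact not_isDiag_of_mem_pairEdges (hZD i) hi
    · intro e he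
      obtain ⟨i, hi, -⟩ := hEmem' e he
      exact not_isDiag_of_mem_pairEdges (hZD i) hi
    · intro e he
      rcases mem_union.1 he with he | he
      · obtain ⟨i, hi, -⟩ := hEmem e he
        exact hav i e hi
      · obtain ⟨i, hi, -⟩ := hEmem' e he
        exact hav i e hi
  calc _ ≤ (gnp V p).real (⋃ ξ ∈ Fintype.piFinset opt, cyl (S ∪ E ξ) (S' ∪ E' ξ)) :=
        measureReal_mono hsub (measure_ne_top _ _)
    _ ≤ ∑ ξ ∈ Fintype.piFinset opt, (gnp V p).real (cyl (S ∪ E ξ) (S' ∪ E' ξ)) :=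
        measureReal_biUnion_finset_le _ _
    _ = ∑ ξ ∈ Fintype.piFinset opt, (gnp V p).real (cyl S S') *
          ∏ i, ((p : ℝ) * (1 - (p : ℝ)) ^ (w * (ξ i).1)) := sum_congr rfl hcyl
    _ = (gnp V p).real (cyl S S') * ∏ i, ∑ y ∈ opt i, ((p : ℝ) * (1 - (p : ℝ)) ^ (w * y.1)) := by
        rw [← mul_sum, prod_univ_sum]
    _ = _ := by
        congr 1
        refine prod_congr rfl fun i _ => ?_
        simp only [opt]
        rw [sum_product, rotWeight, Fintype.card_coe]
        refine sum_congr rfl fun k _ => ?_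
        simp only [sum_const, nsmul_eq_mul, hZw]
        ring

/-- Conditionally on a cylinder event, expanding maps are realised by edges between the sets `Z i`
and `D`. -/
theorem gnp_not_expands_le {σ : Type*} [Fintype σ] [DecidableEq σ] {D : Finset V} {s : ℕ}
    {Z : σ × Fin 20 → Finset V} {w : ℕ}
    (hZ : ∀ i j, i ≠ j → Disjoint (Z i) (Z j)) (hZw : ∀ i, #(Z i) = w)
    (hZD : ∀ i, Disjoint (Z i) D) {S S' : Finset (Sym2 V)} (hd : Disjoint S S')
    (hS : ∀ e ∈ S, ¬ e.IsDiag) (hS' : ∀ e ∈ S', ¬ e.IsDiag)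
    (hav : ∀ i, ∀ e ∈ pairEdges (Z i) D, e ∉ S ∪ S') (hD : 900 ≤ #D)
    (hσ : 2 * Fintype.card σ ≤ 3 * #D) (hs : 4 * s ≤ 3 * #D) (hwp : w * (p : ℝ) ≤ 1 / 10) :
    (gnp V p).real (cyl S S' ∩ {G | ¬ ∃ F : σ → Fin 20 → D, Expands F s ∧
      ∀ b j, Hits G (Z (b, j)) (F b j)}) ≤ (gnp V p).real (cyl S S') *
        (1 / (#D : ℝ) ^ 2 + 20 * Fintype.card σ * (1 - (p : ℝ)) ^ (w * #D)) := by
  have hp0 : (0 : ℝ) ≤ p := p.2.1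
  have hp1 : (p : ℝ) ≤ 1 := p.2.2
  have hne : Nonempty D := by
    have : 0 < #D := by omega
    obtain ⟨v, hv⟩ := card_pos.1 this
    exact ⟨⟨v, hv⟩⟩
  obtain ⟨rot, hrot, hrot'⟩ := exists_rotation D
  rw [Fintype.card_coe] at hrot'
  obtain ⟨θ, hθ⟩ := exists_rotation_start (σ := σ) (κ := 20) (s := s) hrot hp0 hp1 hwp
  have hbound : ∑ x ∈ obstacles σ D s, (11 / 10 * (#x.1 : ℝ) / Fintype.card D) ^ (20 * #x.1) ≤
      1 / (#D : ℝ) ^ 2 := by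
    have := sum_obstacleWeight_le (σ := σ) (τ := D) (s := s) (by rwa [Fintype.card_coe])
      (by rwa [Fintype.card_coe]) (by rwa [Fintype.card_coe])
    rw [Fintype.card_coe] at this ⊢
    exact this
  have hsub : cyl S S' ∩ {G : SimpleGraph V | ¬ ∃ F : σ → Fin 20 → D, Expands F s ∧
      ∀ b j, Hits G (Z (b, j)) (F b j)} ⊆
      -- Either some `Z i` has no neighbour in `D`, or all first hits exist and the maps formed by
      -- them run into an obstacle.
      (⋃ i ∈ (univ : Finset (σ × Fin 20)), cyl (S ∪ ∅) (S' ∪ pairEdges (Z i) D)) ∪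
      ⋃ x ∈ obstacles σ D s, (cyl S S' ∩ {G | ∀ i : ↥(x.1 ×ˢ (univ : Finset (Fin 20))),
        FirstHitIn G rot (Z i) (θ i) x.2}) := by
    rintro G ⟨hG, hno⟩
    rw [Set.mem_ofPred_eq] at hno
    by_cases hhit : ∀ i, ∃ d ∈ D, Hits G (Z i) d
    · right
      have hfirst : ∀ i, ∃ k < #D, Hits G (Z i) (rot (θ i) k) ∧
          ∀ l < k, ¬ Hits G (Z i) (rot (θ i) l) := by
        intro i
        obtain ⟨d, hd, hdh⟩ := hhit i
        have hsurj : (range #D).image (rot (θ i)) = univ := by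
          rw [← card_eq_iff_eq_univ, card_image_of_injOn, card_range, Fintype.card_coe]
          rw [coe_range]
          exact hrot' (θ i)
        have hex : ∃ k, k < #D ∧ Hits G (Z i) (rot (θ i) k) := by
          have h1 : (⟨d, hd⟩ : D) ∈ (range #D).image (rot (θ i)) := by rw [hsurj]; exact mem_univ _
          obtain ⟨k, hk, hkd⟩ := mem_image.1 h1
          refine ⟨k, mem_range.1 hk, ?_⟩
          rw [hkd]
          exact hdh
        classical
        refine ⟨Nat.find hex, (Nat.find_spec hex).1, (Nat.find_spec hex).2, fun l hl hh => ?_⟩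
        exact Nat.find_min hex hl ⟨hl.trans (Nat.find_spec hex).1, hh⟩
      choose k hk hkh hkl using hfirst
      have hnE : ¬ Expands (fun b j => rot (θ (b, j)) (k (b, j))) s :=
        fun hE => hno ⟨_, hE, fun b j => hkh (b, j)⟩
      obtain ⟨x, hx, hxA⟩ := exists_obstacle (by norm_num) (by rw [Fintype.card_coe]; omega) hnE
      simp only [Set.mem_iUnion]
      refine ⟨x, hx, hG, ?_⟩
      rintro ⟨⟨b, j⟩, hi⟩
      exact ⟨k (b, j), hk _, hxA b (mem_product.1 hi).1 j, hkh _, hkl _⟩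
    · left
      push Not at hhit
      obtain ⟨i, hi⟩ := hhit
      simp only [Set.mem_iUnion]
      refine ⟨i, mem_univ i, fun e he => hG.1 e (by simpa using he), fun e he => ?_⟩
      rcases mem_union.1 he with he | he
      · exact hG.2 e he
      · obtain ⟨a, ha, b, hb, rfl⟩ := mem_pairEdges.1 he
        exact fun hab => hi b hb ⟨a, ha, hab⟩
  have hμ0 : 0 ≤ (gnp V p).real (cyl S S') := measureReal_nonneg
  refine (measureReal_mono hsub (measure_ne_top _ _)).trans ((measureReal_union_le _ _).trans ?_)
  rw [mul_add, add_comm]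
  refine add_le_add ?_ ?_
  · calc _ ≤ ∑ x ∈ obstacles σ D s, (gnp V p).real (cyl S S' ∩
          {G | ∀ i : ↥(x.1 ×ˢ (univ : Finset (Fin 20))), FirstHitIn G rot (Z i) (θ i) x.2}) :=
          measureReal_biUnion_finset_le _ _
      _ ≤ ∑ x ∈ obstacles σ D s, (gnp V p).real (cyl S S') *
            ∏ i ∈ x.1 ×ˢ (univ : Finset (Fin 20)), rotWeight rot w p x.2 (θ i) := by
          refine sum_le_sum fun x _ => ?_
          rw [← prod_coe_sort]
          exact gnp_firstHitIn_le (ι := ↥(x.1 ×ˢ (univ : Finset (Fin 20)))) hrot'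
            (Z := fun i => Z i) (fun i j hij => hZ i j fun h => hij (Subtype.ext h))
            (fun i => hZw i) (fun i => hZD i) hd hS hS' (fun i => hav i) (fun i => θ i) x.2
      _ ≤ _ := by
          rw [← mul_sum]
          exact mul_le_mul_of_nonneg_left (hθ.trans hbound) hμ0
  · calc _ ≤ ∑ i ∈ (univ : Finset (σ × Fin 20)),
          (gnp V p).real (cyl (S ∪ ∅) (S' ∪ pairEdges (Z i) D)) :=
          measureReal_biUnion_finset_le _ _
      _ = ∑ i ∈ (univ : Finset (σ × Fin 20)),
          (gnp V p).real (cyl S S') * (1 - (p : ℝ)) ^ (w * #D) := by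
          refine sum_congr rfl fun i _ => ?_
          rw [gnp_cyl_union hd hS hS' (disjoint_empty_left _) (by simp)
            (fun e he => not_isDiag_of_mem_pairEdges (hZD i) he)
            (fun e he => hav i e (by simpa using he)), card_pairEdges (hZD i), hZw]
          simp
      _ = _ := by
          rw [sum_const, card_univ, Fintype.card_prod, Fintype.card_fin, nsmul_eq_mul]
          push_cast
          ring

end

/-! ### Subdivided templates and trees of depth two -/

section

open Finset MeasureTheory

section Assembly

variable {V ι : Type*} [DecidableEq V] [Fintype ι] [DecidableEq ι] {G : SimpleGraph V}

/-- Paths `c i, q i, p i, r i` of length three that replace the edges of a template graph between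
`C` and `Y ∪ R` give a device of matching type. -/
theorem isMatchingDevice_of_subdivision {lam : ℕ} {R Y C : Finset V} {p q r : ι → V} {c : ι → C}
    (hRY : Disjoint R Y) (hRC : Disjoint R C) (hYC : Disjoint Y C) (hY : #Y = 6 * lam)
    (hC : #C = 9 * lam) (hι : Fintype.card ι ≤ 991 * lam)
    (hp : p.Injective) (hq : q.Injective) (hpq : ∀ i j, p i ≠ q j)
    (hpd : ∀ i, p i ∉ R ∧ p i ∉ Y ∧ p i ∉ C) (hqd : ∀ i, q i ∉ R ∧ q i ∉ Y ∧ q i ∉ C)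
    (hcq : ∀ i, G.Adj (c i) (q i)) (hqp : ∀ i, G.Adj (q i) (p i)) (hpr : ∀ i, G.Adj (p i) (r i))
    (htemp : ∀ U ⊆ R, #U = 3 * lam → ∃ sel : C → ι, (∀ x, c (sel x) = x) ∧
      (r ∘ sel).Injective ∧ ∀ x, r (sel x) ∈ Y ∪ U) :
    IsMatchingDevice G lam R (C ∪ univ.image p) (Y ∪ univ.image q) := by
  have hCp : Disjoint C (univ.image p) := by
    rw [disjoint_right]; simp only [mem_image, mem_univ, true_and]
    rintro _ ⟨i, rfl⟩; exact (hpd i).2.2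
  have hYq : Disjoint Y (univ.image q) := by
    rw [disjoint_right]; simp only [mem_image, mem_univ, true_and]
    rintro _ ⟨i, rfl⟩; exact (hqd i).2.1
  have hc0 : #(C ∪ univ.image p) = 9 * lam + Fintype.card ι := by
    rw [card_union_of_disjoint hCp, hC, card_image_of_injective _ hp, card_univ]
  have hc1 : #(Y ∪ univ.image q) = 6 * lam + Fintype.card ι := by
    rw [card_union_of_disjoint hYq, hY, card_image_of_injective _ hq, card_univ]
  have hd1 : Disjoint (Y ∪ univ.image q) R := by
    rw [disjoint_left]; simp only [mem_union, mem_image, mem_univ, true_and]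
    rintro _ (h | ⟨i, rfl⟩)
    · exact disjoint_right.1 hRY h
    · exact (hqd i).1
  have hd0 : Disjoint (C ∪ univ.image p) R := by
    rw [disjoint_left]; simp only [mem_union, mem_image, mem_univ, true_and]
    rintro _ (h | ⟨i, rfl⟩)
    · exact disjoint_right.1 hRC h
    · exact (hpd i).1
  refine ⟨hd0, hd1, by omega, by omega, by omega, fun U hU hUc => ?_⟩
  obtain ⟨sel, hsel, hinj, hmem⟩ := htemp U hU hUc
  classical
  have hd2 : Disjoint (C ∪ univ.image p) (Y ∪ univ.image q ∪ U) := by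
    rw [disjoint_union_right]
    refine ⟨?_, hd0.mono_right hU⟩
    rw [disjoint_left]; simp only [mem_union, mem_image, mem_univ, true_and]
    rintro _ (h | ⟨i, rfl⟩) (h' | ⟨j, h'⟩)
    · exact disjoint_left.1 hYC h' h
    · exact (hqd j).2.2 (h' ▸ h)
    · exact (hpd i).2.1 h'
    · exact hpq i j h'.symm
  -- A vertex of `C` is matched along its selected template edge, `p i` goes to `r i` on selected
  -- edges and to `q i` on the others; `f` outside the domain is irrelevant.
  let f : V → V := fun v =>
    if h : v ∈ C then q (sel ⟨v, h⟩)
    else if h : ∃ i, p i = v then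
      if sel (c h.choose) = h.choose then r h.choose else q h.choose
    else v
  have f1 : ∀ x : C, f x = q (sel x) := fun x => dif_pos x.2
  have f2 : ∀ i, f (p i) = if sel (c i) = i then r i else q i := fun i => by
    have h : ∃ j, p j = p i := ⟨i, rfl⟩
    have : h.choose = i := hp h.choose_spec
    simp only [f]
    rw [dif_neg (hpd i).2.2, dif_pos h, this]
  have hrq : ∀ i j, sel (c i) = i → r i ≠ q j := fun i j hi h => by
    have := hmem (c i)
    rw [hi, h, mem_union] at this
    rcases this with h | h
    · exact (hqd j).2.1 h
    · exact (hqd j).1 (hU h)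
  have hmaps : Set.MapsTo f (C ∪ univ.image p : Finset V) (Y ∪ univ.image q ∪ U : Finset V) := by
    intro v hv
    simp only [coe_union, coe_image, coe_univ, Set.image_univ, Set.mem_union, mem_coe,
      Set.mem_range] at hv ⊢
    rcases hv with h | ⟨i, rfl⟩
    · exact Or.inl (Or.inr ⟨_, (f1 ⟨v, h⟩).symm⟩)
    · rw [f2]
      split_ifs with h
      · have := hmem (c i)
        rw [h, mem_union] at this
        rcases this with h | h
        · exact Or.inl (Or.inl h)
        · exact Or.inr h
      · exact Or.inl (Or.inr ⟨_, rfl⟩)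
  have hfinj : Set.InjOn f (C ∪ univ.image p : Finset V) := by
    have key : ∀ (x : C) i, f x ≠ f (p i) := by
      intro x i h
      rw [f1, f2] at h
      split_ifs at h with h'
      · exact hrq i _ h' h.symm
      · have := hq h
        exact h' (by rw [← this, hsel])
    intro v hv w hw hvw
    simp only [coe_union, coe_image, coe_univ, Set.image_univ, Set.mem_union, mem_coe,
      Set.mem_range] at hv hw
    rcases hv with hv | ⟨i, rfl⟩ <;> rcases hw with hw | ⟨j, rfl⟩
    · rw [f1 ⟨v, hv⟩, f1 ⟨w, hw⟩] at hvw
      have := congrArg c (hq hvw)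
      rw [hsel, hsel] at this
      exact congrArg Subtype.val this
    · exact absurd hvw (key ⟨v, hv⟩ j)
    · exact absurd hvw.symm (key ⟨w, hw⟩ i)
    · rw [f2, f2] at hvw
      split_ifs at hvw with h h' h'
      · have : c i = c j := hinj (by simpa [h, h'] using hvw)
        rw [← h, ← h', this]
      · exact absurd hvw (hrq i j h)
      · exact absurd hvw.symm (hrq j i h')
      · rw [hq hvw]
  refine ⟨hd2, f, ⟨hmaps, hfinj, ?_⟩, ?_⟩
  · refine surjOn_of_injOn_of_card_le f hmaps hfinj ?_
    rw [card_union_of_disjoint (hd1.mono_right hU), hc0, hc1, hUc]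
    omega
  · intro v hv
    simp only [mem_union, mem_image, mem_univ, true_and] at hv
    rcases hv with h | ⟨i, rfl⟩
    · rw [f1 ⟨v, h⟩]
      have := hcq (sel ⟨v, h⟩)
      rwa [hsel] at this
    · rw [f2]
      split_ifs with h
      · exact hpr i
      · exact (hqp i).symm

end Assembly

section Stars

variable {V : Type*} [DecidableEq V] {G : SimpleGraph V} {A T S : Finset V} {κ M c : ℕ}

/-- A set too large for the hypothesis contains one of size `(M + κ) / κ`, which already has more
than `M` neighbours. The extra `κ` compensates for rounding. -/
theorem ExpandsInto.of_le (h : ExpandsInto G A T κ (M + κ)) (hκ : 0 < κ) (hc : c ≤ κ) :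
    ExpandsInto G A T c M := by
  intro U hU hUM
  rcases le_or_gt (κ * #U) (M + κ) with h1 | h1
  · exact (Nat.mul_le_mul_right _ hc).trans (h U hU h1)
  · have h2 : (M + κ) / κ ≤ #U := by
      rw [← Nat.lt_succ_iff, Nat.div_lt_iff_lt_mul hκ]
      nlinarith
    obtain ⟨U', hU', hcard⟩ := exists_subset_card_eq h2
    have h3 := h U' (hU'.trans hU) (by rw [hcard]; exact Nat.mul_div_le _ _)
    have h4 : M < κ * #U' := by
      rw [hcard]
      have := Nat.lt_mul_div_succ (M + κ) hκ
      rw [Nat.mul_add] at this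
      omega
    exact hUM.trans (h4.le.trans (h3.trans (card_le_card (nbrIn_mono_right hU'))))

/-- Expanding sets carry vertex-disjoint stars. -/
theorem ExpandsInto.exists_stars (h : ExpandsInto G A T c M) (hS : S ⊆ A) (hM : c * #S ≤ M) :
    ∃ φ : S × Fin c → V, φ.Injective ∧ ∀ x, φ x ∈ T ∧ G.Adj x.1 (φ x) := by
  have key := (all_card_le_biUnion_card_iff_exists_injective
    (fun x : S × Fin c => nbrIn G T {x.1.1})).1 ?_
  · obtain ⟨φ, h1, h2⟩ := key
    refine ⟨φ, h1, fun x => ?_⟩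
    have := mem_nbrIn.1 (h2 x)
    simpa using this
  · intro P
    let U : Finset V := P.image fun x => x.1.1
    have hUS : U ⊆ S := by
      intro v hv
      obtain ⟨x, -, rfl⟩ := mem_image.1 hv
      exact x.1.2
    have h1 : #P ≤ c * #U := by
      have hmul := card_le_mul_card_image (s := P) (f := fun x => x.1.1) c ?_
      · exact hmul
      · intro a _
        calc #{x ∈ P | x.1.1 = a} ≤ #(univ : Finset (Fin c)) := by
              refine card_le_card_of_injOn (fun x => x.2) (by simp) ?_
              intro x hx y hy hxy
              simp only [coe_filter, Set.mem_ofPred_eq] at hx hy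
              exact Prod.ext (Subtype.ext (hx.2.trans hy.2.symm)) hxy
          _ = c := by simp
    have h2 : c * #U ≤ M := (Nat.mul_le_mul_left _ (card_le_card hUS)).trans hM
    refine h1.trans ((h U (hUS.trans hS) h2).trans (card_le_card ?_))
    intro y hy
    obtain ⟨hyT, u, hu, huy⟩ := mem_nbrIn.1 hy
    obtain ⟨x, hx, rfl⟩ := mem_image.1 hu
    exact mem_biUnion.2 ⟨x, hx, mem_nbrIn.2 ⟨hyT, _, mem_singleton_self _, huy⟩⟩

/-- Twenty trees of depth two at each vertex of `Q`: the vertex `v` has children `a v j s` in `T₁`,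
which have children `z v j s t` in `T₂`, and all these are distinct. -/
structure Sprouts (G : SimpleGraph V) (Q T₁ T₂ : Finset V) {k m : ℕ} (a : V → Fin 20 → Fin k → V)
    (z : V → Fin 20 → Fin k → Fin m → V) : Prop where
  a_mem : ∀ v ∈ Q, ∀ j s, a v j s ∈ T₁
  z_mem : ∀ v ∈ Q, ∀ j s t, z v j s t ∈ T₂
  a_adj : ∀ v ∈ Q, ∀ j s, G.Adj v (a v j s)
  z_adj : ∀ v ∈ Q, ∀ j s t, G.Adj (a v j s) (z v j s t)
  a_inj : ∀ v ∈ Q, ∀ w ∈ Q, ∀ j j' s s', a v j s = a w j' s' → v = w ∧ j = j' ∧ s = s'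
  z_inj : ∀ v ∈ Q, ∀ w ∈ Q, ∀ j j' s s' t t', z v j s t = z w j' s' t' →
    v = w ∧ j = j' ∧ s = s' ∧ t = t'

/-- Two rounds of disjoint stars: `20k` children for each vertex of `Q`, then `m` children for each
of those. -/
theorem exists_sprouts [Nonempty V] {Q T₁ T₂ : Finset V} {k m : ℕ} (hQ : Q ⊆ A) (hT : T₁ ⊆ A)
    (h₁ : ExpandsInto G A T₁ κ (M + κ)) (h₂ : ExpandsInto G A T₂ κ (M + κ)) (hκ : 0 < κ)
    (hk : k * 20 ≤ κ) (hm : m ≤ κ) (hk' : k * 20 * #Q ≤ M) (hm' : m * (k * 20 * #Q) ≤ M) :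
    ∃ (a : V → Fin 20 → Fin k → V) (z : V → Fin 20 → Fin k → Fin m → V),
      Sprouts G Q T₁ T₂ a z := by
  classical
  obtain ⟨φ, hφ, hφ'⟩ := (h₁.of_le hκ (by omega : 20 * k ≤ κ)).exists_stars hQ (by
    rwa [mul_comm 20 k])
  let e : Fin 20 × Fin k ≃ Fin (20 * k) := finProdFinEquiv
  let a : V → Fin 20 → Fin k → V := fun v j s =>
    if hv : v ∈ Q then φ (⟨v, hv⟩, e (j, s)) else Classical.arbitrary V
  have ha : ∀ v (hv : v ∈ Q) j s, a v j s = φ (⟨v, hv⟩, e (j, s)) := fun v hv j s => dif_pos hv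
  let S : Finset V := univ.image φ
  have hS : #S = k * 20 * #Q := by
    rw [card_image_of_injective _ hφ, card_univ, Fintype.card_prod, Fintype.card_coe,
      Fintype.card_fin]
    ring
  have hSA : S ⊆ A := by
    intro v hv
    obtain ⟨x, -, rfl⟩ := mem_image.1 hv
    exact hT (hφ' x).1
  obtain ⟨ψ, hψ, hψ'⟩ := (h₂.of_le hκ hm).exists_stars hSA (by rwa [hS])
  have haS : ∀ v (hv : v ∈ Q) j s, a v j s ∈ S := fun v hv j s =>
    mem_image.2 ⟨_, mem_univ _, (ha v hv j s).symm⟩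
  let z : V → Fin 20 → Fin k → Fin m → V := fun v j s t =>
    if hv : a v j s ∈ S then ψ (⟨a v j s, hv⟩, t) else Classical.arbitrary V
  have hz : ∀ v (hv : v ∈ Q) j s t, z v j s t = ψ (⟨a v j s, haS v hv j s⟩, t) :=
    fun v hv j s t => dif_pos (haS v hv j s)
  have hainj : ∀ v ∈ Q, ∀ w ∈ Q, ∀ j j' s s', a v j s = a w j' s' → v = w ∧ j = j' ∧ s = s' := by
    intro v hv w hw j j' s s' h
    rw [ha v hv, ha w hw] at h
    have h1 := hφ h
    simp only [Prod.mk.injEq, Subtype.mk.injEq, EmbeddingLike.apply_eq_iff_eq] at h1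
    tauto
  refine ⟨a, z, ⟨?_, ?_, ?_, ?_, hainj, ?_⟩⟩
  · intro v hv j s; rw [ha v hv]; exact (hφ' _).1
  · intro v hv j s t; rw [hz v hv]; exact (hψ' _).1
  · intro v hv j s; rw [ha v hv]; exact (hφ' (⟨v, hv⟩, e (j, s))).2
  · intro v hv j s t; rw [hz v hv]; exact (hψ' (⟨a v j s, haS v hv j s⟩, t)).2
  · intro v hv w hw j j' s s' t t' h
    rw [hz v hv, hz w hw] at h
    have h1 := hψ h
    simp only [Prod.mk.injEq, Subtype.mk.injEq] at h1
    obtain ⟨h2, h3, h4⟩ := hainj v hv w hw _ _ _ _ h1.1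
    exact ⟨h2, h3, h4, h1.2⟩

end Stars

end

/-! ### Matching devices from trees and unexposed edges -/

section

open Finset MeasureTheory

section Sprouting

variable {V : Type*} [DecidableEq V] {G : SimpleGraph V} {R Y C T₁ T₂ : Finset V} {k m : ℕ}
  {a : V → Fin 20 → Fin k → V} {z : V → Fin 20 → Fin k → Fin m → V}

/-- The leaves of the tree `j` at `v`. -/
def leaves (z : V → Fin 20 → Fin k → Fin m → V) (v : V) (j : Fin 20) : Finset V :=
  univ.image fun x : Fin k × Fin m => z v j x.1 x.2

theorem Hits.exists_leaf {v c : V} {j : Fin 20} (h : Hits G (leaves z v j) c) :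
    ∃ s t, G.Adj (z v j s t) c := by
  obtain ⟨y, hy, hyc⟩ := h
  obtain ⟨x, -, rfl⟩ := mem_image.1 hy
  exact ⟨x.1, x.2, hyc⟩

theorem Sprouts.card_leaves {Q : Finset V} (h : Sprouts G Q T₁ T₂ a z) {v : V} (hv : v ∈ Q)
    (j : Fin 20) : #(leaves z v j) = k * m := by
  rw [leaves, card_image_of_injective, card_univ, Fintype.card_prod, Fintype.card_fin,
    Fintype.card_fin]
  intro x y hxy
  obtain ⟨-, -, h1, h2⟩ := h.z_inj v hv v hv _ _ _ _ _ _ hxy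
  exact Prod.ext h1 h2

theorem Sprouts.leaves_subset {Q : Finset V} (h : Sprouts G Q T₁ T₂ a z) {v : V} (hv : v ∈ Q)
    (j : Fin 20) : leaves z v j ⊆ T₂ := by
  intro y hy
  obtain ⟨x, -, rfl⟩ := mem_image.1 hy
  exact h.z_mem v hv _ _ _

theorem Sprouts.disjoint_leaves {Q : Finset V} (h : Sprouts G Q T₁ T₂ a z) {v w : V} (hv : v ∈ Q)
    (hw : w ∈ Q) {j j' : Fin 20} (hne : ¬ (v = w ∧ j = j')) :
    Disjoint (leaves z v j) (leaves z w j') := by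
  rw [disjoint_left]
  intro y hy hy'
  obtain ⟨x, -, rfl⟩ := mem_image.1 hy
  obtain ⟨x', -, hx⟩ := mem_image.1 hy'
  obtain ⟨h1, h2, -⟩ := h.z_inj w hw v hv _ _ _ _ _ _ hx
  exact hne ⟨h1.symm, h2.symm⟩

/-- A hit of a leaf set extends a branch of its tree to a path of length three, so every template
edge given by `F` or `H` is already subdivided, and the branches used are disjoint. -/
theorem Sprouts.exists_matchingDevice {lam : ℕ} (h : Sprouts G (Y ∪ R ∪ C) T₁ T₂ a z)
    (hRY : Disjoint R Y) (hRC : Disjoint R C) (hYC : Disjoint Y C)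
    (hT₁ : Disjoint (Y ∪ R ∪ C) T₁) (hT₂ : Disjoint (Y ∪ R ∪ C) T₂) (hT : Disjoint T₁ T₂)
    (hR : #R = 6 * lam) (hY : #Y = 6 * lam) (hC : #C = 9 * lam) (hlam : 1 ≤ lam)
    {F : ↥(Y ∪ R) → Fin 20 → C} {H : C → Fin 20 → Y}
    (hF : Expands F (5 * lam)) (hH : Expands H (9 * lam / 2))
    (hFh : ∀ (b : ↥(Y ∪ R)) j, Hits G (leaves z b j) (F b j))
    (hHh : ∀ (b : C) j, Hits G (leaves z b j) (H b j)) :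
    ∃ W₀ W₁, IsMatchingDevice G lam R W₀ W₁ := by
  choose sF tF hFa using fun b j => (hFh b j).exists_leaf
  choose sH tH hHa using fun b j => (hHh b j).exists_leaf
  have m1 : ∀ b : ↥(Y ∪ R), (b : V) ∈ Y ∪ R ∪ C := fun b => mem_union_left _ b.2
  have m2 : ∀ b : C, (b : V) ∈ Y ∪ R ∪ C := fun b => mem_union_right _ b.2
  have hne : ∀ (b : ↥(Y ∪ R)) (b' : C), (b : V) ≠ b' := by
    intro b b' hbb
    have := b.2
    rw [hbb, mem_union] at this
    rcases this with h | h
    · exact disjoint_left.1 hYC h b'.2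
    · exact disjoint_left.1 hRC h b'.2
  have hTne : ∀ x ∈ T₁, ∀ y ∈ T₂, x ≠ y := fun x hx y hy hxy => disjoint_left.1 hT hx (hxy ▸ hy)
  have hT₁' : ∀ x ∈ T₁, x ∉ R ∧ x ∉ Y ∧ x ∉ C := fun x hx => by
    have := disjoint_right.1 hT₁ hx
    simp only [mem_union] at this; tauto
  have hT₂' : ∀ x ∈ T₂, x ∉ R ∧ x ∉ Y ∧ x ∉ C := fun x hx => by
    have := disjoint_right.1 hT₂ hx
    simp only [mem_union] at this; tauto
  -- Trees rooted in `Y ∪ R` and in `C` are traversed in opposite directions, so the inner vertices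
  -- `a` and `z` exchange the roles of `p` and `q`.
  let p : (↥(Y ∪ R) × Fin 20) ⊕ (C × Fin 20) → V :=
    Sum.elim (fun x => a x.1 x.2 (sF x.1 x.2)) fun x => z x.1 x.2 (sH x.1 x.2) (tH x.1 x.2)
  let q : (↥(Y ∪ R) × Fin 20) ⊕ (C × Fin 20) → V :=
    Sum.elim (fun x => z x.1 x.2 (sF x.1 x.2) (tF x.1 x.2)) fun x => a x.1 x.2 (sH x.1 x.2)
  let r : (↥(Y ∪ R) × Fin 20) ⊕ (C × Fin 20) → V :=
    Sum.elim (fun x => x.1) fun x => H x.1 x.2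
  let c : (↥(Y ∪ R) × Fin 20) ⊕ (C × Fin 20) → C := Sum.elim (fun x => F x.1 x.2) fun x => x.1
  have hYR : #(Y ∪ R) = 12 * lam := by
    rw [card_union_of_disjoint hRY.symm, hR, hY]; ring
  refine ⟨_, _, isMatchingDevice_of_subdivision (p := p) (q := q) (r := r) (c := c) hRY hRC hYC
    hY hC ?_ ?_ ?_ ?_ ?_ ?_ ?_ ?_ ?_ ?_⟩
  · simp only [Fintype.card_sum, Fintype.card_prod, Fintype.card_coe, hYR, hC, Fintype.card_fin]
    omega
  · rintro (⟨b, j⟩ | ⟨b, j⟩) (⟨b', j'⟩ | ⟨b', j'⟩) hbb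
    · obtain ⟨h1, h2, -⟩ := h.a_inj _ (m1 b) _ (m1 b') _ _ _ _ hbb
      exact congrArg _ (Prod.ext (Subtype.ext h1) h2)
    · exact absurd hbb (hTne _ (h.a_mem _ (m1 b) _ _) _ (h.z_mem _ (m2 b') _ _ _))
    · exact absurd hbb.symm (hTne _ (h.a_mem _ (m1 b') _ _) _ (h.z_mem _ (m2 b) _ _ _))
    · obtain ⟨h1, h2, -⟩ := h.z_inj _ (m2 b) _ (m2 b') _ _ _ _ _ _ hbb
      exact congrArg _ (Prod.ext (Subtype.ext h1) h2)
  · rintro (⟨b, j⟩ | ⟨b, j⟩) (⟨b', j'⟩ | ⟨b', j'⟩) hbb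
    · obtain ⟨h1, h2, -⟩ := h.z_inj _ (m1 b) _ (m1 b') _ _ _ _ _ _ hbb
      exact congrArg _ (Prod.ext (Subtype.ext h1) h2)
    · exact absurd hbb.symm (hTne _ (h.a_mem _ (m2 b') _ _) _ (h.z_mem _ (m1 b) _ _ _))
    · exact absurd hbb (hTne _ (h.a_mem _ (m2 b) _ _) _ (h.z_mem _ (m1 b') _ _ _))
    · obtain ⟨h1, h2, -⟩ := h.a_inj _ (m2 b) _ (m2 b') _ _ _ _ hbb
      exact congrArg _ (Prod.ext (Subtype.ext h1) h2)
  · rintro (⟨b, j⟩ | ⟨b, j⟩) (⟨b', j'⟩ | ⟨b', j'⟩) hbb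
    · exact absurd hbb (hTne _ (h.a_mem _ (m1 b) _ _) _ (h.z_mem _ (m1 b') _ _ _))
    · exact hne _ _ (h.a_inj _ (m1 b) _ (m2 b') _ _ _ _ hbb).1
    · exact hne _ _ (h.z_inj _ (m1 b') _ (m2 b) _ _ _ _ _ _ hbb.symm).1
    · exact absurd hbb.symm (hTne _ (h.a_mem _ (m2 b') _ _) _ (h.z_mem _ (m2 b) _ _ _))
  · rintro (⟨b, j⟩ | ⟨b, j⟩)
    · exact hT₁' _ (h.a_mem _ (m1 b) _ _)
    · exact hT₂' _ (h.z_mem _ (m2 b) _ _ _)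
  · rintro (⟨b, j⟩ | ⟨b, j⟩)
    · exact hT₂' _ (h.z_mem _ (m1 b) _ _ _)
    · exact hT₁' _ (h.a_mem _ (m2 b) _ _)
  · rintro (⟨b, j⟩ | ⟨b, j⟩)
    · exact (hFa b j).symm
    · exact h.a_adj _ (m2 b) _ _
  · rintro (⟨b, j⟩ | ⟨b, j⟩)
    · exact (h.z_adj _ (m1 b) _ _ _).symm
    · exact h.z_adj _ (m2 b) _ _ _
  · rintro (⟨b, j⟩ | ⟨b, j⟩)
    · exact (h.a_adj _ (m1 b) _ _).symm
    · exact hHa b j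
  · intro U hU hUc
    obtain ⟨φ, hφ, hφ'⟩ := exists_matching_of_expands (hRY.symm.mono_right hU)
      (subset_union_left (s₂ := R)) (hU.trans subset_union_right)
      (by rw [Fintype.card_coe, hC, hY, hUc]; ring) (by rw [Fintype.card_coe, hC]; omega)
      (by rw [Fintype.card_coe, hC]; omega) hF hH
    have hsel : ∀ x : C, ∃ i, c i = x ∧ r i = φ x := by
      intro x
      rcases (hφ' x).2 with ⟨hz, j, hj⟩ | ⟨j, hj⟩
      · exact ⟨Sum.inl (⟨φ x, hz⟩, j), hj, rfl⟩
      · exact ⟨Sum.inr (x, j), rfl, hj⟩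
    choose sel hs1 hs2 using hsel
    refine ⟨sel, hs1, ?_, fun x => by rw [hs2]; exact (hφ' x).1⟩
    have : r ∘ sel = φ := funext hs2
    rw [this]; exact hφ

end Sprouting

section Conditioning

variable {V : Type*} [Fintype V] [DecidableEq V] {p : unitInterval}

/-- A conditional bound that holds for all configurations of the edges in `E` holds
unconditionally. -/
theorem gnp_le_of_forall_cyl {E : Finset (Sym2 V)} (hE : ∀ e ∈ E, ¬ e.IsDiag) {δ : ℝ}
    {B : Set (SimpleGraph V)} (h : ∀ H ⊆ E, (gnp V p).real (cyl H (E \ H) ∩ B) ≤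
      (gnp V p).real (cyl H (E \ H)) * δ) : (gnp V p).real B ≤ δ := by
  classical
  have hsub : B ⊆ ⋃ H ∈ E.powerset, cyl H (E \ H) ∩ B := by
    intro G hG
    simp only [Set.mem_iUnion]
    refine ⟨{e ∈ E | e ∈ G.edgeSet}, mem_powerset.2 (filter_subset _ _), ⟨?_, ?_⟩, hG⟩
    · exact fun e he => (mem_filter.1 he).2
    · intro e he he'
      rw [mem_sdiff, mem_filter] at he
      exact he.2 ⟨he.1, he'⟩
  calc _ ≤ (gnp V p).real (⋃ H ∈ E.powerset, cyl H (E \ H) ∩ B) :=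
        measureReal_mono hsub (measure_ne_top _ _)
    _ ≤ ∑ H ∈ E.powerset, (gnp V p).real (cyl H (E \ H) ∩ B) := measureReal_biUnion_finset_le _ _
    _ ≤ ∑ H ∈ E.powerset, (p : ℝ) ^ #H * (1 - (p : ℝ)) ^ (#E - #H) * δ := by
        refine sum_le_sum fun H hH => ?_
        rw [mem_powerset] at hH
        refine (h H hH).trans_eq ?_
        rw [gnp_cyl _ disjoint_sdiff (fun e he => hE e (hH he))
          (fun e he => hE e (sdiff_subset he)), card_sdiff_of_subset hH]
    _ = δ := by
        rw [← sum_mul, sum_pow_mul_eq_add_pow, add_sub_cancel, one_pow, one_mul]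

/-- The existence of the trees depends only on pairs inside `E`. Once these are exposed and the
trees are fixed, the pairs between leaves and `Y ∪ R ∪ C` are still independent, and
`gnp_not_expands_le` is applied to the maps into `C` and to those into `Y`. -/
theorem gnp_sprouts_not_matchingDevice_le {lam k m : ℕ} {R Y C T₁ T₂ : Finset V}
    (hRY : Disjoint R Y) (hRC : Disjoint R C) (hYC : Disjoint Y C)
    (hT₁ : Disjoint (Y ∪ R ∪ C) T₁) (hT₂ : Disjoint (Y ∪ R ∪ C) T₂) (hT : Disjoint T₁ T₂)
    (hR : #R = 6 * lam) (hY : #Y = 6 * lam) (hC : #C = 9 * lam) (hlam : 150 ≤ lam)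
    (hwp : (k * m : ℕ) * (p : ℝ) ≤ 1 / 10) :
    (gnp V p).real {G | (∃ (a : V → Fin 20 → Fin k → V) (z : V → Fin 20 → Fin k → Fin m → V),
      Sprouts G (Y ∪ R ∪ C) T₁ T₂ a z) ∧ ¬ ∃ W₀ W₁, IsMatchingDevice G lam R W₀ W₁} ≤
      2 / (lam : ℝ) ^ 2 + 420 * lam * (1 - (p : ℝ)) ^ (k * m * (6 * lam)) := by
  have hYR : #(Y ∪ R) = 12 * lam := by
    rw [card_union_of_disjoint hRY.symm, hR, hY]; ring
  set E := pairEdges (Y ∪ R ∪ C) T₁ ∪ pairEdges T₁ T₂ with hEdef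
  have hE : ∀ e ∈ E, ¬ e.IsDiag := by
    intro e he
    rcases mem_union.1 he with h | h
    exacts [not_isDiag_of_mem_pairEdges hT₁ h, not_isDiag_of_mem_pairEdges hT h]
  refine gnp_le_of_forall_cyl hE fun H hH => ?_
  have hEH : H ∪ E \ H = E := union_sdiff_of_subset hH
  by_cases hs : ∃ (a : V → Fin 20 → Fin k → V) (z : V → Fin 20 → Fin k → Fin m → V),
      Sprouts (SimpleGraph.fromEdgeSet (H : Set (Sym2 V))) (Y ∪ R ∪ C) T₁ T₂ a z
  swap
  · have : cyl H (E \ H) ∩ {G | (∃ (a : V → Fin 20 → Fin k → V)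
        (z : V → Fin 20 → Fin k → Fin m → V), Sprouts G (Y ∪ R ∪ C) T₁ T₂ a z) ∧
        ¬ ∃ W₀ W₁, IsMatchingDevice G lam R W₀ W₁} = ∅ := by
      rw [Set.eq_empty_iff_forall_notMem]
      rintro G ⟨hG, ⟨a, z, h⟩, -⟩
      have key : ∀ x y, s(x, y) ∈ E → G.Adj x y →
          (SimpleGraph.fromEdgeSet (H : Set (Sym2 V))).Adj x y := by
        intro x y hxy hadj
        rw [SimpleGraph.fromEdgeSet_adj]
        refine ⟨?_, hadj.ne⟩
        by_contra hn
        exact hG.2 _ (mem_sdiff.2 ⟨hxy, hn⟩) hadj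
      refine hs ⟨a, z, h.a_mem, h.z_mem, fun v hv j s => key _ _ ?_ (h.a_adj v hv j s),
        fun v hv j s t => key _ _ ?_ (h.z_adj v hv j s t), h.a_inj, h.z_inj⟩
      · exact mem_union_left _ (mem_pairEdges.2 ⟨_, hv, _, h.a_mem v hv j s, rfl⟩)
      · exact mem_union_right _
          (mem_pairEdges.2 ⟨_, h.a_mem v hv j s, _, h.z_mem v hv j s t, rfl⟩)
    rw [this, measureReal_empty]
    have : 0 ≤ (1 - (p : ℝ)) ^ (k * m * (6 * lam)) := pow_nonneg one_sub_nonneg _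
    positivity
  · obtain ⟨a, z, h⟩ := hs
    have hsub : cyl H (E \ H) ∩ {G | (∃ (a : V → Fin 20 → Fin k → V)
        (z : V → Fin 20 → Fin k → Fin m → V), Sprouts G (Y ∪ R ∪ C) T₁ T₂ a z) ∧
        ¬ ∃ W₀ W₁, IsMatchingDevice G lam R W₀ W₁} ⊆
        (cyl H (E \ H) ∩ {G | ¬ ∃ F : ↥(Y ∪ R) → Fin 20 → C, Expands F (5 * lam) ∧
          ∀ (b : ↥(Y ∪ R)) j, Hits G (leaves z b j) (F b j)}) ∪
        (cyl H (E \ H) ∩ {G | ¬ ∃ F : C → Fin 20 → Y, Expands F (9 * lam / 2) ∧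
          ∀ (b : C) j, Hits G (leaves z b j) (F b j)}) := by
      rintro G ⟨hG, -, hno⟩
      by_cases h1 : ∃ F : ↥(Y ∪ R) → Fin 20 → C, Expands F (5 * lam) ∧
          ∀ (b : ↥(Y ∪ R)) j, Hits G (leaves z b j) (F b j)
      · refine Or.inr ⟨hG, fun h2 => hno ?_⟩
        obtain ⟨F, hF, hF'⟩ := h1
        obtain ⟨F', hH, hH'⟩ := h2
        have key : ∀ x y, (SimpleGraph.fromEdgeSet (H : Set (Sym2 V))).Adj x y → G.Adj x y :=
          fun x y hxy => hG.1 _ ((SimpleGraph.fromEdgeSet_adj _).1 hxy).1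
        have hsp : Sprouts G (Y ∪ R ∪ C) T₁ T₂ a z :=
          ⟨h.a_mem, h.z_mem, fun v hv j s => key _ _ (h.a_adj v hv j s),
            fun v hv j s t => key _ _ (h.z_adj v hv j s t), h.a_inj, h.z_inj⟩
        exact hsp.exists_matchingDevice hRY hRC hYC hT₁ hT₂ hT hR hY hC (by omega) hF hH hF' hH'
      · exact Or.inl ⟨hG, h1⟩
    have hav : ∀ v ∈ Y ∪ R ∪ C, ∀ j, ∀ D ⊆ Y ∪ R ∪ C, ∀ e ∈ pairEdges (leaves z v j) D,
        e ∉ H ∪ E \ H := by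
      intro v hv j D hD e he heE
      rw [hEH] at heE
      obtain ⟨x, hx, y, hy, rfl⟩ := mem_pairEdges.1 he
      have hx2 := h.leaves_subset hv j hx
      have hyQ := hD hy
      have e1 := disjoint_left.1 hT₂ hyQ
      have e2 := disjoint_left.1 hT₁ hyQ
      have e3 := disjoint_right.1 hT hx2
      rcases mem_union.1 heE with h' | h'
      · obtain ⟨u, hu, w, hw, huw⟩ := mem_pairEdges.1 h'
        rcases Sym2.eq_iff.1 huw with ⟨h1, h2⟩ | ⟨h1, h2⟩
        · exact e2 (h2 ▸ hw)
        · exact e3 (h2 ▸ hw)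
      · obtain ⟨u, hu, w, hw, huw⟩ := mem_pairEdges.1 h'
        rcases Sym2.eq_iff.1 huw with ⟨h1, h2⟩ | ⟨h1, h2⟩
        · exact e3 (h1 ▸ hu)
        · exact e2 (h1 ▸ hu)
    have m1 : ∀ b : ↥(Y ∪ R), (b : V) ∈ Y ∪ R ∪ C := fun b => mem_union_left _ b.2
    have m2 : ∀ b : C, (b : V) ∈ Y ∪ R ∪ C := fun b => mem_union_right _ b.2
    have hCQ : C ⊆ Y ∪ R ∪ C := subset_union_right
    have hYQ : Y ⊆ Y ∪ R ∪ C := subset_union_left.trans subset_union_left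
    have b1 := gnp_not_expands_le (p := p) (σ := ↥(Y ∪ R)) (D := C) (s := 5 * lam)
      (Z := fun x => leaves z x.1 x.2) (w := k * m)
      (fun i j hij => h.disjoint_leaves (m1 _) (m1 _) fun hh => hij
        (Prod.ext (Subtype.ext hh.1) hh.2))
      (fun i => h.card_leaves (m1 _) _)
      (fun i => (hT₂.mono_left hCQ).symm.mono_left (h.leaves_subset (m1 _) _))
      (S := H) (S' := E \ H) disjoint_sdiff (fun e he => hE e (hH he))
      (fun e he => hE e (sdiff_subset he)) (fun i => hav _ (m1 _) _ _ hCQ) (by omega)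
      (by rw [Fintype.card_coe, hYR]; omega) (by omega) hwp
    have b2 := gnp_not_expands_le (p := p) (σ := C) (D := Y) (s := 9 * lam / 2)
      (Z := fun x => leaves z x.1 x.2) (w := k * m)
      (fun i j hij => h.disjoint_leaves (m2 _) (m2 _) fun hh => hij
        (Prod.ext (Subtype.ext hh.1) hh.2))
      (fun i => h.card_leaves (m2 _) _)
      (fun i => (hT₂.mono_left hYQ).symm.mono_left (h.leaves_subset (m2 _) _))
      (S := H) (S' := E \ H) disjoint_sdiff (fun e he => hE e (hH he))
      (fun e he => hE e (sdiff_subset he)) (fun i => hav _ (m2 _) _ _ hYQ) (by omega)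
      (by rw [Fintype.card_coe]; omega) (by omega) hwp
    refine (measureReal_mono hsub (measure_ne_top _ _)).trans
      ((measureReal_union_le _ _).trans ((add_le_add b1 b2).trans ?_))
    rw [← mul_add]
    refine mul_le_mul_of_nonneg_left ?_ measureReal_nonneg
    rw [Fintype.card_coe, Fintype.card_coe, hYR, hC, hY]
    have hl : (0 : ℝ) < lam := by exact_mod_cast (by omega : 0 < lam)
    have i1 : 1 / ((9 * lam : ℕ) : ℝ) ^ 2 ≤ 1 / (lam : ℝ) ^ 2 := by
      push_cast
      exact one_div_le_one_div_of_le (by positivity) (by nlinarith)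
    have i2 : 1 / ((6 * lam : ℕ) : ℝ) ^ 2 ≤ 1 / (lam : ℝ) ^ 2 := by
      push_cast
      exact one_div_le_one_div_of_le (by positivity) (by nlinarith)
    have i3 : (1 - (p : ℝ)) ^ (k * m * (9 * lam)) ≤ (1 - (p : ℝ)) ^ (k * m * (6 * lam)) :=
      pow_le_pow_of_le_one one_sub_nonneg one_sub_le_one (Nat.mul_le_mul_left _ (by omega))
    have i4 : 20 * ((12 * lam : ℕ) : ℝ) * (1 - (p : ℝ)) ^ (k * m * (9 * lam)) ≤
        20 * ((12 * lam : ℕ) : ℝ) * (1 - (p : ℝ)) ^ (k * m * (6 * lam)) :=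
      mul_le_mul_of_nonneg_left i3 (by positivity)
    have i5 : 2 / (lam : ℝ) ^ 2 = 1 / (lam : ℝ) ^ 2 + 1 / (lam : ℝ) ^ 2 := by ring
    rw [i5]
    push_cast at i1 i2 i4 ⊢
    linarith

end Conditioning

end

/-! ### The template and the path device, deterministically -/

section

open Finset

/-- A template of degree at most sixty with `R` replaceable by any half of it. -/
theorem exists_template {V : Type*} [DecidableEq V] {lam : ℕ} {R Y : Finset V}
    (hRY : Disjoint R Y) (hR : #R = 6 * lam) (hY : #Y = 6 * lam) (hlam : 150 ≤ lam) :
    ∃ N : Fin (9 * lam) → Finset V, (∀ i, N i ⊆ Y ∪ R) ∧ (∀ i, #(N i) ≤ 60) ∧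
      (∀ r, #{i | r ∈ N i} ≤ 60) ∧ ∀ U ⊆ R, #U = 3 * lam →
        ∃ φ : Fin (9 * lam) → V, φ.Injective ∧ ∀ i, φ i ∈ N i ∧ φ i ∈ Y ∪ U := by
  classical
  have hYR : #(Y ∪ R) = 12 * lam := by
    rw [card_union_of_disjoint hRY.symm, hR, hY]; ring
  obtain ⟨F, hF, hF'⟩ := exists_expands (σ := ↥(Y ∪ R)) (τ := Fin (9 * lam)) (s := 5 * lam)
    (by rw [Fintype.card_fin]; omega) (by rw [Fintype.card_fin, Fintype.card_coe, hYR]; omega)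
    (by rw [Fintype.card_fin]; omega)
  obtain ⟨H, hH, hH'⟩ := exists_expands (σ := Fin (9 * lam)) (τ := Y) (s := 9 * lam / 2)
    (by rw [Fintype.card_coe]; omega) (by rw [Fintype.card_fin, Fintype.card_coe, hY]; omega)
    (by rw [Fintype.card_coe]; omega)
  -- Out-degree 20 of one family plus in-degree at most 40 of the other gives 60 on either side.
  let N : Fin (9 * lam) → Finset V := fun i =>
    ({x : ↥(Y ∪ R) × Fin 20 | F x.1 x.2 = i} : Finset _).image (fun x => (x.1 : V)) ∪
      univ.image fun j => (H i j : V)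
  refine ⟨N, ?_, ?_, ?_, ?_⟩
  · intro i v hv
    rcases mem_union.1 hv with h | h
    · obtain ⟨x, -, rfl⟩ := mem_image.1 h
      exact x.1.2
    · obtain ⟨j, -, rfl⟩ := mem_image.1 h
      exact mem_union_left _ (H i j).2
  · intro i
    refine (card_union_le _ _).trans ?_
    have h1 := (card_image_le (f := fun x : ↥(Y ∪ R) × Fin 20 => (x.1 : V))).trans (hF' i)
    have h2 : #(univ.image fun j => (H i j : V)) ≤ 20 := card_image_le.trans (by simp)
    omega
  · intro r
    by_cases hr : r ∈ Y ∪ R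
    swap
    · have : ({i | r ∈ N i} : Finset (Fin (9 * lam))) = ∅ := by
        rw [filter_eq_empty_iff]
        intro i _ hi
        rcases mem_union.1 hi with h | h
        · obtain ⟨x, -, rfl⟩ := mem_image.1 h
          exact hr x.1.2
        · obtain ⟨j, -, rfl⟩ := mem_image.1 h
          exact hr (mem_union_left _ (H i j).2)
      rw [this]; simp
    have hsub : ({i | r ∈ N i} : Finset (Fin (9 * lam))) ⊆ univ.image (F ⟨r, hr⟩) ∪
        ({x : Fin (9 * lam) × Fin 20 | (H x.1 x.2 : V) = r} : Finset _).image Prod.fst := by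
      intro i hi
      rw [mem_filter] at hi
      rcases mem_union.1 hi.2 with h | h
      · obtain ⟨x, hx, rfl⟩ := mem_image.1 h
        exact mem_union_left _ (mem_image.2 ⟨x.2, mem_univ _, (mem_filter.1 hx).2⟩)
      · obtain ⟨j, -, hj⟩ := mem_image.1 h
        exact mem_union_right _ (mem_image.2 ⟨(i, j), mem_filter.2 ⟨mem_univ _, hj⟩, rfl⟩)
    refine (card_le_card hsub).trans ((card_union_le _ _).trans ?_)
    have h1 : #(univ.image (F ⟨r, hr⟩)) ≤ 20 := card_image_le.trans (by simp)
    have h2 : #({x : Fin (9 * lam) × Fin 20 | (H x.1 x.2 : V) = r} : Finset _) ≤ 40 := by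
      by_cases hrY : r ∈ Y
      · refine le_trans (le_of_eq ?_) (hH' ⟨r, hrY⟩)
        congr 1
        ext x
        simp [Subtype.ext_iff]
      · rw [card_eq_zero.2]
        · omega
        rw [filter_eq_empty_iff]
        rintro x - rfl
        exact hrY (H _ _).2
    have h3 := (card_image_le (f := Prod.fst)).trans h2
    omega
  · intro U hU hUc
    obtain ⟨φ, hφ, hφ'⟩ := exists_matching_of_expands (hRY.symm.mono_right hU)
      (subset_union_left (s₂ := R)) (hU.trans subset_union_right)
      (by rw [Fintype.card_fin, hY, hUc]; ring) (by rw [Fintype.card_fin]; omega)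
      (by rw [Fintype.card_fin]; omega) hF hH
    refine ⟨φ, hφ, fun i => ⟨?_, (hφ' i).1⟩⟩
    rcases (hφ' i).2 with ⟨hz, j, hj⟩ | ⟨j, hj⟩
    · exact mem_union_left _ (mem_image.2 ⟨(⟨φ i, hz⟩, j), mem_filter.2 ⟨mem_univ _, hj⟩, rfl⟩)
    · exact mem_union_right _ (mem_image.2 ⟨j, mem_univ _, hj⟩)

/-- Up to level `h` the sum is geometric and at most `2m`; the two further levels contribute at most
`m` each. -/
theorem sum_min_pow_le {d m h : ℕ} (hd : 2 ≤ d) (h2 : d ^ h ≤ m) :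
    ∑ i ∈ range (h + 3), min (d ^ i) m ≤ 4 * m := by
  have key : ∑ i ∈ range (h + 1), d ^ i ≤ 2 * d ^ h := by
    clear h2
    induction h with
    | zero => simp
    | succ h ih =>
      rw [sum_range_succ, pow_succ]
      nlinarith [Nat.zero_le (d ^ h)]
  rw [sum_range_succ, sum_range_succ]
  have h1 : ∑ i ∈ range (h + 1), min (d ^ i) m ≤ ∑ i ∈ range (h + 1), d ^ i :=
    sum_le_sum fun i _ => min_le_left _ _
  have h3 := min_le_right (d ^ (h + 1)) m
  have h4 := min_le_right (d ^ (h + 2)) m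
  omega

/-- Expansion into `T` and edges between large sets give a device of path type. -/
theorem ExpandsInto.exists_pathDevice {V : Type*} [DecidableEq V] {G : SimpleGraph V}
    {A T R Y C : Finset V} {κ K m d h q lam l : ℕ} (hex : ExpandsInto G A T κ (K + κ))
    (hjoin : ∀ P ⊆ A, ∀ Q ⊆ A, Disjoint P Q → m ≤ #P → m ≤ #Q → ∃ a ∈ P, ∃ b ∈ Q, G.Adj a b)
    (hTA : T ⊆ A) (hRA : R ⊆ A) (hYA : Y ⊆ A) (hCA : C ⊆ A)
    (hRY : Disjoint R Y) (hRC : Disjoint R C) (hYC : Disjoint Y C) (hT : Disjoint (Y ∪ R ∪ C) T)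
    (hR : #R = 6 * lam) (hY : #Y = 6 * lam) (hC : #C = 9 * lam) (hlam : 150 ≤ lam)
    (hm : 1 ≤ m) (hκ : 0 < κ) (hd : 120 ≤ d) (hdκ : d ≤ κ) (hKm : K + κ ≤ κ * m)
    (hhq : h + 3 = 2 * q) (hdm : d ^ h ≤ m) (hmd : m ≤ d ^ (h + 2))
    (hl : 60 * (absorberSize (h + 2) + 2 * (h + 3)) + 2 < l)
    (hK : 2 * m * d + 8 * m + 9 * lam * l ≤ K) :
    ∃ X x y, IsPathDevice G lam l R X x y := by
  obtain ⟨N, hN, hNc, hNd, hNm⟩ := exists_template hRY hR hY hlam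
  have hT' : ∀ v ∈ Y ∪ R ∪ C, v ∉ T := fun v hv => disjoint_left.1 hT hv
  have hext : ExpandsInto G A T d K := hex.of_le hκ hdκ
  have hE : Extendable G A m T fun _ => d := by
    intro U hU hUm
    rw [sum_const, smul_eq_mul, mul_comm]
    refine hext U hU ?_
    calc d * #U ≤ d * (2 * m) := Nat.mul_le_mul_left _ hUm
      _ ≤ K := by nlinarith
  -- A set of `m` vertices contains one of size `(K + κ) / κ`, which has more than `K` neighbours by
  -- `hex`.
  have hHost : Host G A T m K := by
    refine ⟨hTA, hm, ?_, hjoin⟩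
    intro U hU hmU _
    have h1 : (K + κ) / κ ≤ #U := by
      refine le_trans ?_ hmU
      rw [Nat.div_le_iff_le_mul_add_pred hκ]
      omega
    obtain ⟨U', hU', hcard⟩ := exists_subset_card_eq h1
    have h3 := hex U' (hU'.trans hU) (by rw [hcard]; exact Nat.mul_div_le _ _)
    have h4 : K < κ * #U' := by
      rw [hcard]
      have := Nat.lt_mul_div_succ (K + κ) hκ
      rw [Nat.mul_add] at this
      omega
    exact h4.le.trans (h3.trans (card_le_card (nbrIn_mono_right hU')))
  have hL : Linker G A T m d K (h + 2) := ⟨hHost, by omega, hmd⟩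
  let e := C.equivFinOfCardEq hC
  obtain ⟨l, rfl⟩ : ∃ l', l = l' + 2 := ⟨l - 2, by omega⟩
  have hxC : ∀ i, (e.symm i : V) ∈ C := fun i => (e.symm i).2
  refine LambdaDevice.exists_pathDevice hL hE (by omega) (q := q) (by omega) (R := R) (Y := Y)
    (x := fun i => (e.symm i : V)) (nb := fun i => (N i).toList) hY hRY.symm ?_ ?_ ?_ hRA ?_ hYA ?_
    ?_ ?_ ?_ ?_ ?_ ?_
  · exact Subtype.val_injective.comp e.symm.injective
  · exact fun i => ⟨hCA (hxC i), hT' _ (mem_union_right _ (hxC i))⟩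
  · intro i hi
    rcases mem_union.1 hi with h | h
    · exact disjoint_left.1 hYC h (hxC i)
    · exact disjoint_left.1 hRC h (hxC i)
  · exact hT.mono_left (subset_union_right.trans subset_union_left)
  · exact hT.mono_left (subset_union_left.trans subset_union_left)
  · exact fun i => nodup_toList _
  · exact fun i r hr => hN i (mem_toList.1 hr)
  · intro r
    simp only [mem_toList]
    have := hNd r
    omega
  · intro i
    rw [length_toList]
    calc #(N i) * (absorberSize (h + 2) + 2 * (h + 2 + 1)) ≤
          60 * (absorberSize (h + 2) + 2 * (h + 3)) := Nat.mul_le_mul_right _ (hNc i)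
      _ < l := by omega
  · have h1 := sum_min_pow_le (by omega) hdm
    have h2 : 9 * lam * l ≤ 9 * lam * (l + 2) := Nat.mul_le_mul_left _ (by omega)
    unfold reserve
    rw [show h + 2 + 1 = h + 3 by omega]
    omega
  · intro U hU hUc
    obtain ⟨φ, hφ, hφ'⟩ := hNm U hU hUc
    exact ⟨φ, hφ, fun i => ⟨mem_toList.2 (hφ' i).1, (hφ' i).2⟩⟩

end

/-! ### Numerical scale and probabilities of the two properties -/

section

open Finset MeasureTheory

/-- The number `n` is huge, `x` is its logarithm, and `y` is the sixth root of `x`. -/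
structure Scale (n : ℕ) (x y : ℝ) : Prop where
  log_eq : Real.log n = x
  pow_eq : y ^ 6 = x
  le_log : 10 ^ 8 ≤ Real.log y
  y_pos : 0 < y

theorem eventually_exists_scale : ∀ᶠ n : ℕ in Filter.atTop, ∃ x y, Scale n x y := by
  have h : Filter.Tendsto (fun n : ℕ => Real.log (Real.log n)) Filter.atTop Filter.atTop :=
    Real.tendsto_log_atTop.comp (Real.tendsto_log_atTop.comp tendsto_natCast_atTop_atTop)
  have h' : Filter.Tendsto (fun n : ℕ => Real.log n) Filter.atTop Filter.atTop :=
    Real.tendsto_log_atTop.comp tendsto_natCast_atTop_atTop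
  filter_upwards [h.eventually_ge_atTop (6 * 10 ^ 8), h'.eventually_gt_atTop 0] with n hn hn'
  refine ⟨Real.log n, Real.exp (Real.log (Real.log n) / 6), rfl, ?_, ?_, Real.exp_pos _⟩
  · rw [← Real.exp_nat_mul]
    push_cast
    rw [mul_div_cancel₀ _ (by norm_num), Real.exp_log hn']
  · rw [Real.log_exp]; linarith

namespace Scale

variable {n : ℕ} {x y : ℝ}

theorem le_y (hs : Scale n x y) : 10 ^ 8 ≤ y := by
  have := Real.log_le_sub_one_of_pos hs.y_pos
  linarith [hs.le_log]

theorem y_le_x (hs : Scale n x y) : y ^ 5 * 10 ^ 8 ≤ x := by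
  have h := hs.le_y
  have := hs.y_pos
  rw [← hs.pow_eq, pow_succ y 5]
  gcongr

theorem le_x (hs : Scale n x y) : 10 ^ 8 ≤ x := by
  have h := hs.le_y
  have := hs.y_le_x
  have h1 : (1 : ℝ) ≤ y ^ 5 := one_le_pow₀ (by linarith)
  linarith

theorem n_pos (hs : Scale n x y) : (0 : ℝ) < n := by
  rcases Nat.eq_zero_or_pos n with h | h
  · have := hs.log_eq
    rw [h, Nat.cast_zero, Real.log_zero] at this
    linarith [hs.le_x]
  · exact_mod_cast h

theorem exp_eq (hs : Scale n x y) : Real.exp x = n := by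
  rw [← hs.log_eq, Real.exp_log hs.n_pos]

theorem pow_le (hs : Scale n x y) : x ^ 7 ≤ n := by
  rw [← hs.exp_eq]
  have h := Real.pow_div_factorial_le_exp x (by linarith [hs.le_x]) 8
  refine le_trans ?_ h
  rw [le_div_iff₀ (by positivity), pow_succ x 7]
  have h1 : ((Nat.factorial 8 : ℕ) : ℝ) ≤ x := by
    have := hs.le_x
    norm_num [Nat.factorial] at this ⊢
    linarith
  have : 0 ≤ x ^ 7 := pow_nonneg (by linarith [hs.le_x]) _
  gcongr

theorem le_n (hs : Scale n x y) : 10 ^ 40 * x ≤ n := by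
  refine le_trans ?_ hs.pow_le
  have h := hs.le_x
  have h1 : (10 ^ 40 : ℝ) ≤ x ^ 6 := by
    calc (10 ^ 40 : ℝ) ≤ (10 ^ 8) ^ 6 := by norm_num
      _ ≤ x ^ 6 := by gcongr
  rw [pow_succ x 6]
  gcongr

theorem log_log_eq (hs : Scale n x y) : Real.log (Real.log n) = 6 * Real.log y := by
  rw [hs.log_eq, ← hs.pow_eq, Real.log_pow]; norm_num

end Scale

section Prob

variable {V : Type*} [Fintype V] [DecidableEq V] {p : unitInterval} {n : ℕ} {x y : ℝ}

theorem one_sub_pow_le (N : ℕ) : (1 - (p : ℝ)) ^ N ≤ Real.exp (-(p * N)) := by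
  have h : 1 - (p : ℝ) ≤ Real.exp (-p) := by linarith [Real.add_one_le_exp (-(p : ℝ))]
  refine (pow_le_pow_left₀ one_sub_nonneg h N).trans_eq ?_
  rw [← Real.exp_nat_mul]; ring_nf

/-- With expansion factor `⌊x⌋`, the choice of few neighbours costs at most `exp (20x)`, whereas the
missing edges to more than half of `T` contribute at most `exp (-4000x)`. -/
theorem Scale.gnp_not_expandsInto_le (hs : Scale n x y) (hp : (p : ℝ) = 10 ^ 5 * x / n)
    {A T : Finset V} (hA : #A ≤ n) (hT : #T = n / 10 + 1) :
    (gnp V p).real {G | ¬ ExpandsInto G A T ⌊x⌋₊ (n / 50)} ≤ Real.exp (-(3 * x)) := by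
  have hx := hs.le_x
  have hn := hs.n_pos
  have hnx := hs.le_n
  have hκ1 : x - 1 < ⌊x⌋₊ := Nat.sub_one_lt_floor x
  have hκ2 : (⌊x⌋₊ : ℝ) ≤ x := Nat.floor_le (by linarith)
  have hκ : 0 < ⌊x⌋₊ := by
    rw [← Nat.cast_pos (α := ℝ)]; linarith
  have hT1 : (n : ℝ) / 10 ≤ #T := by
    rw [hT]
    have : n ≤ 10 * (n / 10 + 1) := by omega
    have : (n : ℝ) ≤ 10 * ((n / 10 + 1 : ℕ) : ℝ) := by exact_mod_cast this
    linarith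
  have hT2 : (#T : ℝ) ≤ n / 5 := by
    rw [hT]
    have h1 : (10 : ℕ) ≤ n := by
      have : (10 : ℝ) ≤ n := by linarith
      exact_mod_cast this
    have : 5 * (n / 10 + 1) ≤ n := by omega
    have : 5 * ((n / 10 + 1 : ℕ) : ℝ) ≤ n := by exact_mod_cast this
    linarith
  have hTp1 : 10 ^ 4 * x ≤ #T * (p : ℝ) := by
    rw [hp, ← mul_div_assoc, le_div_iff₀ hn]
    nlinarith
  have hTp2 : #T * (p : ℝ) ≤ 2 * 10 ^ 4 * x := by
    rw [hp, ← mul_div_assoc, div_le_iff₀ hn]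
    nlinarith
  have hρ : #A * ((Real.exp 1 * (#T * p) / ⌊x⌋₊) ^ ⌊x⌋₊ * (1 - (p : ℝ)) ^ (n / 20)) ≤
      Real.exp (-(5 * x)) := by
    have h1 : Real.exp 1 * (#T * p) / ⌊x⌋₊ ≤ Real.exp 20 := by
      have e1 : Real.exp 1 ≤ 3 := by linarith [Real.exp_one_lt_d9]
      have e2 : (2 : ℝ) ^ 20 ≤ Real.exp 20 := by
        have : Real.exp 20 = Real.exp 1 ^ 20 := by rw [← Real.exp_nat_mul]; norm_num
        rw [this]
        exact pow_le_pow_left₀ (by norm_num) (by linarith [Real.exp_one_gt_d9]) _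
      refine le_trans ?_ e2
      rw [div_le_iff₀ (by linarith)]
      calc Real.exp 1 * (#T * p) ≤ 3 * (2 * 10 ^ 4 * x) := by
            apply mul_le_mul e1 hTp2 _ (by norm_num)
            linarith
        _ ≤ 2 ^ 20 * ⌊x⌋₊ := by norm_num; linarith
    have h2 : (Real.exp 1 * (#T * p) / ⌊x⌋₊) ^ ⌊x⌋₊ ≤ Real.exp (20 * x) := by
      calc _ ≤ Real.exp 20 ^ ⌊x⌋₊ := by
            refine pow_le_pow_left₀ ?_ h1 _
            have : 0 ≤ #T * (p : ℝ) := by linarith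
            positivity
        _ = Real.exp (⌊x⌋₊ * 20) := by rw [← Real.exp_nat_mul]
        _ ≤ _ := Real.exp_le_exp.2 (by linarith)
    have h3 : (1 - (p : ℝ)) ^ (n / 20) ≤ Real.exp (-(4000 * x)) := by
      refine (one_sub_pow_le _).trans (Real.exp_le_exp.2 ?_)
      have : n < 20 * (n / 20 + 1) := by omega
      have : (n : ℝ) < 20 * (((n / 20 : ℕ) : ℝ) + 1) := by exact_mod_cast this
      rw [neg_le_neg_iff, hp, div_mul_eq_mul_div, le_div_iff₀ hn]
      nlinarith
    have h4 : (#A : ℝ) ≤ Real.exp x := by rw [hs.exp_eq]; exact_mod_cast hA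
    calc _ ≤ Real.exp x * (Real.exp (20 * x) * Real.exp (-(4000 * x))) := by
          have : 0 ≤ (1 - (p : ℝ)) ^ (n / 20) := pow_nonneg one_sub_nonneg _
          have : 0 ≤ #T * (p : ℝ) := by linarith
          gcongr
      _ = Real.exp (x + (20 * x + -(4000 * x))) := by rw [← Real.exp_add, ← Real.exp_add]
      _ ≤ _ := Real.exp_le_exp.2 (by linarith)
  have hM : ((n / 50 : ℕ) : ℝ) ≤ Real.exp x := by
    rw [hs.exp_eq]; exact_mod_cast Nat.div_le_self _ _
  refine (LambdaDevice.gnp_not_expandsInto_le (W := n / 20) hκ (by omega) (by linarith) hρ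
    ?_).trans ?_
  · rw [Real.exp_le_one_iff]; linarith
  · calc _ ≤ Real.exp x * Real.exp x * Real.exp (-(5 * x)) := by gcongr
      _ = Real.exp (-(3 * x)) := by rw [← Real.exp_add, ← Real.exp_add]; ring_nf

/-- Since `y ^ 6 = x`, sets of size `n / y ^ 3` have `p (n / y ^ 3)² = 10⁵ n` expected edges between
them, which beats the `4 ^ n` choices. -/
theorem Scale.gnp_not_joined_le (hs : Scale n x y) (hp : (p : ℝ) = 10 ^ 5 * x / n)
    {A : Finset V} (hA : #A ≤ n) :
    (gnp V p).real {G | ¬ ∀ P ⊆ A, ∀ Q ⊆ A, Disjoint P Q → ⌈n / y ^ 3⌉₊ ≤ #P → ⌈n / y ^ 3⌉₊ ≤ #Q →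
      ∃ a ∈ P, ∃ b ∈ Q, G.Adj a b} ≤ Real.exp (-(3 * x)) := by
  refine (LambdaDevice.gnp_not_joined_le A _).trans ?_
  have hn := hs.n_pos
  have hy := hs.y_pos
  have hx := hs.le_x
  have hnx := hs.le_n
  have h1 : (4 : ℝ) ^ #A ≤ Real.exp (2 * n) := by
    calc (4 : ℝ) ^ #A ≤ 4 ^ n := pow_le_pow_right₀ (by norm_num) hA
      _ ≤ Real.exp 2 ^ n := by
          refine pow_le_pow_left₀ (by norm_num) ?_ _
          have : Real.exp 2 = Real.exp 1 ^ 2 := by rw [← Real.exp_nat_mul]; norm_num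
          rw [this]
          nlinarith [Real.exp_one_gt_d9]
      _ = _ := by rw [← Real.exp_nat_mul, mul_comm]
  have h2 : (n : ℝ) / y ^ 3 ≤ ⌈n / y ^ 3⌉₊ := Nat.le_ceil _
  have h3 : (1 - (p : ℝ)) ^ (⌈n / y ^ 3⌉₊ * ⌈n / y ^ 3⌉₊) ≤ Real.exp (-(10 ^ 5 * n)) := by
    refine (one_sub_pow_le _).trans (Real.exp_le_exp.2 ?_)
    rw [neg_le_neg_iff]
    push_cast
    calc (10 ^ 5 * n : ℝ) = p * (n / y ^ 3 * (n / y ^ 3)) := by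
          rw [hp, ← hs.pow_eq]; field_simp
      _ ≤ _ := by
          have : (0 : ℝ) ≤ p := p.2.1
          gcongr
  calc _ ≤ Real.exp (2 * n) * Real.exp (-(10 ^ 5 * n)) := by
        have : 0 ≤ (1 - (p : ℝ)) ^ (⌈n / y ^ 3⌉₊ * ⌈n / y ^ 3⌉₊) := pow_nonneg one_sub_nonneg _
        gcongr
    _ = Real.exp (2 * n + -(10 ^ 5 * n)) := by rw [← Real.exp_add]
    _ ≤ _ := Real.exp_le_exp.2 (by linarith)

end Prob

end

/-! ### Choice of parameters for the path device -/

section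

open Finset MeasureTheory

/-- Either the logarithm of `m` to base `d` or its predecessor is odd; allowing two more levels
instead of one makes room for this parity. -/
theorem exists_odd_pow_le {d m : ℕ} (hd : 2 ≤ d) (hm : d ≤ m) :
    ∃ h q, h + 3 = 2 * q ∧ d ^ h ≤ m ∧ m ≤ d ^ (h + 2) := by
  have h1 : d ^ Nat.log d m ≤ m := Nat.pow_log_le_self d (by omega)
  have h2 : m < d ^ (Nat.log d m + 1) := Nat.lt_pow_succ_log_self (by omega) m
  have h3 : 0 < Nat.log d m := Nat.log_pos (by omega) hm
  generalize Nat.log d m = t at h1 h2 h3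
  rcases Nat.even_or_odd' t with ⟨c, hc | hc⟩
  · refine ⟨t - 1, c + 1, by omega, le_trans ?_ h1, ?_⟩
    · exact Nat.pow_le_pow_right (by omega) (by omega)
    · rw [show t - 1 + 2 = t + 1 by omega]; exact h2.le
  · refine ⟨t, c + 2, by omega, h1, h2.le.trans ?_⟩
    exact Nat.pow_le_pow_right (by omega) (by omega)

namespace Scale

variable {n : ℕ} {x y : ℝ}

/-- The ratio `log n / log log n` is large. -/
theorem le_ratio (hs : Scale n x y) : 10 ^ 6 ≤ x / (6 * Real.log y) := by
  have h1 := hs.le_log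
  have h2 := hs.le_y
  have h3 := Real.log_le_sub_one_of_pos hs.y_pos
  rw [le_div_iff₀ (by linarith)]
  refine le_trans ?_ hs.y_le_x
  have h4 : y ≤ y ^ 5 := le_self_pow₀ (by linarith) (by norm_num)
  nlinarith

theorem lowerEnd_eq (hs : Scale n x y) : lowerEnd n = n * (6 * Real.log y) / x ^ 2 := by
  rw [lowerEnd, hs.log_log_eq, hs.log_eq]

theorem pathOrder_eq (hs : Scale n x y) : pathOrder n = 10 ^ 4 * (x / (6 * Real.log y)) ^ 2 := by
  rw [pathOrder, hs.log_log_eq, hs.log_eq, div_pow, mul_div_assoc]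

theorem div_sq_le_lowerEnd (hs : Scale n x y) : n / x ^ 2 ≤ lowerEnd n := by
  rw [hs.lowerEnd_eq]
  have h1 := hs.le_log
  have h2 := hs.n_pos
  gcongr
  nlinarith

/-- The total length of the paths is small. -/
theorem lowerEnd_mul_pathOrder_le (hs : Scale n x y) :
    (lowerEnd n + 1) * (pathOrder n + 1) ≤ n / 1000 := by
  have h1 := hs.le_log
  have h2 := hs.n_pos
  have h3 := hs.le_x
  have h4 := hs.le_ratio
  have h5 := hs.le_n
  have hX : lowerEnd n * pathOrder n = 10 ^ 4 * n / (6 * Real.log y) := by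
    rw [hs.lowerEnd_eq, hs.pathOrder_eq]; field_simp
  have hA : 10 ^ 4 * (n : ℝ) / (6 * Real.log y) ≤ n / 10 ^ 4 := by
    rw [div_le_div_iff₀ (by linarith) (by norm_num)]
    nlinarith
  have hB : lowerEnd n ≤ n / 10 ^ 4 := by
    have : lowerEnd n = n / (x * (x / (6 * Real.log y))) := by
      rw [hs.lowerEnd_eq]; field_simp
    rw [this]
    refine div_le_div_of_nonneg_left h2.le (by norm_num) ?_
    nlinarith
  have hC : pathOrder n ≤ n / 10 ^ 4 := by
    rw [hs.pathOrder_eq]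
    have : x / (6 * Real.log y) ≤ x := div_le_self (by linarith) (by linarith)
    have h6 : (x / (6 * Real.log y)) ^ 2 ≤ x ^ 2 := by gcongr
    have h7 : 10 ^ 8 * x ^ 2 ≤ n := by
      refine le_trans ?_ hs.pow_le
      have : (1 : ℝ) ≤ x ^ 4 := one_le_pow₀ (by linarith)
      calc 10 ^ 8 * x ^ 2 ≤ x * x ^ 2 := by gcongr
        _ ≤ x * x ^ 2 * x ^ 4 := le_mul_of_one_le_right (by positivity) this
        _ = x ^ 7 := by ring
    linarith
  nlinarith

/-- The base is at least `y ^ (3 / 2)`, so `h` is at most `x / (3 log y / 2)`. -/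
theorem le_ratio_of_pow_le (hs : Scale n x y) {h : ℕ} (hh : (⌊y ^ 2⌋₊ : ℝ) ^ h ≤ n) :
    (h : ℝ) ≤ 4 * (x / (6 * Real.log y)) := by
  have hy := hs.le_y
  have hlog := hs.le_log
  have hd1 : y ^ 2 - 1 < ⌊y ^ 2⌋₊ := Nat.sub_one_lt_floor _
  have hy2 : y ≤ y ^ 2 := le_self_pow₀ (by linarith) (by norm_num)
  have hd0 : (0 : ℝ) < ⌊y ^ 2⌋₊ := by linarith
  rw [← hs.exp_eq] at hh
  have h1 : h * Real.log ⌊y ^ 2⌋₊ ≤ x := by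
    rw [← Real.log_pow]
    exact (Real.log_le_iff_le_exp (by positivity)).2 hh
  have h2 : 3 * Real.log y ≤ 2 * Real.log ⌊y ^ 2⌋₊ := by
    have : Real.log (y ^ 3) ≤ Real.log ((⌊y ^ 2⌋₊ : ℝ) ^ 2) := by
      refine Real.log_le_log (by positivity) ?_
      have : y ^ 2 / 2 ≤ ⌊y ^ 2⌋₊ := by linarith
      calc y ^ 3 ≤ (y ^ 2 / 2) ^ 2 := by
            have : (y ^ 2 / 2) ^ 2 = y ^ 3 * (y / 4) := by ring
            rw [this]
            exact le_mul_of_one_le_right (by positivity) (by linarith)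
        _ ≤ _ := by gcongr
    rw [Real.log_pow, Real.log_pow] at this
    exact_mod_cast this
  rw [← mul_div_assoc, le_div_iff₀ (by linarith)]
  have h3 := mul_le_mul_of_nonneg_left h2 (Nat.cast_nonneg (α := ℝ) h)
  linarith

/-- The choices are `d = ⌊y²⌋` and `m = ⌈n / y³⌉`. Then `m d` is about `n / y`, negligible against
`K`, which is about `n / 50`, while `⌊x⌋ m` exceeds `n / 50`. -/
theorem exists_pathDevice (hs : Scale n x y) {V : Type*} [DecidableEq V] {G : SimpleGraph V}
    {A T R Y C : Finset V} {lam l : ℕ} (hex : ExpandsInto G A T ⌊x⌋₊ (n / 50))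
    (hjoin : ∀ P ⊆ A, ∀ Q ⊆ A, Disjoint P Q → ⌈n / y ^ 3⌉₊ ≤ #P → ⌈n / y ^ 3⌉₊ ≤ #Q →
      ∃ a ∈ P, ∃ b ∈ Q, G.Adj a b)
    (hTA : T ⊆ A) (hRA : R ⊆ A) (hYA : Y ⊆ A) (hCA : C ⊆ A)
    (hRY : Disjoint R Y) (hRC : Disjoint R C) (hYC : Disjoint Y C) (hT : Disjoint (Y ∪ R ∪ C) T)
    (hR : #R = 6 * lam) (hY : #Y = 6 * lam) (hC : #C = 9 * lam) (hlam : 150 ≤ lam)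
    (hle : (lam : ℝ) ≤ lowerEnd n + 1) (hl : l = ⌊pathOrder n⌋₊ ∨ l = ⌈pathOrder n⌉₊) :
    ∃ X x y, IsPathDevice G lam l R X x y := by
  have hy := hs.le_y
  have hx := hs.le_x
  have hnx := hs.le_n
  have hn := hs.n_pos
  have hlog := hs.le_log
  have hX := hs.le_ratio
  have hP := hs.pathOrder_eq
  set X := x / (6 * Real.log y) with hXdef
  have hP0 : 0 ≤ pathOrder n := by rw [hP]; positivity
  have hl1 : pathOrder n - 1 ≤ l := by
    rcases hl with rfl | rfl
    · exact (Nat.sub_one_lt_floor _).le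
    · linarith [Nat.le_ceil (pathOrder n)]
  have hl2 : (l : ℝ) ≤ pathOrder n + 1 := by
    rcases hl with rfl | rfl
    · linarith [Nat.floor_le hP0]
    · exact (Nat.ceil_lt_add_one hP0).le
  have hκ1 : x - 1 < ⌊x⌋₊ := Nat.sub_one_lt_floor x
  have hκ2 : (⌊x⌋₊ : ℝ) ≤ x := Nat.floor_le (by linarith)
  have hκ : 0 < ⌊x⌋₊ := by
    rw [← Nat.cast_pos (α := ℝ)]; linarith
  have hM1 : (n : ℝ) / 50 - 1 ≤ (n / 50 : ℕ) := by
    have : n ≤ 50 * (n / 50 + 1) := by omega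
    have : (n : ℝ) ≤ 50 * (((n / 50 : ℕ) : ℝ) + 1) := by exact_mod_cast this
    linarith
  have hM2 : ((n / 50 : ℕ) : ℝ) ≤ n / 50 := Nat.cast_div_le
  obtain ⟨K, hK⟩ : ∃ K, n / 50 = K + ⌊x⌋₊ := by
    refine ⟨n / 50 - ⌊x⌋₊, (Nat.sub_add_cancel ?_).symm⟩
    have : (⌊x⌋₊ : ℝ) ≤ (n / 50 : ℕ) := by linarith
    exact_mod_cast this
  have hKr : ((n / 50 : ℕ) : ℝ) = K + ⌊x⌋₊ := by rw [hK]; push_cast; ring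
  have hd1 : y ^ 2 - 1 < ⌊y ^ 2⌋₊ := Nat.sub_one_lt_floor _
  have hd2 : (⌊y ^ 2⌋₊ : ℝ) ≤ y ^ 2 := Nat.floor_le (by positivity)
  have hm1 : (n : ℝ) / y ^ 3 ≤ ⌈n / y ^ 3⌉₊ := Nat.le_ceil _
  have hm2 : (⌈n / y ^ 3⌉₊ : ℝ) < n / y ^ 3 + 1 := Nat.ceil_lt_add_one (by positivity)
  have hyx : y ^ 3 * y ^ 3 = x := by rw [← hs.pow_eq]; ring
  have hy2 : y ≤ y ^ 2 := le_self_pow₀ (by linarith) (by norm_num)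
  have hy3 : y ≤ y ^ 3 := le_self_pow₀ (by linarith) (by norm_num)
  have hy23 : y ^ 2 ≤ y ^ 3 := pow_le_pow_right₀ (by linarith) (by norm_num)
  have hy3x : y ^ 3 * 10 ^ 8 ≤ x := by rw [← hyx]; gcongr; linarith
  have hny : x ≤ n / y ^ 3 := by
    rw [le_div_iff₀ (by positivity)]
    calc x * y ^ 3 ≤ x * x := by gcongr; linarith
      _ = x ^ 2 := by ring
      _ ≤ x ^ 7 := pow_le_pow_right₀ (by linarith) (by norm_num)
      _ ≤ n := hs.pow_le
  have hny' : (n : ℝ) / y ^ 3 ≤ n / 10 ^ 8 := by gcongr; linarith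
  have hny2 : (n : ℝ) / y ^ 3 * y ^ 2 ≤ n / 10 ^ 8 := by
    have : (n : ℝ) / y ^ 3 * y ^ 2 = n / y := by field_simp
    rw [this]; gcongr
  have hd120 : 120 ≤ ⌊y ^ 2⌋₊ := by
    have : (120 : ℝ) ≤ ⌊y ^ 2⌋₊ := by linarith
    exact_mod_cast this
  have hdm : ⌊y ^ 2⌋₊ ≤ ⌈n / y ^ 3⌉₊ := by
    have : (⌊y ^ 2⌋₊ : ℝ) ≤ ⌈n / y ^ 3⌉₊ := by linarith
    exact_mod_cast this
  obtain ⟨h, q, hhq, hh1, hh2⟩ := exists_odd_pow_le (by omega) hdm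
  have hhX : (h : ℝ) ≤ 4 * X := hs.le_ratio_of_pow_le (by
    have : ((⌊y ^ 2⌋₊ : ℝ)) ^ h ≤ ⌈n / y ^ 3⌉₊ := by exact_mod_cast hh1
    linarith)
  rw [hK] at hex
  refine hex.exists_pathDevice hjoin hTA hRA hYA hCA hRY hRC hYC hT hR hY hC hlam (by omega) hκ
    hd120 ?_ ?_ hhq hh1 hh2 ?_ ?_
  · have : (⌊y ^ 2⌋₊ : ℝ) ≤ ⌊x⌋₊ := by linarith
    exact_mod_cast this
  · have : (K : ℝ) + ⌊x⌋₊ ≤ ⌊x⌋₊ * ⌈n / y ^ 3⌉₊ := by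
      rw [← hKr]
      refine hM2.trans ?_
      calc (n : ℝ) / 50 ≤ y ^ 3 * (n / y ^ 3) := by
            rw [mul_div_cancel₀ _ (by positivity)]; linarith
        _ ≤ _ := by gcongr; linarith
    exact_mod_cast this
  -- Sixty absorbers with their links have about `120 h² ≤ 1920 X²` vertices, fewer than the `10⁴
  -- X²` of `pathOrder n`; the lower-order terms are covered by `X ≥ 10⁶`.
  · have : (60 * ((2 + 2 * (h + 2 + 1) + 2 * (h + 2 + 1) ^ 2) + 2 * (h + 3)) + 2 : ℝ) < l := by
      refine lt_of_lt_of_le ?_ hl1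
      rw [hP]
      have h0 : (0 : ℝ) ≤ h := Nat.cast_nonneg _
      have hh : (h : ℝ) ^ 2 ≤ (4 * X) ^ 2 := pow_le_pow_left₀ h0 hhX 2
      have hXX : 10 ^ 6 * X ≤ X ^ 2 := by rw [sq]; gcongr
      clear * - hh hXX hhX hX
      linarith
    unfold absorberSize
    exact_mod_cast this
  · have h1 := hs.lowerEnd_mul_pathOrder_le
    have h2 : (lam : ℝ) * l ≤ n / 1000 := by
      refine le_trans ?_ h1
      gcongr
      linarith [Nat.cast_nonneg (α := ℝ) lam]
    have h3 : (⌈n / y ^ 3⌉₊ : ℝ) * ⌊y ^ 2⌋₊ ≤ n / 10 ^ 8 + y ^ 2 := by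
      calc _ ≤ (n / y ^ 3 + 1) * y ^ 2 := by gcongr
        _ ≤ _ := by linarith
    have : (2 * ⌈n / y ^ 3⌉₊ * ⌊y ^ 2⌋₊ + 8 * ⌈n / y ^ 3⌉₊ + 9 * lam * l : ℝ) ≤ K := by
      clear * - h2 h3 hm2 hny' hnx hKr hM1 hκ2 hx hy23 hy3x
      linarith
    exact_mod_cast this

end Scale

end

/-! ### The matching device parameters and the final union bound -/

section

open Finset MeasureTheory

theorem exists_disjoint_card_eq {V : Type*} [Fintype V] [DecidableEq V] (B : Finset V) {k : ℕ}
    (h : #B + k ≤ Fintype.card V) : ∃ S, Disjoint B S ∧ #S = k := by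
  obtain ⟨S, hS, hk⟩ := exists_subset_card_eq (s := Bᶜ) (n := k) (by rw [card_compl]; omega)
  exact ⟨S, disjoint_compl_right.mono_right hS, hk⟩

/-- Parameters for the trees in a matching device. -/
theorem Scale.exists_sprout_sizes {n : ℕ} {x y p : ℝ} (hs : Scale n x y)
    (hp : p = 10 ^ 5 * x / n) {lam K : ℕ} (hK : n / 50 = K + ⌊x⌋₊) (h1 : n / x ^ 2 ≤ lam)
    (h2 : (lam : ℝ) ≤ n / (100 * x)) :
    ∃ k m : ℕ, k * 20 ≤ ⌊x⌋₊ ∧ m ≤ ⌊x⌋₊ ∧ k * 20 * (21 * lam) ≤ K ∧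
      m * (k * 20 * (21 * lam)) ≤ K ∧ (k * m : ℕ) * p ≤ 1 / 10 ∧
      14 * x ≤ p * (k * m * (6 * lam) : ℕ) := by
  have hx := hs.le_x
  have hnx := hs.le_n
  have hn := hs.n_pos
  have hκ1 : x - 1 < ⌊x⌋₊ := Nat.sub_one_lt_floor x
  have hκ2 : (⌊x⌋₊ : ℝ) ≤ x := Nat.floor_le (by linarith)
  have hM1 : (n : ℝ) / 50 - 1 ≤ (n / 50 : ℕ) := by
    have : n ≤ 50 * (n / 50 + 1) := by omega
    have : (n : ℝ) ≤ 50 * (((n / 50 : ℕ) : ℝ) + 1) := by exact_mod_cast this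
    linarith
  have hM2 : ((n / 50 : ℕ) : ℝ) ≤ n / 50 := Nat.cast_div_le
  have hKr : ((n / 50 : ℕ) : ℝ) = K + ⌊x⌋₊ := by rw [hK]; push_cast; ring
  have hK1 : (n : ℝ) / 60 ≤ K := by linarith
  have hK2 : (K : ℝ) ≤ n / 50 := by linarith [Nat.cast_nonneg (α := ℝ) ⌊x⌋₊]
  have hl0 : (0 : ℝ) < lam := lt_of_lt_of_le (by positivity) h1
  have hlx : lam * x ≤ n / 100 := by
    have := (le_div_iff₀ (by positivity)).1 h2
    linarith
  have hlx2 : (n : ℝ) ≤ lam * x ^ 2 := (div_le_iff₀ (by positivity)).1 h1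
  -- With `k ≤ x / 1000` the first tree levels take at most `n / 200` vertices.
  obtain ⟨k, hk1, hk2⟩ : ∃ k : ℕ, x / 2000 ≤ k ∧ (k : ℝ) ≤ x / 1000 :=
    ⟨⌊x / 1000⌋₊, by linarith [Nat.sub_one_lt_floor (x / 1000)], Nat.floor_le (by linarith)⟩
  have hk0 : (0 : ℝ) < k := by linarith
  have hkl1 : k * 20 * (21 * (lam : ℝ)) ≤ n / 200 := by
    have : (k : ℝ) * lam ≤ x / 1000 * lam := by gcongr
    linarith
  have hkl2 : (n : ℝ) ≤ 2000 * (x * (k * lam)) := by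
    have : x / 2000 * (lam * x) ≤ k * (lam * x) := by gcongr
    linarith
  -- `m` is as large as the room `K` permits. Maximality gives `420 k m λ ≥ n / 60 - n / 200`, hence
  -- the constant `36000` used at the end.
  obtain ⟨m, hm1, hm2⟩ : ∃ m : ℕ, m * (k * 20 * (21 * lam)) ≤ K ∧
      K < (m + 1) * (k * 20 * (21 * lam)) := by
    have hpos : 0 < k * 20 * (21 * lam) := by
      have : (0 : ℝ) < k * 20 * (21 * (lam : ℝ)) := by positivity
      exact_mod_cast this
    exact ⟨K / (k * 20 * (21 * lam)), Nat.div_mul_le_self _ _, by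
      rw [mul_comm]; exact Nat.lt_mul_div_succ _ hpos⟩
  have hm1r : (m : ℝ) * (k * 20 * (21 * lam)) ≤ K := by exact_mod_cast hm1
  have hm2r : (K : ℝ) < (m + 1) * (k * 20 * (21 * lam)) := by exact_mod_cast hm2
  refine ⟨k, m, ?_, ?_, ?_, hm1, ?_, ?_⟩
  · have : (k : ℝ) * 20 ≤ ⌊x⌋₊ := by linarith
    exact_mod_cast this
  · have : (m : ℝ) ≤ ⌊x⌋₊ := by
      have h3 : (k * lam : ℝ) * (m * 420) ≤ k * lam * (40 * x) := by linarith
      have h4 := le_of_mul_le_mul_left h3 (by positivity)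
      linarith
    exact_mod_cast this
  · have : k * 20 * (21 * (lam : ℝ)) ≤ K := by linarith
    exact_mod_cast this
  · rw [hp, ← mul_div_assoc, div_le_iff₀ hn]
    push_cast
    have h3 : 10 ^ 6 * x ≤ lam := by
      refine le_trans ?_ h1
      rw [le_div_iff₀ (by positivity)]
      calc 10 ^ 6 * x * x ^ 2 ≤ x ^ 4 * x * x ^ 2 := by
            gcongr
            exact le_trans (by norm_num) (pow_le_pow_left₀ (by norm_num) hx 4)
        _ = x ^ 7 := by ring
        _ ≤ n := hs.pow_le
    have h4 : (k * m : ℝ) * (10 ^ 6 * x) ≤ k * m * lam := by gcongr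
    linarith
  · rw [hp, div_mul_eq_mul_div, le_div_iff₀ hn]
    push_cast
    have h3 : (n : ℝ) / 36000 ≤ k * m * lam := by linarith
    have h4 : x * ((n : ℝ) / 36000) ≤ x * (k * m * lam) := by gcongr
    have h5 : 0 ≤ x * n := by positivity
    linarith

/-- For huge `n`, the random graph fails to contain a device with small probability. -/
theorem Scale.gnp_not_hasDevice_le {V : Type*} [Fintype V] [DecidableEq V] {p : unitInterval}
    {n : ℕ} {x y : ℝ} (hs : Scale n x y) (hp : (p : ℝ) = 10 ^ 5 * x / n) {lam : ℕ} {R : Finset V}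
    (h1 : lowerEnd n ≤ lam) (h2 : (lam : ℝ) ≤ n / (100 * x)) (hV : 3 * (n : ℝ) / 4 ≤ Fintype.card V)
    (hR : #R = 6 * lam) :
    (gnp V p).real {G | ¬ HasDevice G n lam R} ≤ 500 * (x ^ 4 / n ^ 2) := by
  have hx := hs.le_x
  have hnx := hs.le_n
  have hn := hs.n_pos
  have h1' : n / x ^ 2 ≤ lam := hs.div_sq_le_lowerEnd.trans h1
  have hlam0 : (150 : ℝ) ≤ lam := by
    refine le_trans ?_ h1'
    rw [le_div_iff₀ (by positivity)]
    calc 150 * x ^ 2 ≤ x ^ 5 * x ^ 2 := by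
          gcongr
          exact le_trans (by norm_num) (pow_le_pow_left₀ (by norm_num) hx 5)
      _ = x ^ 7 := by ring
      _ ≤ n := hs.pow_le
  have hlam : 150 ≤ lam := by exact_mod_cast hlam0
  have hlx : (lam : ℝ) ≤ n / 10 ^ 6 := by
    refine h2.trans ?_
    gcongr
    linarith
  have hnat : 21 * lam + 2 * (n / 10 + 1) ≤ n ∧
      21 * lam + 2 * (n / 10 + 1) ≤ Fintype.card V := by
    have h3 : ((n / 10 : ℕ) : ℝ) ≤ n / 10 := Nat.cast_div_le
    have h4 : (21 * lam + 2 * ((n / 10 : ℕ) + 1) : ℝ) ≤ n := by linarith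
    have h5 : (21 * lam + 2 * ((n / 10 : ℕ) + 1) : ℝ) ≤ Fintype.card V := by linarith
    exact ⟨by exact_mod_cast h4, by exact_mod_cast h5⟩
  obtain ⟨Y, hRY, hY⟩ := exists_disjoint_card_eq R (k := 6 * lam) (by omega)
  have cYR : #(Y ∪ R) = 12 * lam := by
    rw [card_union_of_disjoint hRY.symm, hR, hY]; ring
  obtain ⟨C, hYRC, hC⟩ := exists_disjoint_card_eq (Y ∪ R) (k := 9 * lam) (by omega)
  have cQ : #(Y ∪ R ∪ C) = 21 * lam := by
    rw [card_union_of_disjoint hYRC, cYR, hC]; ring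
  obtain ⟨T₁, hQT₁, hT₁⟩ := exists_disjoint_card_eq (Y ∪ R ∪ C) (k := n / 10 + 1) (by omega)
  have cQT : #(Y ∪ R ∪ C ∪ T₁) = 21 * lam + (n / 10 + 1) := by
    rw [card_union_of_disjoint hQT₁, cQ, hT₁]
  obtain ⟨T₂, hQT₂, hT₂⟩ := exists_disjoint_card_eq (Y ∪ R ∪ C ∪ T₁) (k := n / 10 + 1) (by omega)
  set Q := Y ∪ R ∪ C with hQdef
  set A := Q ∪ T₁ ∪ T₂ with hAdef
  have hA : #A ≤ n := by
    rw [hAdef, card_union_of_disjoint hQT₂, cQT, hT₂]; omega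
  have hQA : Q ⊆ A := subset_union_left.trans subset_union_left
  have hT₁A : T₁ ⊆ A := subset_union_right.trans subset_union_left
  have hYQ : Y ⊆ Q := subset_union_left.trans subset_union_left
  have hRQ : R ⊆ Q := subset_union_right.trans subset_union_left
  have hCQ : C ⊆ Q := subset_union_right
  have hYC : Disjoint Y C := hYRC.mono_left subset_union_left
  have hRC : Disjoint R C := hYRC.mono_left subset_union_right
  have hT : Disjoint T₁ T₂ := hQT₂.mono_left subset_union_right
  have hQT₂' : Disjoint Q T₂ := hQT₂.mono_left subset_union_left
  have hκ2 : (⌊x⌋₊ : ℝ) ≤ x := Nat.floor_le (by linarith)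
  have hκ : 0 < ⌊x⌋₊ := Nat.floor_pos.2 (by linarith)
  obtain ⟨K, hK⟩ : ∃ K, n / 50 = K + ⌊x⌋₊ := by
    refine ⟨n / 50 - ⌊x⌋₊, (Nat.sub_add_cancel ?_).symm⟩
    rw [Nat.le_div_iff_mul_le (by norm_num)]
    have : (⌊x⌋₊ : ℝ) * 50 ≤ n := by linarith
    exact_mod_cast this
  obtain ⟨k, m, hk, hm, hkK, hmK, hkm, hkm'⟩ := hs.exists_sprout_sizes hp hK h1' h2
  have hne : Nonempty V := by
    rw [← Fintype.card_pos_iff]; omega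
  have hsub : {G : SimpleGraph V | ¬ HasDevice G n lam R} ⊆
      (({G | ¬ ExpandsInto G A T₁ ⌊x⌋₊ (n / 50)} ∪ {G | ¬ ExpandsInto G A T₂ ⌊x⌋₊ (n / 50)}) ∪
      {G | ¬ ∀ P ⊆ A, ∀ Q ⊆ A, Disjoint P Q → ⌈n / y ^ 3⌉₊ ≤ #P → ⌈n / y ^ 3⌉₊ ≤ #Q →
        ∃ a ∈ P, ∃ b ∈ Q, G.Adj a b}) ∪
      {G | (∃ (a : V → Fin 20 → Fin k → V) (z : V → Fin 20 → Fin k → Fin m → V),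
        Sprouts G Q T₁ T₂ a z) ∧ ¬ ∃ W₀ W₁, IsMatchingDevice G lam R W₀ W₁} := by
    intro G hG
    by_contra hcon
    simp only [Set.mem_union, not_or, Set.mem_ofPred_eq, not_not] at hcon
    obtain ⟨⟨⟨e1, e2⟩, e3⟩, e4⟩ := hcon
    refine hG ⟨fun _ => ?_, fun hl l hll => ?_⟩
    · by_contra hno
      refine e4 ⟨?_, hno⟩
      rw [hK] at e1 e2
      exact exists_sprouts hQA hT₁A e1 e2 hκ hk hm (by rwa [cQ]) (by rwa [cQ])
    · refine hs.exists_pathDevice e1 e3 hT₁A (hRQ.trans hQA) (hYQ.trans hQA) (hCQ.trans hQA) hRY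
        hRC hYC hQT₁ hR hY hC hlam ?_ hll
      rw [hl]
      exact (Nat.ceil_lt_add_one ((by positivity : (0 : ℝ) ≤ n / x ^ 2).trans
        hs.div_sq_le_lowerEnd)).le
  have b1 := hs.gnp_not_expandsInto_le hp hA hT₁
  have b2 := hs.gnp_not_expandsInto_le hp hA hT₂
  have b3 := hs.gnp_not_joined_le hp hA
  have b4 := gnp_sprouts_not_matchingDevice_le hRY hRC hYC hQT₁ hQT₂' hT hR hY hC hlam hkm
  -- `exp (-(3x)) = n⁻³`, well below the main term.
  have hexp : Real.exp (-(3 * x)) ≤ x ^ 4 / n ^ 2 := by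
    have : Real.exp (-(3 * x)) = 1 / ((n : ℝ) ^ 2 * n) := by
      rw [Real.exp_neg, ← hs.exp_eq, ← pow_succ, ← Real.exp_nat_mul, one_div]
      norm_num
    rw [this, ← div_div, div_right_comm]
    gcongr
    have : (1 : ℝ) ≤ x ^ 4 := one_le_pow₀ (by linarith)
    have : (1 : ℝ) / n ≤ 1 := by rw [div_le_one hn]; linarith
    linarith
  have c1 : 2 / (lam : ℝ) ^ 2 ≤ 2 * (x ^ 4 / n ^ 2) := by
    have : x ^ 4 / (n : ℝ) ^ 2 = 1 / (n / x ^ 2) ^ 2 := by field_simp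
    rw [this, mul_one_div]
    gcongr
  have c2 : 420 * lam * (1 - (p : ℝ)) ^ (k * m * (6 * lam)) ≤ 420 * Real.exp (-(3 * x)) := by
    have d1 : (1 - (p : ℝ)) ^ (k * m * (6 * lam)) ≤ Real.exp (-(14 * x)) :=
      (one_sub_pow_le _).trans (Real.exp_le_exp.2 (neg_le_neg hkm'))
    have d2 : (lam : ℝ) ≤ Real.exp x := by rw [hs.exp_eq]; linarith
    calc _ ≤ 420 * Real.exp x * Real.exp (-(14 * x)) := by
          have := pow_nonneg (one_sub_nonneg (p := p)) (k * m * (6 * lam))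
          gcongr
      _ = 420 * Real.exp (x + -(14 * x)) := by rw [Real.exp_add]; ring
      _ ≤ _ := by
          gcongr
          linarith
  refine (measureReal_mono hsub (measure_ne_top _ _)).trans
    ((measureReal_union_le _ _).trans ((add_le_add ((measureReal_union_le _ _).trans
      (add_le_add ((measureReal_union_le _ _).trans (add_le_add b1 b2)) b3)) b4).trans ?_))
  have hnonneg : 0 ≤ x ^ 4 / (n : ℝ) ^ 2 := by positivity
  linarith

theorem isLittleO_log_pow_div :
    (fun n : ℕ => 500 * (Real.log n ^ 4 / (n : ℝ) ^ 2)) =o[Filter.atTop]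
      (fun n : ℕ => (n : ℝ)⁻¹) := by
  have h : (fun t : ℝ => Real.log t ^ 4) =o[Filter.atTop] (fun t : ℝ => t) :=
    Real.isLittleO_pow_log_id_atTop
  have h' := (h.comp_tendsto tendsto_natCast_atTop_atTop (k := fun n : ℕ => (n : ℝ)))
  have h2 := (h'.mul_isBigO
    (Asymptotics.isBigO_refl (fun n : ℕ => ((n : ℝ) ^ 2)⁻¹) _)).const_mul_left 500
  refine h2.congr' (Filter.Eventually.of_forall fun n => ?_) ?_
  · simp only [Function.comp, div_eq_mul_inv]
  · filter_upwards [Filter.eventually_gt_atTop 0] with n hn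
    have : (n : ℝ) ≠ 0 := by positivity
    simp only [Function.comp]
    field_simp

end

end LambdaDevice

theorem mainTheorem8 :
    ∃ f : ℕ → ℝ, f =o[Filter.atTop] (fun n : ℕ => (n : ℝ)⁻¹) ∧
      ∀ (lam n n' : ℕ) (p : unitInterval) (R : Finset (Fin n')),
        LambdaDevice.lowerEnd n ≤ lam →
        (lam : ℝ) ≤ n / (100 * Real.log n) →
        3 * (n : ℝ) / 4 ≤ n' →
        R.card = 6 * lam →
        (p : ℝ) = 10 ^ 5 * Real.log n / n →
        1 - f n ≤ (SimpleGraph.binomialRandom (Fin n') p).real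
          {G : SimpleGraph (Fin n') | LambdaDevice.HasDevice G n lam R} := by
  classical
  -- Where `n` is not huge, the value 1 makes the claim trivial; this affects only finitely many
  -- `n`.
  refine ⟨fun n => if ∃ x y, LambdaDevice.Scale n x y then
    500 * (Real.log n ^ 4 / (n : ℝ) ^ 2) else 1, ?_, ?_⟩
  · refine LambdaDevice.isLittleO_log_pow_div.congr' ?_ Filter.EventuallyEq.rfl
    filter_upwards [LambdaDevice.eventually_exists_scale] with n hn
    rw [if_pos hn]
  · intro lam n n' p R h1 h2 hn' hR hp
    beta_reduce
    by_cases h : ∃ x y, LambdaDevice.Scale n x y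
    · obtain ⟨x, y, hs⟩ := h
      have hbad := hs.gnp_not_hasDevice_le (V := Fin n') (p := p) (by rw [hp, hs.log_eq]) h1
        (by rwa [hs.log_eq] at h2) (by rwa [Fintype.card_fin]) hR
      -- Subadditivity for the event and its complement suffices, so measurability of the event is
      -- not needed.
      have htot := MeasureTheory.measureReal_union_le
        (μ := SimpleGraph.binomialRandom (Fin n') p)
        {G : SimpleGraph (Fin n') | LambdaDevice.HasDevice G n lam R}
        {G : SimpleGraph (Fin n') | ¬ LambdaDevice.HasDevice G n lam R}
      have huniv : {G : SimpleGraph (Fin n') | LambdaDevice.HasDevice G n lam R} ∪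
          {G : SimpleGraph (Fin n') | ¬ LambdaDevice.HasDevice G n lam R} = Set.univ := by
        ext G
        simp [em]
      rw [huniv, MeasureTheory.probReal_univ] at htot
      rw [if_pos ⟨x, y, hs⟩, hs.log_eq]
      linarith
    · rw [if_neg h, sub_self]
      exact MeasureTheory.measureReal_nonneg
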